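/- Let $V^1,V^2$ be vertex operator algebras over $\mathbb C$. Let $M^1,M^2,M^3$ be $V^1$-modules and $N^1,N^2,N^3$ be $V^2$-modules. Here a module is a weak module which is the direct sum of its finite-dimensional $L(0)$-eigenspaces $M_{(\lambda)}$, $\lambda\in\mathbb C$, such that for every fixed $\lambda$ one has $M_{(\lambda+n)}=0$ for all sufficiently small integers $n$. For a vertex operator algebra $V$ and weak $V$-modules $W^1,W^2,W^3$, let $I_V\binom{W^3}{W^1\,W^2}$ be the vector space of intertwining operators of this type, that is, of linear maps $\mathcal Y(\cdot,z)\colon W^1\to \mathrm{Hom}(W^2,W^3)\{z\}$, $u\mapsto\sum_{n\in\mathbb C}u_nz^{-n-1}$, such that * for all $u\in W^1$, $v\in W^2$, $\lambda\in\mathbb C$, $u_{n+\lambda}v=0$ for all sufficiently large integers $n$; * the Jacobi identity holds; * $\frac{d}{dz}\mathcal Y(u,z)=\mathcal Y(L(-1)u,z)$ for all $u\in W^1$. The fusion rule is $\dim I_V\binom{W^3}{W^1\,W^2}\in\{0,1,2,\dots,\infty\}$. The vertex operator algebra $V^1\otimes V^2$ acts on $M^i\otimes N^i$ by $Y(a\otimes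 b,z)=Y(a,z)\otimes Y(b,z)$; its vacuum is $\mathbf 1\otimes\mathbf 1$ and its Virasoro element is $\omega^1\otimes\mathbf 1+\mathbf 1\otimes\omega^2$. Write $$I_1=I_{V^1}\tbinom{M^3}{M^1\,M^2},\qquad I_2=I_{V^2}\tbinom{N^3}{N^1\,N^2},\qquad I_{12}=I_{V^1\otimes V^2}\tbinom{M^3\otimes N^3}{M^1\otimes N^1\;\,M^2\otimes N^2}.$$ For $\mathcal Y_1\in I_1$ and $\mathcal Y_2\in I_2$ put $$(\mathcal Y_1\otimes\mathcal Y_2)(u^1\otimes v^1,z)(u^2\otimes v^2)=\mathcal Y_1(u^1,z)u^2\otimes\mathcal Y_2(v^1,z)v^2 ,$$ and call this product well defined if for all $u^i\in M^i$, $v^i\in N^i$ $(i=1,2)$ and $n\in\mathbb C$ only finitely many of the terms $u^1_iu^2\otimes v^1_{n-1-i}v^2$, $i\in\mathbb C$, are nonzero; their sum is then the coefficient of $z^{-n-1}$. 1. If the weights of $M^3$ lie in finitely many cosets of $\mathbb Z$ in $\mathbb C$, or the weights of $N^3$ do, or $\dim I_1<\infty$, or $\dim I_2<\infty$, then $\mathcal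 Y_1\otimes\mathcal Y_2$ is well defined for all $\mathcal Y_1\in I_1$, $\mathcal Y_2\in I_2$. 2. If $\mathcal Y_1\otimes\mathcal Y_2$ is well defined for all $\mathcal Y_1\in I_1$, $\mathcal Y_2\in I_2$, then all these products lie in $I_{12}$, and the resulting linear map $$\sigma\colon I_1\otimes I_2\to I_{12},\qquad \mathcal Y_1\otimes\mathcal Y_2\mapsto\mathcal Y_1\otimes\mathcal Y_2,$$ is injective. If moreover $\dim I_1<\infty$ or $\dim I_2<\infty$, then $\sigma$ is a linear isomorphism. 3. Fusion rules are multiplicative: $\dim I_{12}=\dim I_1\cdot\dim I_2$ in $\{0,1,2,\dots,\infty\}$, where $0\cdot\infty=0$. -/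

import Mathlib

open scoped TensorProduct VertexOperator

noncomputable section

/-! ### Products of Laurent series of operators -/

section TensorSeries

variable {M N : Type*} [AddCommGroup M] [Module ℂ M] [AddCommGroup N] [Module ℂ N]

theorem tensorCoeff_support_finite (A : VertexOperator ℂ M) (B : VertexOperator ℂ N)
    (g : ℤ) (u : M) (v : N) :
    (Function.support fun p : ℤ =>
      (HVertexOperator.coeff A p u ⊗ₜ[ℂ] HVertexOperator.coeff B (g - p) v : M ⊗[ℂ] N)).Finite := by
  have h := Set.AddAntidiagonal.finite_of_isPWO
    (HVertexOperator.coeff_isPWOsupport A u) (HVertexOperator.coeff_isPWOsupport B v) g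
  refine (h.image Prod.fst).subset ?_
  intro p hp
  refine ⟨(p, g - p), ?_, rfl⟩
  refine ⟨fun h0 => hp ?_, fun h0 => hp ?_, by simp⟩
  · have h1 : HVertexOperator.coeff A p u = 0 := h0
    show HVertexOperator.coeff A p u ⊗ₜ[ℂ] HVertexOperator.coeff B (g - p) v = 0
    rw [h1, TensorProduct.zero_tmul]
  · have h1 : HVertexOperator.coeff B (g - p) v = 0 := h0
    show HVertexOperator.coeff A p u ⊗ₜ[ℂ] HVertexOperator.coeff B (g - p) v = 0
    rw [h1, TensorProduct.tmul_zero]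

/-- The coefficient of `z ^ g` in `A(z) ⊗ B(z)`. -/
def tensorCoeff (A : VertexOperator ℂ M) (B : VertexOperator ℂ N) (g : ℤ) :
    M ⊗[ℂ] N →ₗ[ℂ] M ⊗[ℂ] N :=
  TensorProduct.lift <| LinearMap.mk₂ ℂ
    (fun u v => ∑ᶠ p : ℤ,
      HVertexOperator.coeff A p u ⊗ₜ[ℂ] HVertexOperator.coeff B (g - p) v)
    (fun u u' v => by
      rw [← finsum_add_distrib (tensorCoeff_support_finite A B g u v)
        (tensorCoeff_support_finite A B g u' v)]
      exact finsum_congr fun p => by rw [map_add, TensorProduct.add_tmul])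
    (fun c u v => by
      rw [smul_finsum' c (tensorCoeff_support_finite A B g u v)]
      exact finsum_congr fun p => by rw [map_smul, TensorProduct.smul_tmul'])
    (fun u v v' => by
      rw [← finsum_add_distrib (tensorCoeff_support_finite A B g u v)
        (tensorCoeff_support_finite A B g u v')]
      exact finsum_congr fun p => by rw [map_add, TensorProduct.tmul_add])
    (fun c u v => by
      rw [smul_finsum' c (tensorCoeff_support_finite A B g u v)]
      exact finsum_congr fun p => by rw [map_smul, TensorProduct.tmul_smul])

theorem tensorCoeff_tmul (A : VertexOperator ℂ M) (B : VertexOperator ℂ N) (g : ℤ)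
    (u : M) (v : N) :
    tensorCoeff A B g (u ⊗ₜ v) = ∑ᶠ p : ℤ,
      HVertexOperator.coeff A p u ⊗ₜ[ℂ] HVertexOperator.coeff B (g - p) v := rfl

theorem tensorCoeff_support_isPWO (A : VertexOperator ℂ M) (B : VertexOperator ℂ N)
    (x : M ⊗[ℂ] N) : (Function.support fun g => tensorCoeff A B g x).IsPWO := by
  induction x using TensorProduct.induction_on with
  | zero => simp
  | tmul u v =>
    refine ((HVertexOperator.coeff_isPWOsupport A u).add
      (HVertexOperator.coeff_isPWOsupport B v)).mono ?_
    intro g hg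
    by_contra hcon
    refine hg ?_
    show tensorCoeff A B g (u ⊗ₜ v) = 0
    rw [tensorCoeff_tmul]
    refine finsum_eq_zero_of_forall_eq_zero fun p => ?_
    by_contra hp
    refine hcon ⟨p, fun h0 => hp ?_, g - p, fun h0 => hp ?_, by simp⟩
    · have h1 : HVertexOperator.coeff A p u = 0 := h0
      rw [h1, TensorProduct.zero_tmul]
    · have h1 : HVertexOperator.coeff B (g - p) v = 0 := h0
      rw [h1, TensorProduct.tmul_zero]
  | add x y hx hy =>
    refine (hx.union hy).mono ?_
    intro g hg
    by_contra hcon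
    rw [Set.mem_union, not_or] at hcon
    refine hg ?_
    have h1 : tensorCoeff A B g x = 0 := by simpa using hcon.1
    have h2 : tensorCoeff A B g y = 0 := by simpa using hcon.2
    show tensorCoeff A B g (x + y) = 0
    rw [map_add, h1, h2, add_zero]

/-- The vertex operator `A(z) ⊗ B(z)` on `M ⊗ N`. -/
def tensorVertexOperator (A : VertexOperator ℂ M) (B : VertexOperator ℂ N) :
    VertexOperator ℂ (M ⊗[ℂ] N) :=
  HVertexOperator.of_coeff (tensorCoeff A B) (tensorCoeff_support_isPWO A B)

theorem coeff_tensorVertexOperator_tmul (A : VertexOperator ℂ M) (B : VertexOperator ℂ N)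
    (g : ℤ) (u : M) (v : N) :
    HVertexOperator.coeff (tensorVertexOperator A B) g (u ⊗ₜ v) = ∑ᶠ p : ℤ,
      HVertexOperator.coeff A p u ⊗ₜ[ℂ] HVertexOperator.coeff B (g - p) v := rfl

theorem tensorVertexOperator_ext {A B : VertexOperator ℂ (M ⊗[ℂ] N)}
    (h : ∀ g u v, HVertexOperator.coeff A g (u ⊗ₜ v) = HVertexOperator.coeff B g (u ⊗ₜ v)) :
    A = B := by
  apply HVertexOperator.coeff_inj
  funext g
  exact TensorProduct.ext' (h g)

variable {V W : Type*} [AddCommGroup V] [Module ℂ V] [AddCommGroup W] [Module ℂ W]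

/-- The action `Y(a ⊗ b, z) = Y(a, z) ⊗ Y(b, z)` of `V ⊗ W` on `M ⊗ N`, for `V` acting on `M` and
`W` acting on `N`. -/
def tensorAction (Y : V →ₗ[ℂ] VertexOperator ℂ M) (Y' : W →ₗ[ℂ] VertexOperator ℂ N) :
    V ⊗[ℂ] W →ₗ[ℂ] VertexOperator ℂ (M ⊗[ℂ] N) :=
  TensorProduct.lift <| LinearMap.mk₂ ℂ (fun a b => tensorVertexOperator (Y a) (Y' b))
    (fun a a' b => tensorVertexOperator_ext fun g u v => by
      rw [map_add HVertexOperator.coeff]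
      simp only [Pi.add_apply, LinearMap.add_apply, coeff_tensorVertexOperator_tmul]
      rw [← finsum_add_distrib (tensorCoeff_support_finite _ _ g u v)
        (tensorCoeff_support_finite _ _ g u v)]
      refine finsum_congr fun p => ?_
      rw [map_add Y, map_add HVertexOperator.coeff, Pi.add_apply, LinearMap.add_apply,
        TensorProduct.add_tmul])
    (fun c a b => tensorVertexOperator_ext fun g u v => by
      rw [map_smul HVertexOperator.coeff]
      simp only [Pi.smul_apply, LinearMap.smul_apply, coeff_tensorVertexOperator_tmul]
      rw [smul_finsum' c (tensorCoeff_support_finite _ _ g u v)]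
      refine finsum_congr fun p => ?_
      rw [map_smul Y, map_smul HVertexOperator.coeff, Pi.smul_apply, LinearMap.smul_apply,
        TensorProduct.smul_tmul'])
    (fun a b b' => tensorVertexOperator_ext fun g u v => by
      rw [map_add HVertexOperator.coeff]
      simp only [Pi.add_apply, LinearMap.add_apply, coeff_tensorVertexOperator_tmul]
      rw [← finsum_add_distrib (tensorCoeff_support_finite _ _ g u v)
        (tensorCoeff_support_finite _ _ g u v)]
      refine finsum_congr fun p => ?_
      rw [map_add Y', map_add HVertexOperator.coeff, Pi.add_apply, LinearMap.add_apply,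
        TensorProduct.tmul_add])
    (fun c a b => tensorVertexOperator_ext fun g u v => by
      rw [map_smul HVertexOperator.coeff]
      simp only [Pi.smul_apply, LinearMap.smul_apply, coeff_tensorVertexOperator_tmul]
      rw [smul_finsum' c (tensorCoeff_support_finite _ _ g u v)]
      refine finsum_congr fun p => ?_
      rw [map_smul Y', map_smul HVertexOperator.coeff, Pi.smul_apply, LinearMap.smul_apply,
        TensorProduct.tmul_smul])

/-- In modes: `(a ⊗ b)ₙ (u ⊗ v) = ∑ᵢ aᵢ u ⊗ bₙ₋₁₋ᵢ v`. -/
theorem tensorAction_ncoeff (Y : V →ₗ[ℂ] VertexOperator ℂ M) (Y' : W →ₗ[ℂ] VertexOperator ℂ N)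
    (a : V) (b : W) (n : ℤ) (u : M) (v : N) :
    ((tensorAction Y Y' (a ⊗ₜ b))[[n]]) (u ⊗ₜ v) =
      ∑ᶠ i : ℤ, ((Y a)[[i]]) u ⊗ₜ[ℂ] ((Y' b)[[n - 1 - i]]) v := by
  have h : ((tensorAction Y Y' (a ⊗ₜ b))[[n]]) (u ⊗ₜ v) = ∑ᶠ p : ℤ,
      HVertexOperator.coeff (Y a) p u ⊗ₜ[ℂ] HVertexOperator.coeff (Y' b) (-n - 1 - p) v := rfl
  rw [h]
  refine finsum_eq_of_bijective (fun p : ℤ => -p - 1) ?_ ?_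
  · exact Function.Involutive.bijective fun p => by simp
  · intro p
    rw [VertexOperator.ncoeff_apply, VertexOperator.ncoeff_apply]
    congr 3 <;> ring_nf

end TensorSeries

/-! ### Vertex operator algebras and their modules -/

section VOA

variable {V M M₁ M₂ M₃ : Type*} [AddCommGroup V] [Module ℂ V] [AddCommGroup M] [Module ℂ M]
  [AddCommGroup M₁] [Module ℂ M₁] [AddCommGroup M₂] [Module ℂ M₂] [AddCommGroup M₃] [Module ℂ M₃]

/-- The Jacobi identity
`z₀⁻¹ δ((z₁ - z₂)/z₀) Y₃(a, z₁) 𝒴(u, z₂) v - z₀⁻¹ δ((z₂ - z₁)/(-z₀)) 𝒴(u, z₂) Y₂(a, z₁) v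
  = z₂⁻¹ δ((z₁ - z₀)/z₂) 𝒴(Y₁(a, z₀) u, z₂) v`,
written as the equality of the coefficients of `z₀^(-l-1) z₁^(-m-1) z₂^(-n-1)`.
Here `𝒴 u n` is the coefficient of `z^(-n-1)` in `𝒴(u, z)`, and `n` ranges over `ι`,
which is `ℤ` for vertex operators and `ℂ` for intertwining operators. -/
def JacobiIdentity {ι : Type*} [Ring ι] (Y₁ : V →ₗ[ℂ] VertexOperator ℂ M₁)
    (Y₂ : V →ₗ[ℂ] VertexOperator ℂ M₂) (Y₃ : V →ₗ[ℂ] VertexOperator ℂ M₃)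
    (𝒴 : M₁ → ι → M₂ →ₗ[ℂ] M₃) : Prop :=
  ∀ (a : V) (u : M₁) (v : M₂) (l m : ℤ) (n : ι),
    (∑ᶠ i : ℕ, ((-1) ^ i * Ring.choose l i : ℤ) •
        ((Y₃ a)[[l + m - i]]) (𝒴 u (n + (i : ι)) v)) -
      (∑ᶠ i : ℕ, ((l.negOnePow : ℤ) * (-1) ^ i * Ring.choose l i : ℤ) •
        𝒴 u ((l : ι) + n - (i : ι)) (((Y₂ a)[[m + i]]) v)) =
      ∑ᶠ i : ℕ, (Ring.choose m i : ℤ) •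
        𝒴 (((Y₁ a)[[l + i]]) u) ((m : ι) + n - (i : ι)) v

/-- The data of a vertex operator algebra: the vertex operator map
`Y(a, z) = ∑ₙ aₙ z^(-n-1)` (where `aₙ = (Y a)[[n]]`, and `Y(a, z) u` is a Laurent series
for every `u`), the vacuum vector and the Virasoro element. -/
structure VertexData (V : Type*) [AddCommGroup V] [Module ℂ V] where
  /-- the vertex operator map -/
  Y : V →ₗ[ℂ] VertexOperator ℂ V
  /-- the vacuum vector -/
  vacuum : V
  /-- the Virasoro element -/
  conformal : V

namespace VertexData

/-- `L(n)` acting on `M`, where `Y_M(ω, z) = ∑ₙ L(n) z^(-n-2)`. -/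
def vir (D : VertexData V) (YM : V →ₗ[ℂ] VertexOperator ℂ M) (n : ℤ) : Module.End ℂ M :=
  (YM D.conformal)[[n + 1]]

/-- The weight space `M_(h)`: the eigenspace of `L(0)` with eigenvalue `h`. -/
def weightSpace (D : VertexData V) (YM : V →ₗ[ℂ] VertexOperator ℂ M) (h : ℂ) : Submodule ℂ M :=
  (D.vir YM 0).eigenspace h

/-- `(V, Y, 𝟏, ω)` is a vertex operator algebra. -/
structure IsVOA (D : VertexData V) : Prop where
  vacuum_left : ∀ n : ℤ, (D.Y D.vacuum)[[n]] = if n = -1 then 1 else 0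
  creation : ∀ (a : V) (n : ℤ), 0 ≤ n → ((D.Y a)[[n]]) D.vacuum = 0
  creation_neg_one : ∀ a : V, ((D.Y a)[[-1]]) D.vacuum = a
  jacobi : JacobiIdentity D.Y D.Y D.Y fun b n => (D.Y b)[[n]]
  virasoro : ∃ c : ℂ, ∀ m n : ℤ,
    D.vir D.Y m * D.vir D.Y n - D.vir D.Y n * D.vir D.Y m =
      ((m : ℂ) - n) • D.vir D.Y (m + n) +
        (if m + n = 0 then ((m : ℂ) ^ 3 - m) / 12 * c else 0) • (1 : Module.End ℂ V)
  /-- `Y(L(-1) a, z) = d/dz Y(a, z)` -/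
  derivative : ∀ (a : V) (n : ℤ),
    (D.Y (D.vir D.Y (-1) a))[[n]] = (-n : ℂ) • (D.Y a)[[n - 1]]
  grading : DirectSum.IsInternal fun n : ℤ => D.weightSpace D.Y n
  finite_weightSpace : ∀ n : ℤ, Module.Finite ℂ (D.weightSpace D.Y n)
  lower_bounded : ∃ N : ℤ, ∀ n : ℤ, n < N → D.weightSpace D.Y n = ⊥
  vacuum_mem : D.vacuum ∈ D.weightSpace D.Y 0
  conformal_mem : D.conformal ∈ D.weightSpace D.Y 2

/-- `(M, Y_M)` is a weak module. (That `Y_M(a, z) u` is a Laurent series is part of the type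
of `Y_M`.) -/
structure IsWeakModule (D : VertexData V) (YM : V →ₗ[ℂ] VertexOperator ℂ M) : Prop where
  vacuum : ∀ n : ℤ, (YM D.vacuum)[[n]] = if n = -1 then 1 else 0
  jacobi : JacobiIdentity D.Y YM YM fun b n => (YM b)[[n]]

/-- `(M, Y_M)` is a module: a weak module that is the direct sum of its finite-dimensional
weight spaces `M_(h)`, `h ∈ ℂ`, with `M_(h+n) = 0` for fixed `h` and integers `n` sufficiently
small. -/
structure IsModule (D : VertexData V) (YM : V →ₗ[ℂ] VertexOperator ℂ M) : Prop
    extends D.IsWeakModule YM where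
  grading : DirectSum.IsInternal fun h : ℂ => D.weightSpace YM h
  finite_weightSpace : ∀ h : ℂ, Module.Finite ℂ (D.weightSpace YM h)
  lower_bounded : ∀ h : ℂ, ∃ N : ℤ, ∀ n : ℤ, n < N → D.weightSpace YM (h + n) = ⊥

/-- The weights of `M` lie in finitely many cosets of `ℤ` in `ℂ`. -/
def FinitelyManyCosets (D : VertexData V) (YM : V →ₗ[ℂ] VertexOperator ℂ M) : Prop :=
  ∃ S : Finset ℂ, ∀ h : ℂ, D.weightSpace YM h ≠ ⊥ → ∃ s ∈ S, ∃ k : ℤ, h = s + k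

/-- `𝒴(u, z) = ∑_{n ∈ ℂ} uₙ z^(-n-1)`, with `uₙ = 𝒴 u n`, is an intertwining operator of type
`(M₃ over M₁ M₂)`. -/
structure IsIntertwining (D : VertexData V) (Y₁ : V →ₗ[ℂ] VertexOperator ℂ M₁)
    (Y₂ : V →ₗ[ℂ] VertexOperator ℂ M₂) (Y₃ : V →ₗ[ℂ] VertexOperator ℂ M₃)
    (𝒴 : M₁ →ₗ[ℂ] ℂ → M₂ →ₗ[ℂ] M₃) : Prop where
  truncation : ∀ (u : M₁) (v : M₂) (c : ℂ), ∃ N : ℤ, ∀ n : ℤ, N ≤ n → 𝒴 u (n + c) v = 0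
  jacobi : JacobiIdentity Y₁ Y₂ Y₃ fun u n => 𝒴 u n
  /-- `d/dz 𝒴(u, z) = 𝒴(L(-1) u, z)` -/
  derivative : ∀ (u : M₁) (n : ℂ), 𝒴 (D.vir Y₁ (-1) u) n = (-n) • 𝒴 u (n - 1)

theorem ncoeff_support_finite (A : VertexOperator ℂ M) (k : ℤ) (u : M) :
    (Function.support fun i : ℕ => (A[[k + i]]) u).Finite := by
  refine (Set.finite_Iic
    (-k - 1 - HahnSeries.order ((HahnModule.of ℂ).symm (A u))).toNat).subset ?_
  intro i hi
  by_contra hcon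
  rw [Set.mem_Iic, not_le] at hcon
  refine hi (VertexOperator.ncoeff_eq_zero_of_lt_order A _ u ?_)
  omega

namespace IsIntertwining

variable {D : VertexData V} {Y₁ : V →ₗ[ℂ] VertexOperator ℂ M₁} {Y₂ : V →ₗ[ℂ] VertexOperator ℂ M₂}
  {Y₃ : V →ₗ[ℂ] VertexOperator ℂ M₃} {𝒴 𝒵 : M₁ →ₗ[ℂ] ℂ → M₂ →ₗ[ℂ] M₃}

theorem support_finite (h : D.IsIntertwining Y₁ Y₂ Y₃ 𝒴) (u : M₁) (v : M₂) (n : ℂ) :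
    (Function.support fun i : ℕ => 𝒴 u (n + (i : ℂ)) v).Finite := by
  obtain ⟨N, hN⟩ := h.truncation u v n
  refine (Set.finite_Iic N.toNat).subset ?_
  intro i hi
  by_contra hcon
  rw [Set.mem_Iic, not_le] at hcon
  refine hi ?_
  have h1 := hN i (by omega)
  rw [Int.cast_natCast, add_comm] at h1
  exact h1

theorem zero : D.IsIntertwining Y₁ Y₂ Y₃ 0 where
  truncation _ _ _ := ⟨0, fun _ _ => rfl⟩
  jacobi _ _ _ _ _ _ := by simp
  derivative _ _ := by simp

theorem add (h : D.IsIntertwining Y₁ Y₂ Y₃ 𝒴) (h' : D.IsIntertwining Y₁ Y₂ Y₃ 𝒵) :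
    D.IsIntertwining Y₁ Y₂ Y₃ (𝒴 + 𝒵) where
  truncation u v c := by
    obtain ⟨N, hN⟩ := h.truncation u v c
    obtain ⟨N', hN'⟩ := h'.truncation u v c
    refine ⟨max N N', fun n hn => ?_⟩
    simp [hN n (le_trans (le_max_left _ _) hn), hN' n (le_trans (le_max_right _ _) hn)]
  jacobi a u v l m n := by
    have e := h.jacobi a u v l m n
    have e' := h'.jacobi a u v l m n
    simp only [LinearMap.add_apply, Pi.add_apply, map_add, smul_add]
    rw [finsum_add_distrib, finsum_add_distrib, finsum_add_distrib, ← e, ← e']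
    · abel
    · exact (ncoeff_support_finite (Y₁ a) l u).subset fun i hi h0 => hi (by simp [h0])
    · exact (ncoeff_support_finite (Y₁ a) l u).subset fun i hi h0 => hi (by simp [h0])
    · exact (ncoeff_support_finite (Y₂ a) m v).subset fun i hi h0 => hi (by simp [h0])
    · exact (ncoeff_support_finite (Y₂ a) m v).subset fun i hi h0 => hi (by simp [h0])
    · exact (h.support_finite u v n).subset fun i hi h0 => hi (by simp [h0])
    · exact (h'.support_finite u v n).subset fun i hi h0 => hi (by simp [h0])
  derivative u n := by
    simp only [LinearMap.add_apply, Pi.add_apply, h.derivative, h'.derivative, smul_add]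

theorem smul (c : ℂ) (h : D.IsIntertwining Y₁ Y₂ Y₃ 𝒴) :
    D.IsIntertwining Y₁ Y₂ Y₃ (c • 𝒴) where
  truncation u v d := by
    obtain ⟨N, hN⟩ := h.truncation u v d
    exact ⟨N, fun n hn => by simp [hN n hn]⟩
  jacobi a u v l m n := by
    have e := congrArg (c • ·) (h.jacobi a u v l m n)
    simp only [smul_sub] at e
    rw [smul_finsum', smul_finsum', smul_finsum'] at e
    · simp only [LinearMap.smul_apply, Pi.smul_apply, map_smul]
      simp only [smul_comm _ c]
      exact e
    · exact (ncoeff_support_finite (Y₁ a) l u).subset fun i hi h0 => hi (by simp [h0])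
    · exact (ncoeff_support_finite (Y₂ a) m v).subset fun i hi h0 => hi (by simp [h0])
    · exact (h.support_finite u v n).subset fun i hi h0 => hi (by simp [h0])
  derivative u n := by
    simp only [LinearMap.smul_apply, Pi.smul_apply, h.derivative]
    rw [smul_comm]

end IsIntertwining

/-- The space of intertwining operators of type `(M₃ over M₁ M₂)`. -/
def intertwiners (D : VertexData V) (Y₁ : V →ₗ[ℂ] VertexOperator ℂ M₁)
    (Y₂ : V →ₗ[ℂ] VertexOperator ℂ M₂) (Y₃ : V →ₗ[ℂ] VertexOperator ℂ M₃) :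
    Submodule ℂ (M₁ →ₗ[ℂ] ℂ → M₂ →ₗ[ℂ] M₃) where
  carrier := {𝒴 | D.IsIntertwining Y₁ Y₂ Y₃ 𝒴}
  add_mem' h h' := h.add h'
  zero_mem' := IsIntertwining.zero
  smul_mem' c _ h := h.smul c

/-- The fusion rule: the dimension, in `{0, 1, 2, …, ∞}`, of the space of intertwining operators. -/
def fusionRule (D : VertexData V) (Y₁ : V →ₗ[ℂ] VertexOperator ℂ M₁)
    (Y₂ : V →ₗ[ℂ] VertexOperator ℂ M₂) (Y₃ : V →ₗ[ℂ] VertexOperator ℂ M₃) : ℕ∞ :=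
  Cardinal.toENat (Module.rank ℂ (D.intertwiners Y₁ Y₂ Y₃))

/-- The tensor product of two vertex operator algebras. -/
def tensor {W : Type*} [AddCommGroup W] [Module ℂ W] (D : VertexData V) (E : VertexData W) :
    VertexData (V ⊗[ℂ] W) where
  Y := tensorAction D.Y E.Y
  vacuum := D.vacuum ⊗ₜ E.vacuum
  conformal := D.conformal ⊗ₜ E.vacuum + D.vacuum ⊗ₜ E.conformal

end VertexData

end VOA

/-! ### Tensor products of intertwining operators -/

section TensorIntertwiners

variable {M₁ M₂ M₃ N₁ N₂ N₃ : Type*}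
  [AddCommGroup M₁] [Module ℂ M₁] [AddCommGroup M₂] [Module ℂ M₂] [AddCommGroup M₃] [Module ℂ M₃]
  [AddCommGroup N₁] [Module ℂ N₁] [AddCommGroup N₂] [Module ℂ N₂] [AddCommGroup N₃] [Module ℂ N₃]

/-- The product `𝒴₁(u₁, z) u₂ ⊗ 𝒴₂(v₁, z) v₂` is well defined for all `u₁, u₂, v₁, v₂`, that is,
the coefficient of each power `z^(-n-1)` is a finite sum. -/
def HasTensor (𝒴₁ : M₁ →ₗ[ℂ] ℂ → M₂ →ₗ[ℂ] M₃) (𝒴₂ : N₁ →ₗ[ℂ] ℂ → N₂ →ₗ[ℂ] N₃) : Prop :=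
  ∀ (u₁ : M₁) (u₂ : M₂) (v₁ : N₁) (v₂ : N₂) (n : ℂ),
    {i : ℂ | 𝒴₁ u₁ i u₂ ⊗ₜ[ℂ] 𝒴₂ v₁ (n - 1 - i) v₂ ≠ 0}.Finite

/-- `𝒴` is the operator `𝒴₁ ⊗ 𝒴₂`, given by
`𝒴(u₁ ⊗ v₁, z)(u₂ ⊗ v₂) = 𝒴₁(u₁, z) u₂ ⊗ 𝒴₂(v₁, z) v₂`. -/
def IsTensor (𝒴₁ : M₁ →ₗ[ℂ] ℂ → M₂ →ₗ[ℂ] M₃) (𝒴₂ : N₁ →ₗ[ℂ] ℂ → N₂ →ₗ[ℂ] N₃)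
    (𝒴 : M₁ ⊗[ℂ] N₁ →ₗ[ℂ] ℂ → M₂ ⊗[ℂ] N₂ →ₗ[ℂ] M₃ ⊗[ℂ] N₃) : Prop :=
  HasTensor 𝒴₁ 𝒴₂ ∧
    ∀ (u₁ : M₁) (u₂ : M₂) (v₁ : N₁) (v₂ : N₂) (n : ℂ),
      𝒴 (u₁ ⊗ₜ v₁) n (u₂ ⊗ₜ v₂) = ∑ᶠ i : ℂ, 𝒴₁ u₁ i u₂ ⊗ₜ[ℂ] 𝒴₂ v₁ (n - 1 - i) v₂

end TensorIntertwiners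

end

noncomputable section

/-! ### Finite sums -/

/-! Well-definedness. Within one coset of `ℤ`, the index `i` in `uᵢ u' ⊗ v_{n-1-i} v'` is bounded
above by truncation of the first factor and below by truncation of the second. So a product is well
defined as soon as, for each pair of vectors, one factor uses only finitely many cosets. If the
weights of its target lie in finitely many cosets, this follows from the weight formula `wt u + wt
u' - i - 1` (`FinitelyManyCosets.finite_intCoset`). If its space of intertwining operators is
finite-dimensional, it follows because the part of an intertwining operator with exponents in one
coset is again an intertwining operator, and nonzero parts for different cosets are linearly
independent (`finiteCosetIntertwiners_eq`).

The product is an intertwining operator. Truncation is not automatic when infinitely many cosets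
occur, since well-definedness treats each `n` separately. The commutator with `L(1)` propagates a
nonzero coefficient to lower indices in its coset, so every coset seen at large total index is, with
one exception, already seen at one fixed total index (`exists_tensor_bound`). The Jacobi identity is
replaced by weak commutativity and weak associativity. These are multiplicative, and together they
imply it (`expansion_of_weak`, `conv_leftExpansion`, `IsJacobiTriple.conv`).

Injectivity and surjectivity. For homogeneous `u`, `v` and a homogeneous functional `ψ`, only one
index `n` can give `ψ (uₙ v) ≠ 0`. These numbers separate intertwining operators and multiply under
products, which gives injectivity. Fixing homogeneous data in the second tensor factors turns an
intertwining operator for `V¹ ⊗ V²` into one for `V¹`, up to a power of `z`, and symmetrically for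
the first factors (`exists_left_slice`, `exists_right_slice`). Thus it is a matrix whose columns
come from `I₁` and whose rows come from `I₂`. If one of the two spaces is finite-dimensional, such a
matrix comes from `I₁ ⊗ I₂` (`surjective_of_slices`).

Fusion rules. If `I₁` or `I₂` is finite-dimensional, `σ` is an isomorphism. If both are
infinite-dimensional, the operators in `I₁` with exponents in finitely many cosets still form an
infinite-dimensional space. Their products with a fixed nonzero element of `I₂` are defined and
embed this space in `I₁₂`. -/

theorem finsum_nat_eq_add_succ {X : Type*} [AddCommGroup X] {f : ℕ → X}
    (hf : (Function.support f).Finite) : ∑ᶠ i, f i = f 0 + ∑ᶠ i, f (i + 1) := by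
  obtain ⟨N, hN⟩ := hf.bddAbove
  rw [finsum_eq_finsetSum_of_support_subset f (s := Finset.range (N + 1)),
    finsum_eq_finsetSum_of_support_subset (fun i => f (i + 1)) (s := Finset.range N),
    Finset.sum_range_succ', add_comm]
  · intro i hi
    have := hN (show i + 1 ∈ Function.support f from hi)
    simp only [Finset.coe_range, Set.mem_Iio]
    omega
  · intro i hi
    have := hN hi
    simp only [Finset.coe_range, Set.mem_Iio]
    omega

theorem finsum_antidiagonal {X : Type*} [AddCommGroup X] {f : ℕ × ℕ → X}
    (hf : (Function.support f).Finite) :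
    ∑ᶠ x, f x = ∑ᶠ i, ∑ x ∈ Finset.HasAntidiagonal.antidiagonal i, f x := by
  classical
  rw [← finsum_comp_equiv Finset.HasAntidiagonal.sigmaAntidiagonalEquivProd]
  have hg : (Function.support fun x : (Σ n : ℕ, Finset.HasAntidiagonal.antidiagonal n) =>
      f (Finset.HasAntidiagonal.sigmaAntidiagonalEquivProd x)).Finite :=
    hf.preimage (Finset.HasAntidiagonal.sigmaAntidiagonalEquivProd.injective.injOn)
  set S : Finset ℕ := hf.toFinset.image fun x => x.1 + x.2 with hS
  have h0 : ∀ x, f x ≠ 0 → x.1 + x.2 ∈ S := fun x hx =>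
    Finset.mem_image.2 ⟨x, hf.mem_toFinset.2 hx, rfl⟩
  rw [finsum_eq_finsetSum_of_support_subset (s := S.sigma fun _ => Finset.univ),
    Finset.sum_sigma, finsum_eq_finsetSum_of_support_subset (s := S)]
  · refine Finset.sum_congr rfl fun i _ => ?_
    exact Finset.sum_coe_sort (Finset.HasAntidiagonal.antidiagonal i) fun x => f x
  · intro i hi
    obtain ⟨x, hx, hx0⟩ := Finset.exists_ne_zero_of_sum_ne_zero hi
    rw [← Finset.HasAntidiagonal.mem_antidiagonal.1 hx]
    exact h0 x hx0
  · rintro ⟨i, x, hx⟩ h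
    have := h0 x h
    rw [Finset.HasAntidiagonal.mem_antidiagonal.1 hx] at this
    simpa using this

/-- Multiplication of the power series with coefficients `c` by `1 + ε x`. The three recursions for
the expansions below are instances. -/
theorem finsum_pascal {X : Type*} [AddCommGroup X] {G : ℕ → X}
    (hG : (Function.support G).Finite) (c c' : ℕ → ℤ) (ε : ℤ) (h0 : c' 0 = c 0)
    (h1 : ∀ i, c' (i + 1) = c (i + 1) + ε * c i) :
    ∑ᶠ i, c' i • G i = ∑ᶠ i, c i • G i + ε • ∑ᶠ i, c i • G (i + 1) := by
  have hG' : (Function.support fun i => G (i + 1)).Finite :=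
    hG.preimage (add_left_injective 1).injOn
  have h (d : ℕ → ℤ) : (Function.support fun i => d i • G i).Finite :=
    hG.subset fun i hi h0 => hi (by simp [h0])
  have h' (d : ℕ → ℤ) : (Function.support fun i => d i • G (i + 1)).Finite :=
    hG'.subset fun i hi h0 => hi (by simp [h0])
  rw [finsum_nat_eq_add_succ (h c'), finsum_nat_eq_add_succ (h c), h0,
    smul_finsum' _ (h' c), add_assoc, ← finsum_add_distrib (h' fun i => c (i + 1))]
  · simp only [h1, add_smul, mul_smul]
  · exact (h' c).subset fun i hi h0 => hi (by simp [h0])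

/-! ### The formal content of the Jacobi identity -/

section Formal

variable {ι X X' : Type*} [CommRing ι] [AddCommGroup X] [AddCommGroup X']

/-- The coefficient `(-1) ^ i * (l choose i)`. -/
def altChoose (l : ℤ) (i : ℕ) : ℤ := (-1) ^ i * Ring.choose l i

theorem altChoose_zero (l : ℤ) : altChoose l 0 = 1 := by simp [altChoose]

theorem altChoose_succ_succ (l : ℤ) (i : ℕ) :
    altChoose (l + 1) (i + 1) = altChoose l (i + 1) + (-1) * altChoose l i := by
  simp only [altChoose, Ring.choose_succ_succ]; ring

theorem altChoose_eq (a : ℤ) (j : ℕ) : altChoose (a + j) j = Ring.choose (-a - 1) j := by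
  rw [show -a - 1 = -(a + 1) by ring, Ring.choose_neg, altChoose, Units.smul_def, smul_eq_mul,
    Int.coe_negOnePow_natCast]
  congr 2
  ring

/-- Negating the upper entry by `altChoose_eq` removes its dependence on the summation index, and
the identity becomes Chu–Vandermonde. -/
theorem sum_antidiagonal_altChoose (a b : ℤ) (i : ℕ) :
    ∑ x ∈ Finset.HasAntidiagonal.antidiagonal i, altChoose (a + x.1) x.1 * altChoose (b + x.2) x.2 =
      altChoose (a + b + 1 + i) i := by
  rw [altChoose_eq, show -(a + b + 1) - 1 = (-a - 1) + (-b - 1) by ring,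
    Ring.add_choose_eq i (Commute.all _ _)]
  simp only [altChoose_eq]

/-- Multiplication of a series by `(z₁ - z₂) ^ l z₁ ^ m`, expanded in powers of `z₂`. -/
def leftExpansion (F : ℤ → ι → X) (l m : ℤ) (n : ι) : X :=
  ∑ᶠ i : ℕ, altChoose l i • F (l + m - i) (n + i)

/-- Multiplication of a series by `(z₁ - z₂) ^ l z₁ ^ m`, expanded in powers of `z₁`. -/
def rightExpansion (F : ℤ → ι → X) (l m : ℤ) (n : ι) : X :=
  ∑ᶠ i : ℕ, ((l.negOnePow : ℤ) * altChoose l i) • F (m + i) (l + n - i)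

/-- Multiplication of a series by `z₀ ^ l (z₂ + z₀) ^ m`, expanded in powers of `z₀`. -/
def innerExpansion (F : ℤ → ι → X) (l m : ℤ) (n : ι) : X :=
  ∑ᶠ i : ℕ, Ring.choose m i • F (l + i) (m + n - i)

/-- Multiplication of a series by `z₁ + ε z₂`. -/
def mulAdd (ε : ℤ) (F : ℤ → ι → X) : ℤ → ι → X := fun p q => F (p + 1) q + ε • F p (q + 1)

/-- Translation of a series. -/
def shiftIndex (r : ℤ) (s : ι) (F : ℤ → ι → X) : ℤ → ι → X := fun p q => F (p + r) (q + s)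

theorem mulAdd_eq (ε : ℤ) (F : ℤ → ι → X) :
    mulAdd ε F = shiftIndex 1 0 F + ε • shiftIndex 0 1 F := by
  funext p q
  simp [mulAdd, shiftIndex]

/-- One factor `z₁ - z₂` is split off. With `rightExpansion_add_one` and `innerExpansion_add_one`,
this shows that all three terms of the Jacobi identity obey the recursion that expresses `z₀ = z₁ -
z₂`. -/
theorem leftExpansion_add_one {F : ℤ → ι → X}
    (hF : ∀ p q, (Function.support fun i : ℕ => F (p - i) (q + i)).Finite) (l m : ℤ) (n : ι) :
    leftExpansion F (l + 1) m n = leftExpansion F l (m + 1) n - leftExpansion F l m (n + 1) := by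
  unfold leftExpansion
  rw [finsum_pascal (hF (l + 1 + m) n) (altChoose l) (altChoose (l + 1)) (-1)
    (by simp [altChoose_zero]) (altChoose_succ_succ l)]
  simp only [neg_smul, one_smul, ← sub_eq_add_neg]
  congr 1
  · exact finsum_congr fun i => by rw [show l + 1 + m - (i : ℤ) = l + (m + 1) - i by ring]
  · exact finsum_congr fun i => by
      rw [show l + 1 + m - ((i + 1 : ℕ) : ℤ) = l + m - i by push_cast; ring,
        show n + ((i + 1 : ℕ) : ι) = n + 1 + i by push_cast; ring]

theorem rightExpansion_add_one {F : ℤ → ι → X}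
    (hF : ∀ p q, (Function.support fun i : ℕ => F (p + i) (q - i)).Finite) (l m : ℤ) (n : ι) :
    rightExpansion F (l + 1) m n =
      rightExpansion F l (m + 1) n - rightExpansion F l m (n + 1) := by
  unfold rightExpansion
  rw [finsum_pascal (hF m ((l + 1 : ℤ) + n)) (fun i => ((l + 1).negOnePow : ℤ) * altChoose l i)
    _ (-1) (by simp [altChoose_zero]) fun i => by rw [altChoose_succ_succ]; ring, add_comm,
    sub_eq_add_neg]
  congr 1
  · rw [neg_smul, one_smul, ← finsum_neg_distrib]
    exact finsum_congr fun i => by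
      rw [← neg_smul, Int.negOnePow_succ, Units.val_neg, neg_mul, neg_neg,
        show m + ((i + 1 : ℕ) : ℤ) = m + 1 + i by push_cast; ring,
        show ((l + 1 : ℤ) : ι) + n - ((i + 1 : ℕ) : ι) = l + n - i by push_cast; ring]
  · rw [← finsum_neg_distrib]
    exact finsum_congr fun i => by
      rw [Int.negOnePow_succ, Units.val_neg, neg_mul, neg_smul,
        show ((l + 1 : ℤ) : ι) + n - (i : ι) = l + (n + 1) - i by push_cast; ring]

theorem innerExpansion_add_one {F : ℤ → ι → X}
    (hF : ∀ p q, (Function.support fun i : ℕ => F (p + i) (q - i)).Finite) (l m : ℤ) (n : ι) :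
    innerExpansion F l (m + 1) n = innerExpansion F (l + 1) m n + innerExpansion F l m (n + 1) := by
  unfold innerExpansion
  rw [finsum_pascal (hF l ((m + 1 : ℤ) + n)) (fun i => Ring.choose m i) _ 1 (by simp)
    fun i => by rw [Ring.choose_succ_succ]; ring, add_comm, one_smul]
  congr 1
  · exact finsum_congr fun i => by
      rw [show l + ((i + 1 : ℕ) : ℤ) = l + 1 + i by push_cast; ring,
        show ((m + 1 : ℤ) : ι) + n - ((i + 1 : ℕ) : ι) = m + n - i by push_cast; ring]
  · exact finsum_congr fun i => by
      rw [show ((m + 1 : ℤ) : ι) + n - (i : ι) = m + (n + 1) - i by push_cast; ring]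

theorem finsum_altChoose_zero (G : ℕ → X) : ∑ᶠ i, altChoose 0 i • G i = G 0 := by
  rw [finsum_eq_single _ 0, altChoose_zero, one_smul]
  rintro (_ | i) hi
  · exact absurd rfl hi
  · simp [altChoose, Ring.choose_zero_succ]

/-- A natural power is a polynomial, so the direction of expansion does not matter:
`rightExpansion_natCast` has the same right-hand side. This is what turns the Jacobi identity into
weak commutativity. -/
theorem leftExpansion_natCast {F : ℤ → ι → X}
    (hF : ∀ p q, (Function.support fun i : ℕ => F (p - i) (q + i)).Finite) (K : ℕ) (m : ℤ) (n : ι) :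
    leftExpansion F K m n = (mulAdd (-1))^[K] F m n := by
  induction K generalizing m n with
  | zero =>
    rw [leftExpansion, Nat.cast_zero, finsum_altChoose_zero]
    simp
  | succ K ih =>
    rw [Nat.cast_succ, leftExpansion_add_one hF, ih, ih, Function.iterate_succ_apply', mulAdd]
    simp [sub_eq_add_neg]

theorem rightExpansion_natCast {F : ℤ → ι → X}
    (hF : ∀ p q, (Function.support fun i : ℕ => F (p + i) (q - i)).Finite) (K : ℕ) (m : ℤ) (n : ι) :
    rightExpansion F K m n = (mulAdd (-1))^[K] F m n := by
  induction K generalizing m n with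
  | zero =>
    simp only [rightExpansion, Nat.cast_zero, Int.negOnePow_zero, Units.val_one, one_mul]
    rw [finsum_altChoose_zero]
    simp
  | succ K ih =>
    rw [Nat.cast_succ, rightExpansion_add_one hF, ih, ih, Function.iterate_succ_apply', mulAdd]
    simp [sub_eq_add_neg]

theorem innerExpansion_natCast {F : ℤ → ι → X}
    (hF : ∀ p q, (Function.support fun i : ℕ => F (p + i) (q - i)).Finite) (K : ℕ) (l : ℤ) (n : ι) :
    innerExpansion F l K n = (mulAdd 1)^[K] F l n := by
  induction K generalizing l n with
  | zero =>
    rw [innerExpansion, finsum_eq_single _ 0]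
    · simp
    · rintro (_ | i) hi
      · exact absurd rfl hi
      · simp [Ring.choose_zero_succ]
  | succ K ih =>
    rw [Nat.cast_succ, innerExpansion_add_one hF, ih, ih, Function.iterate_succ_apply', mulAdd]
    simp

/-- Weak commutativity and weak associativity imply the Jacobi identity. -/
theorem expansion_of_weak {F₁₂ F₂₁ F₀ : ℤ → ι → X}
    (h₁₂ : ∀ p q, (Function.support fun i : ℕ => F₁₂ (p - i) (q + i)).Finite)
    (h₂₁ : ∀ p q, (Function.support fun i : ℕ => F₂₁ (p + i) (q - i)).Finite)
    (h₀ : ∀ p q, (Function.support fun i : ℕ => F₀ (p + i) (q - i)).Finite)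
    (K L : ℤ)
    (hcomm : ∀ m n, leftExpansion F₁₂ K m n - rightExpansion F₂₁ K m n = innerExpansion F₀ K m n)
    (hassoc : ∀ l n, leftExpansion F₁₂ l L n - rightExpansion F₂₁ l L n = innerExpansion F₀ l L n)
    (l m : ℤ) (n : ι) :
    leftExpansion F₁₂ l m n - rightExpansion F₂₁ l m n = innerExpansion F₀ l m n := by
  set J : ℤ → ℤ → ι → X := fun l m n =>
    leftExpansion F₁₂ l m n - rightExpansion F₂₁ l m n - innerExpansion F₀ l m n with hJ
  have hrec : ∀ l m n, J (l + 1) m n = J l (m + 1) n - J l m (n + 1) := fun l m n => by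
    simp only [hJ]
    rw [leftExpansion_add_one h₁₂, rightExpansion_add_one h₂₁, innerExpansion_add_one h₀]
    abel
  suffices h : ∀ l m n, J l m n = 0 from sub_eq_zero.1 (h l m n)
  have hK : ∀ m n, J K m n = 0 := fun m n => sub_eq_zero.2 (hcomm m n)
  have hL : ∀ l n, J l L n = 0 := fun l n => sub_eq_zero.2 (hassoc l n)
  intro l
  induction l using Int.inductionOn' (b := K) with
  | zero => exact hK
  | succ k _ ih => intro m n; rw [hrec, ih, ih, sub_zero]
  | pred k _ ih =>
    -- Going down in `l`, the recursion alone does not suffice. As `J k` vanishes, it makes `J (k -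
    -- 1) m n` depend on `m + n` only, and every value of `m + n` is reached at `m = L`, where `J`
    -- is zero.
    have hstep : ∀ m n, J (k - 1) (m + 1) n = J (k - 1) m (n + 1) := fun m n => by
      have := hrec (k - 1) m n
      rw [sub_add_cancel, ih] at this
      exact (sub_eq_zero.1 this.symm)
    intro m
    induction m using Int.inductionOn' (b := L) with
    | zero => exact hL _
    | succ m _ ihm => intro n; rw [hstep, ihm]
    | pred m _ ihm =>
      intro n
      have := hstep (m - 1) (n - 1)
      rw [sub_add_cancel, sub_add_cancel, ihm] at this
      exact this.symm

end Formal

/-! ### Products of formal series -/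

section Conv

variable {ι X X' : Type*} [CommRing ι] [AddCommGroup X] [Module ℂ X] [AddCommGroup X'] [Module ℂ X']

/-- All coefficients of the product of the two series are finite sums. -/
def ConvFinite (F : ℤ → ι → X) (F' : ℤ → ι → X') : Prop :=
  ∀ p q, (Function.support fun x : ℤ × ι => F x.1 x.2 ⊗ₜ[ℂ] F' (p - 1 - x.1) (q - 1 - x.2)).Finite

/-- The product of two series. -/
def conv (F : ℤ → ι → X) (F' : ℤ → ι → X') (p : ℤ) (q : ι) : X ⊗[ℂ] X' :=
  ∑ᶠ x : ℤ × ι, F x.1 x.2 ⊗ₜ[ℂ] F' (p - 1 - x.1) (q - 1 - x.2)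

variable {F G : ℤ → ι → X} {F' G' : ℤ → ι → X'}

theorem convFinite_shiftIndex_left (h : ConvFinite F F') (r : ℤ) (s : ι) :
    ConvFinite (shiftIndex r s F) F' := fun p q => by
  refine ((h (p + r) (q + s)).preimage (f := fun x => (x.1 + r, x.2 + s)) ?_).subset ?_
  · rintro ⟨a, b⟩ _ ⟨c, d⟩ _ hx
    simpa using hx
  · intro x hx
    simp only [Set.mem_preimage, Function.mem_support, shiftIndex] at hx ⊢
    convert hx using 3 <;> ring

theorem convFinite_shiftIndex_right (h : ConvFinite F F') (r : ℤ) (s : ι) :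
    ConvFinite F (shiftIndex r s F') := fun p q => by
  refine (h (p + r) (q + s)).subset ?_
  intro x hx
  simp only [Function.mem_support, shiftIndex] at hx ⊢
  convert hx using 3 <;> ring

theorem conv_shiftIndex_left (r : ℤ) (s : ι) :
    conv (shiftIndex r s F) F' = shiftIndex r s (conv F F') := by
  funext p q
  refine finsum_eq_of_bijective (fun x => (x.1 + r, x.2 + s))
    ((Equiv.addRight r).prodCongr (Equiv.addRight s)).bijective fun x => ?_
  simp only [shiftIndex]
  congr 2 <;> ring

theorem conv_shiftIndex_right (r : ℤ) (s : ι) :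
    conv F (shiftIndex r s F') = shiftIndex r s (conv F F') := by
  funext p q
  refine finsum_congr fun x => ?_
  simp only [shiftIndex]
  congr 2 <;> ring

theorem ConvFinite.add_left (h : ConvFinite F F') (h' : ConvFinite G F') :
    ConvFinite (F + G) F' := fun p q =>
  ((h p q).union (h' p q)).subset fun x hx => by
    by_contra hc
    simp only [Set.mem_union, Function.mem_support, not_or, not_not] at hc
    exact hx (by simp [TensorProduct.add_tmul, hc.1, hc.2])

theorem ConvFinite.smul_left (h : ConvFinite F F') (ε : ℤ) : ConvFinite (ε • F) F' := fun p q =>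
  (h p q).subset fun x hx h0 => hx (by
    have h0 : F x.1 x.2 ⊗ₜ[ℂ] F' (p - 1 - x.1) (q - 1 - x.2) = 0 := h0
    simp [← TensorProduct.smul_tmul', h0])

theorem ConvFinite.add_right (h : ConvFinite F F') (h' : ConvFinite F G') :
    ConvFinite F (F' + G') := fun p q =>
  ((h p q).union (h' p q)).subset fun x hx => by
    by_contra hc
    simp only [Set.mem_union, Function.mem_support, not_or, not_not] at hc
    exact hx (by simp [TensorProduct.tmul_add, hc.1, hc.2])

theorem ConvFinite.smul_right (h : ConvFinite F F') (ε : ℤ) : ConvFinite F (ε • F') := fun p q =>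
  (h p q).subset fun x hx h0 => hx (by
    have h0 : F x.1 x.2 ⊗ₜ[ℂ] F' (p - 1 - x.1) (q - 1 - x.2) = 0 := h0
    simp [TensorProduct.tmul_smul, h0])

theorem conv_add_left (h : ConvFinite F F') (h' : ConvFinite G F') :
    conv (F + G) F' = conv F F' + conv G F' := by
  funext p q
  simp only [conv, Pi.add_apply]
  rw [← finsum_add_distrib (h p q) (h' p q)]
  exact finsum_congr fun x => TensorProduct.add_tmul _ _ _

theorem conv_add_right (h : ConvFinite F F') (h' : ConvFinite F G') :
    conv F (F' + G') = conv F F' + conv F G' := by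
  funext p q
  simp only [conv, Pi.add_apply]
  rw [← finsum_add_distrib (h p q) (h' p q)]
  exact finsum_congr fun x => TensorProduct.tmul_add _ _ _

theorem conv_smul_left (h : ConvFinite F F') (ε : ℤ) : conv (ε • F) F' = ε • conv F F' := by
  funext p q
  simp only [conv, Pi.smul_apply]
  rw [smul_finsum' ε (h p q)]
  exact finsum_congr fun x => (TensorProduct.smul_tmul' _ _ _).symm

theorem conv_smul_right (h : ConvFinite F F') (ε : ℤ) : conv F (ε • F') = ε • conv F F' := by
  funext p q
  simp only [conv, Pi.smul_apply]
  rw [smul_finsum' ε (h p q)]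
  exact finsum_congr fun x => TensorProduct.tmul_smul _ _ _

theorem ConvFinite.mulAdd_left (h : ConvFinite F F') (ε : ℤ) : ConvFinite (mulAdd ε F) F' := by
  rw [mulAdd_eq]
  exact (convFinite_shiftIndex_left h _ _).add_left ((convFinite_shiftIndex_left h _ _).smul_left ε)

theorem ConvFinite.mulAdd_right (h : ConvFinite F F') (ε : ℤ) : ConvFinite F (mulAdd ε F') := by
  rw [mulAdd_eq]
  exact (convFinite_shiftIndex_right h _ _).add_right
    ((convFinite_shiftIndex_right h _ _).smul_right ε)

theorem conv_mulAdd_left (h : ConvFinite F F') (ε : ℤ) :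
    conv (mulAdd ε F) F' = mulAdd ε (conv F F') := by
  rw [mulAdd_eq, mulAdd_eq, conv_add_left (convFinite_shiftIndex_left h _ _)
    ((convFinite_shiftIndex_left h _ _).smul_left ε),
    conv_smul_left (convFinite_shiftIndex_left h _ _), conv_shiftIndex_left, conv_shiftIndex_left]

theorem conv_mulAdd_right (h : ConvFinite F F') (ε : ℤ) :
    conv F (mulAdd ε F') = mulAdd ε (conv F F') := by
  rw [mulAdd_eq, mulAdd_eq, conv_add_right (convFinite_shiftIndex_right h _ _)
    ((convFinite_shiftIndex_right h _ _).smul_right ε),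
    conv_smul_right (convFinite_shiftIndex_right h _ _), conv_shiftIndex_right, conv_shiftIndex_right]

theorem ConvFinite.iterate_mulAdd (h : ConvFinite F F') (ε : ℤ) (K K' : ℕ) :
    ConvFinite ((mulAdd ε)^[K] F) ((mulAdd ε)^[K'] F') := by
  induction K with
  | zero =>
    induction K' with
    | zero => exact h
    | succ K' ih => rw [Function.iterate_succ_apply' _ K']; exact ih.mulAdd_right ε
  | succ K ih => rw [Function.iterate_succ_apply' _ K]; exact ih.mulAdd_left ε

theorem conv_iterate_mulAdd (h : ConvFinite F F') (ε : ℤ) (K K' : ℕ) :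
    conv ((mulAdd ε)^[K] F) ((mulAdd ε)^[K'] F') = (mulAdd ε)^[K + K'] (conv F F') := by
  induction K with
  | zero =>
    induction K' with
    | zero => rfl
    | succ K' ih =>
      rw [Function.iterate_succ_apply' _ K', conv_mulAdd_right (h.iterate_mulAdd ε 0 K'), ih,
        ← add_assoc, Function.iterate_succ_apply']
  | succ K ih =>
    rw [Function.iterate_succ_apply' _ K, conv_mulAdd_left (h.iterate_mulAdd ε K K'), ih,
      add_right_comm, Function.iterate_succ_apply']

end Conv

section Conv

variable {ι X X' : Type*} [CommRing ι] [AddCommGroup X] [Module ℂ X] [AddCommGroup X'] [Module ℂ X']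
  {F : ℤ → ι → X} {F' : ℤ → ι → X'}

theorem finsum_tmul_finsum {α β : Type*} {f : α → X} {g : β → X'}
    (hf : (Function.support f).Finite) (hg : (Function.support g).Finite) :
    (∑ᶠ a, f a) ⊗ₜ[ℂ] (∑ᶠ b, g b) = ∑ᶠ x : α × β, f x.1 ⊗ₜ[ℂ] g x.2 := by
  rw [finsum_curry]
  · rw [finsum_eq_finsetSum_of_support_subset f (s := hf.toFinset) (by simp),
      TensorProduct.sum_tmul,
      finsum_eq_finsetSum_of_support_subset _ (s := hf.toFinset)]
    · refine Finset.sum_congr rfl fun a _ => ?_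
      exact map_finsum (TensorProduct.mk ℂ X X' (f a)) hg
    · intro a ha
      simp only [Set.Finite.coe_toFinset]
      exact fun h0 => ha (by simp [show f a = 0 from h0])
  · refine (hf.prod hg).subset fun x hx => ⟨fun h0 => hx ?_, fun h0 => hx ?_⟩
    · simp [show f x.1 = 0 from h0]
    · simp [show g x.2 = 0 from h0]

/-- Substituting `z₁ = z₂ + z₀` is compatible with products. -/
theorem conv_leftExpansion
    (hF : ∀ p q, (Function.support fun i : ℕ => F (p - i) (q + i)).Finite)
    (hF' : ∀ p q, (Function.support fun i : ℕ => F' (p - i) (q + i)).Finite) (l : ℤ) (n : ι)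
    (h : (Function.support fun x : ℕ × ℤ × ι =>
      F x.2.1 x.2.2 ⊗ₜ[ℂ] F' (l - x.1 - 1 - x.2.1) (n + x.1 - 1 - x.2.2)).Finite) :
    conv (fun c d => leftExpansion F c 0 d) (fun c d => leftExpansion F' c 0 d) l n =
      leftExpansion (conv F F') l 0 n := by
  set H : ℕ × ℤ × ι → X ⊗[ℂ] X' := fun x =>
    F x.2.1 x.2.2 ⊗ₜ[ℂ] F' (l - x.1 - 1 - x.2.1) (n + x.1 - 1 - x.2.2) with hH
  set G : (ℤ × ι) × ℕ × ℕ → X ⊗[ℂ] X' := fun x =>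
    (altChoose (x.1.1 + x.2.1) x.2.1 *
      altChoose (l - (x.2.1 + x.2.2) - 1 - x.1.1 + x.2.2) x.2.2) •
      H (x.2.1 + x.2.2, x.1) with hG
  have hGfin : (Function.support G).Finite := by
    refine (h.biUnion (t := fun y => (fun z : ℕ × ℕ => (y.2, z)) ''
      (Finset.HasAntidiagonal.antidiagonal y.1 : Set (ℕ × ℕ))) fun y _ =>
        (Finset.finite_toSet _).image _).subset ?_
    rintro ⟨x, j, k⟩ hx
    simp only [Set.mem_iUnion]
    exact ⟨(j + k, x), fun h0 => hx (by simp only [hG]; rw [show H (j + k, x) = 0 from h0,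
      smul_zero]), (j, k), by simp, rfl⟩
  let e : (ℤ × ι) × ℕ × ℕ ≃ (ℤ × ι) × ℕ × ℕ :=
    { toFun := fun x => ((x.1.1 - x.2.1, x.1.2 + x.2.1), x.2)
      invFun := fun x => ((x.1.1 + x.2.1, x.1.2 - x.2.1), x.2)
      left_inv := fun x => by simp
      right_inv := fun x => by simp }
  have hs {f : ℕ → X} (hf : (Function.support f).Finite) (c : ℕ → ℤ) :
      (Function.support fun i => c i • f i).Finite :=
    hf.subset fun i hi h0 => hi (by simp [h0])
  have hs' {f : ℕ → X'} (hf : (Function.support f).Finite) (c : ℕ → ℤ) :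
      (Function.support fun i => c i • f i).Finite :=
    hf.subset fun i hi h0 => hi (by simp [h0])
  have e1 : conv (fun c d => leftExpansion F c 0 d) (fun c d => leftExpansion F' c 0 d) l n =
      ∑ᶠ x, G x := by
    rw [← finsum_comp_equiv e, finsum_curry _ (hGfin.preimage e.injective.injOn)]
    refine finsum_congr fun x => ?_
    simp only [leftExpansion]
    rw [finsum_tmul_finsum (hs (hF _ _) _) (hs' (hF' _ _) _)]
    refine finsum_congr fun y => ?_
    simp only [hG, hH, e, Equiv.coe_fn_mk]
    rw [← TensorProduct.smul_tmul', TensorProduct.tmul_smul, smul_smul]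
    push_cast
    congr 3 <;> ring
  have e2 : leftExpansion (conv F F') l 0 n =
      ∑ᶠ x : (ℤ × ι) × ℕ, altChoose l x.2 • H (x.2, x.1) := by
    have hfin : (Function.support fun x : ℕ × ℤ × ι => altChoose l x.1 • H x).Finite :=
      h.subset fun i hi h0 => hi (by simp only; rw [show H i = 0 from h0, smul_zero])
    rw [← finsum_comp_equiv (Equiv.prodComm ℕ (ℤ × ι))]
    simp only [Equiv.prodComm_apply, Prod.fst_swap, Prod.snd_swap]
    rw [finsum_curry _ hfin]
    refine finsum_congr fun i => ?_
    rw [conv, smul_finsum']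
    · simp only [hH, add_zero]
    · have := h.preimage (Prod.mk_right_injective i).injOn
      simpa only [add_zero] using! this
  have hfin : (Function.support fun x : (ℤ × ι) × ℕ => altChoose l x.2 • H (x.2, x.1)).Finite := by
    refine (h.preimage (Prod.swap_injective (α := ℤ × ι) (β := ℕ)).injOn).subset ?_
    intro x hx h0
    exact hx (by simp only; rw [show H (x.2, x.1) = 0 from h0, smul_zero])
  · rw [e1, e2, finsum_curry G hGfin, finsum_curry _ hfin]
    refine finsum_congr fun x => ?_
    rw [finsum_antidiagonal (hGfin.preimage (Prod.mk_right_injective x).injOn)]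
    refine finsum_congr fun i => ?_
    have : ∀ y ∈ Finset.HasAntidiagonal.antidiagonal i, G (x, y) =
        (altChoose (x.1 + y.1) y.1 * altChoose ((l - i - 1 - x.1) + y.2) y.2) • H (i, x) := by
      intro y hy
      rw [Finset.HasAntidiagonal.mem_antidiagonal] at hy
      simp only [hG]
      rw [hy, ← hy]
      push_cast
      rfl
    -- With `a = x.1` and `b = l - i - 1 - x.1`, the upper entry `a + b + 1 + i` equals `l`.
    rw [Finset.sum_congr rfl this, ← Finset.sum_smul, sum_antidiagonal_altChoose]
    congr 2
    ring
end Conv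

/-! ### Weak commutativity and weak associativity -/

section Formal

variable {ι X : Type*} [CommRing ι] [AddCommGroup X]

theorem support_finite_of_bound {F : ℤ → ι → X} {P : ℤ} (hP : ∀ p q, P ≤ p → F p q = 0)
    (p : ℤ) (q : ι) : (Function.support fun i : ℕ => F (p + i) (q - i)).Finite := by
  refine (Set.finite_Iic (P - p).toNat).subset fun i hi => ?_
  by_contra hc
  rw [Set.mem_Iic, not_le] at hc
  exact hi (hP _ _ (by omega))

theorem leftExpansion_eq_shiftIndex (F : ℤ → ι → X) (l m : ℤ) (n : ι) :
    leftExpansion F l m n = leftExpansion (shiftIndex m 0 F) l 0 n :=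
  finsum_congr fun i => by
    simp only [shiftIndex, add_zero]
    rw [show l + m - (i : ℤ) = l - i + m by ring]

/-- The three expansions of a series of operators that satisfies the Jacobi identity. -/
structure IsJacobiTriple (F₁₂ F₂₁ F₀ : ℤ → ι → X) : Prop where
  finite₁₂ : ∀ p q, (Function.support fun i : ℕ => F₁₂ (p - i) (q + i)).Finite
  bound₂₁ : ∃ P : ℕ, ∀ p q, (P : ℤ) ≤ p → F₂₁ p q = 0
  bound₀ : ∃ P : ℕ, ∀ p q, (P : ℤ) ≤ p → F₀ p q = 0
  jacobi : ∀ l m n, leftExpansion F₁₂ l m n - rightExpansion F₂₁ l m n = innerExpansion F₀ l m n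

namespace IsJacobiTriple

variable {F₁₂ F₂₁ F₀ : ℤ → ι → X}

/-- Take `l = K` in the Jacobi identity: the right-hand side only involves `F₀` at first indices `≥
K`, where it vanishes. -/
theorem exists_weak_commutativity (h : IsJacobiTriple F₁₂ F₂₁ F₀) :
    ∃ K : ℕ, (∀ p q, (K : ℤ) ≤ p → F₀ p q = 0) ∧
      (mulAdd (-1))^[K] F₁₂ = (mulAdd (-1))^[K] F₂₁ := by
  obtain ⟨K, hK⟩ := h.bound₀
  obtain ⟨P, hP⟩ := h.bound₂₁
  refine ⟨K, hK, ?_⟩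
  funext m n
  rw [← leftExpansion_natCast h.finite₁₂,
    ← rightExpansion_natCast (support_finite_of_bound hP), ← sub_eq_zero, h.jacobi,
    innerExpansion, finsum_eq_zero_of_forall_eq_zero]
  intro i
  rw [hK _ _ (by omega), smul_zero]

/-- Take `m = L` in the Jacobi identity: the term with `F₂₁` drops out. What remains says that `z₁ ^
L F₁₂` at `z₁ = z₂ + z₀` is `(z₂ + z₀) ^ L F₀`. -/
theorem exists_weak_associativity (h : IsJacobiTriple F₁₂ F₂₁ F₀) :
    ∃ L : ℕ, (∀ p q, (L : ℤ) ≤ p → F₂₁ p q = 0) ∧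
      ∀ l n, leftExpansion (shiftIndex L 0 F₁₂) l 0 n = (mulAdd 1)^[L] F₀ l n := by
  obtain ⟨L, hL⟩ := h.bound₂₁
  obtain ⟨P, hP⟩ := h.bound₀
  refine ⟨L, hL, fun l n => ?_⟩
  rw [← innerExpansion_natCast (support_finite_of_bound hP), ← h.jacobi,
    leftExpansion_eq_shiftIndex F₁₂, rightExpansion, finsum_eq_zero_of_forall_eq_zero, sub_zero]
  intro i
  rw [hL _ _ (by omega), smul_zero]

end IsJacobiTriple

end Formal

section Conv

variable {ι X X' : Type*} [CommRing ι] [AddCommGroup X] [Module ℂ X] [AddCommGroup X'] [Module ℂ X']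

/-- If `F` vanishes for `p ≥ P` and `F'` vanishes for `p ≥ P'`, then so does their product
for `p ≥ P + P'`. -/
theorem conv_eq_zero_of_bound {F : ℤ → ι → X} {F' : ℤ → ι → X'} {P P' : ℤ}
    (h : ∀ p q, P ≤ p → F p q = 0) (h' : ∀ p q, P' ≤ p → F' p q = 0) (p : ℤ) (q : ι)
    (hp : P + P' ≤ p) : conv F F' p q = 0 := by
  refine finsum_eq_zero_of_forall_eq_zero fun x => ?_
  by_cases hx : P ≤ x.1
  · rw [h _ _ hx, TensorProduct.zero_tmul]
  · rw [h' (p - 1 - x.1) _ (by omega), TensorProduct.tmul_zero]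

/-- The exponents of weak commutativity and of weak associativity add up under products, and the
product satisfies the Jacobi identity by `expansion_of_weak`. The hypothesis `h₁₂` is stronger than
`ConvFinite`, because substituting `z₁ = z₂ + z₀` in the product adds a third summation. -/
theorem IsJacobiTriple.conv {F₁₂ F₂₁ F₀ : ℤ → ι → X} {F₁₂' F₂₁' F₀' : ℤ → ι → X'}
    (h : IsJacobiTriple F₁₂ F₂₁ F₀) (h' : IsJacobiTriple F₁₂' F₂₁' F₀')
    (h₁₂ : ∀ l n, (Function.support fun x : ℕ × ℤ × ι =>
      F₁₂ x.2.1 x.2.2 ⊗ₜ[ℂ] F₁₂' (l - x.1 - 1 - x.2.1) (n + x.1 - 1 - x.2.2)).Finite)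
    (h₂₁ : ConvFinite F₂₁ F₂₁') (h₀ : ConvFinite F₀ F₀') :
    IsJacobiTriple (conv F₁₂ F₁₂') (conv F₂₁ F₂₁') (conv F₀ F₀') := by
  obtain ⟨K, hK, hcomm⟩ := h.exists_weak_commutativity
  obtain ⟨K', hK', hcomm'⟩ := h'.exists_weak_commutativity
  obtain ⟨L, hL, hassoc⟩ := h.exists_weak_associativity
  obtain ⟨L', hL', hassoc'⟩ := h'.exists_weak_associativity
  have b₂₁ := conv_eq_zero_of_bound hL hL'
  have b₀ := conv_eq_zero_of_bound hK hK'
  have c₁₂ : ConvFinite F₁₂ F₁₂' := fun p q => by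
    refine ((h₁₂ p q).preimage (Prod.mk_right_injective 0).injOn).subset ?_
    intro x hx
    simpa using hx
  have f₁₂ : ∀ p q, (Function.support fun i : ℕ => _root_.conv F₁₂ F₁₂' (p - i) (q + i)).Finite := by
    intro p q
    refine ((h₁₂ p q).image Prod.fst).subset fun i hi => ?_
    by_contra hc
    refine hi (finsum_eq_zero_of_forall_eq_zero fun x => ?_)
    by_contra hx
    exact hc ⟨(i, x), hx, rfl⟩
  refine ⟨f₁₂, ⟨L + L', by exact_mod_cast b₂₁⟩, ⟨K + K', by exact_mod_cast b₀⟩,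
    expansion_of_weak f₁₂ (support_finite_of_bound b₂₁) (support_finite_of_bound b₀)
      ((K + K' : ℕ) : ℤ) ((L + L' : ℕ) : ℤ) (fun m n => ?_) fun l n => ?_⟩
  · rw [leftExpansion_natCast f₁₂, rightExpansion_natCast (support_finite_of_bound b₂₁),
      ← conv_iterate_mulAdd c₁₂, ← conv_iterate_mulAdd h₂₁, hcomm, hcomm', sub_self,
      innerExpansion, finsum_eq_zero_of_forall_eq_zero]
    intro i
    rw [b₀ _ _ (by push_cast; omega), smul_zero]
  · have e : rightExpansion (_root_.conv F₂₁ F₂₁') l ((L + L' : ℕ) : ℤ) n = 0 := by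
      refine finsum_eq_zero_of_forall_eq_zero fun i => ?_
      rw [b₂₁ _ _ (by push_cast; omega), smul_zero]
    have e' : shiftIndex ((L + L' : ℕ) : ℤ) 0 (_root_.conv F₁₂ F₁₂') =
        _root_.conv (shiftIndex L 0 F₁₂) (shiftIndex L' 0 F₁₂') := by
      rw [conv_shiftIndex_left, conv_shiftIndex_right]
      funext p q
      simp only [shiftIndex, Nat.cast_add, add_zero, add_assoc]
    rw [e, sub_zero, innerExpansion_natCast (support_finite_of_bound b₀),
      ← conv_iterate_mulAdd h₀, leftExpansion_eq_shiftIndex, e', ← conv_leftExpansion]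
    · simp only [hassoc, hassoc']
    · intro p q
      simpa only [shiftIndex, add_zero, sub_add_eq_add_sub] using h.finite₁₂ (p + L) q
    · intro p q
      simpa only [shiftIndex, add_zero, sub_add_eq_add_sub] using h'.finite₁₂ (p + L') q
    · refine ((h₁₂ (l + L + L') n).preimage (f := fun x => (x.1, x.2.1 + (L : ℤ), x.2.2)) ?_).subset ?_
      · rintro ⟨i, a, b⟩ _ ⟨i', a', b'⟩ _ hx
        simpa using hx
      · intro x hx
        simp only [Set.mem_preimage, Function.mem_support, shiftIndex, add_zero] at hx ⊢
        rwa [show l + L + L' - x.1 - 1 - (x.2.1 + L) = l - x.1 - 1 - x.2.1 + L' by ring]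

end Conv

/-! ### Commutator formulas -/

section Modes

variable {V M M₁ M₂ M₃ : Type*} [AddCommGroup V] [Module ℂ V] [AddCommGroup M] [Module ℂ M]
  [AddCommGroup M₁] [Module ℂ M₁] [AddCommGroup M₂] [Module ℂ M₂] [AddCommGroup M₃] [Module ℂ M₃]

/-- This is the case `l = 0`, in which only the terms `i = 0` survive on the left; for natural `m`
the binomial coefficients cut off the right-hand side. -/
theorem JacobiIdentity.commutator {ι : Type*} [Ring ι] {Y₁ : V →ₗ[ℂ] VertexOperator ℂ M₁}
    {Y₂ : V →ₗ[ℂ] VertexOperator ℂ M₂} {Y₃ : V →ₗ[ℂ] VertexOperator ℂ M₃}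
    {𝒴 : M₁ → ι → M₂ →ₗ[ℂ] M₃} (h : JacobiIdentity Y₁ Y₂ Y₃ 𝒴) (a : V) (u : M₁) (v : M₂)
    (m : ℕ) (n : ι) :
    ((Y₃ a)[[(m : ℤ)]]) (𝒴 u n v) - 𝒴 u n (((Y₂ a)[[(m : ℤ)]]) v) =
      ∑ i ∈ Finset.range (m + 1), (m.choose i) • 𝒴 (((Y₁ a)[[(i : ℤ)]]) u) (m + n - i) v := by
  have e := h a u v 0 m n
  rw [finsum_eq_single _ 0, finsum_eq_single _ 0,
    finsum_eq_finsetSum_of_support_subset _ (s := Finset.range (m + 1))] at e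
  · simpa [Ring.choose_natCast] using e
  · intro i hi
    by_contra hc
    simp only [Finset.coe_range, Set.mem_Iio, not_lt] at hc
    refine hi ?_
    simp only
    rw [Ring.choose_natCast, Nat.choose_eq_zero_of_lt (by omega), Nat.cast_zero, zero_smul]
  · rintro (_ | i) hi
    · exact absurd rfl hi
    · simp [Ring.choose_zero_succ]
  · rintro (_ | i) hi
    · exact absurd rfl hi
    · simp [Ring.choose_zero_succ]

namespace VertexData

variable {D : VertexData V}

/-- `L(1) ω = L(1) L(-2) 𝟏 = 3 L(-1) 𝟏 = 0`; the central term is absent since `1 - 2 ≠ 0`. -/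
theorem IsVOA.vir_one_conformal (hD : D.IsVOA) : D.vir D.Y 1 D.conformal = 0 := by
  have h1 : D.conformal = D.vir D.Y (-2) D.vacuum := (hD.creation_neg_one D.conformal).symm
  obtain ⟨c, hc⟩ := hD.virasoro
  have h2 := congrArg (fun f : Module.End ℂ V => f D.vacuum) (hc 1 (-2))
  have h3 : D.vir D.Y 1 D.vacuum = 0 := hD.creation D.conformal 2 (by norm_num)
  have h4 : D.vir D.Y (-1) D.vacuum = 0 := hD.creation D.conformal 0 le_rfl
  simp only [LinearMap.sub_apply, Module.End.mul_apply, LinearMap.add_apply, LinearMap.smul_apply,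
    ← h1, h3] at h2
  norm_num [h4] at h2
  exact h2

theorem IsVOA.vir_zero_conformal (hD : D.IsVOA) :
    D.vir D.Y 0 D.conformal = (2 : ℂ) • D.conformal :=
  Module.End.mem_eigenspace_iff.1 hD.conformal_mem

/-- The relation `[L(0), L(1)] = - L(1)` on a weak module. -/
theorem IsWeakModule.vir_zero_vir_one {YM : V →ₗ[ℂ] VertexOperator ℂ M} (hD : D.IsVOA)
    (hM : D.IsWeakModule YM) (x : M) :
    D.vir YM 0 (D.vir YM 1 x) = D.vir YM 1 (D.vir YM 0 x) - D.vir YM 1 x := by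
  -- `IsWeakModule` does not include the derivative property, so `(L(-1) ω)₃` is unknown. It occurs
  -- in the formulas for both `[L(0), L(1)]` and `[L(1), L(0)]`, and their sum, which is zero,
  -- determines it.
  have e1 := hM.jacobi.commutator D.conformal D.conformal x 1 2
  have e2 := hM.jacobi.commutator D.conformal D.conformal x 2 1
  have h0 : ((D.Y D.conformal)[[1]]) D.conformal = (2 : ℂ) • D.conformal := hD.vir_zero_conformal
  have h1 : ((D.Y D.conformal)[[2]]) D.conformal = 0 := hD.vir_one_conformal
  norm_num [Finset.sum_range_succ, h0, h1] at e1 e2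
  show ((YM D.conformal)[[1]]) (((YM D.conformal)[[2]]) x) =
    ((YM D.conformal)[[2]]) (((YM D.conformal)[[1]]) x) - ((YM D.conformal)[[2]]) x
  set X := ((YM (((D.Y D.conformal)[[0]]) D.conformal))[[3]]) x
  set p := ((YM D.conformal)[[1]]) (((YM D.conformal)[[2]]) x)
  set q := ((YM D.conformal)[[2]]) (((YM D.conformal)[[1]]) x)
  set w := ((YM D.conformal)[[2]]) x
  have hX : (2 : ℂ) • X = (2 : ℂ) • ((-3 : ℂ) • w) := by
    linear_combination (norm := module) (-1 : ℂ) • e1 + (-1 : ℂ) • e2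
  have hX' := smul_right_injective M (two_ne_zero (α := ℂ)) hX
  rw [hX'] at e1
  linear_combination (norm := module) e1

theorem vir_one_mem_weightSpace {YM : V →ₗ[ℂ] VertexOperator ℂ M} (hD : D.IsVOA)
    (hM : D.IsWeakModule YM) {h : ℂ} {x : M} (hx : x ∈ D.weightSpace YM h) :
    D.vir YM 1 x ∈ D.weightSpace YM (h - 1) := by
  rw [weightSpace, Module.End.mem_eigenspace_iff] at hx ⊢
  rw [hM.vir_zero_vir_one hD, hx, map_smul, sub_smul, one_smul]

theorem iterate_vir_one_mem_weightSpace {YM : V →ₗ[ℂ] VertexOperator ℂ M} (hD : D.IsVOA)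
    (hM : D.IsWeakModule YM) {h : ℂ} {x : M} (hx : x ∈ D.weightSpace YM h) (k : ℕ) :
    ((D.vir YM 1) ^ k) x ∈ D.weightSpace YM (h - k) := by
  induction k with
  | zero => simpa using hx
  | succ k ih =>
    rw [pow_succ', Module.End.mul_apply, Nat.cast_succ, ← sub_sub]
    exact vir_one_mem_weightSpace hD hM ih

/-- `L(1)` is locally nilpotent on homogeneous vectors. -/
theorem IsModule.exists_iterate_vir_one_eq_zero {YM : V →ₗ[ℂ] VertexOperator ℂ M} (hD : D.IsVOA)
    (hM : D.IsModule YM) {h : ℂ} {x : M} (hx : x ∈ D.weightSpace YM h) :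
    ∃ K : ℕ, ∀ k : ℕ, K ≤ k → ((D.vir YM 1) ^ k) x = 0 := by
  obtain ⟨N, hN⟩ := hM.lower_bounded h
  refine ⟨(1 - N).toNat, fun k hk => ?_⟩
  have h1 := iterate_vir_one_mem_weightSpace hD hM.toIsWeakModule hx k
  have h2 := hN (-k) (by omega)
  rw [Int.cast_neg, Int.cast_natCast, ← sub_eq_add_neg] at h2
  rwa [h2, Submodule.mem_bot] at h1

/-- A property that is additive and holds for homogeneous vectors holds for all vectors. -/
theorem IsModule.induction_on {YM : V →ₗ[ℂ] VertexOperator ℂ M} (hM : D.IsModule YM)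
    {p : M → Prop} (x : M) (mem : ∀ h, ∀ x ∈ D.weightSpace YM h, p x)
    (zero : p 0) (add : ∀ x y, p x → p y → p (x + y)) : p x :=
  Submodule.iSup_induction _ (motive := p)
    (hM.grading.submodule_iSup_eq_top.symm ▸ Submodule.mem_top) mem zero add

namespace IsIntertwining

variable {Y₁ : V →ₗ[ℂ] VertexOperator ℂ M₁} {Y₂ : V →ₗ[ℂ] VertexOperator ℂ M₂}
  {Y₃ : V →ₗ[ℂ] VertexOperator ℂ M₃} {𝒴 : M₁ →ₗ[ℂ] ℂ → M₂ →ₗ[ℂ] M₃}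

theorem vir_zero_apply (h : D.IsIntertwining Y₁ Y₂ Y₃ 𝒴) (u : M₁) (n : ℂ) (v : M₂) :
    D.vir Y₃ 0 (𝒴 u n v) =
      𝒴 u n (D.vir Y₂ 0 v) + 𝒴 (D.vir Y₁ 0 u) n v - (n + 1) • 𝒴 u n v := by
  have e := h.jacobi.commutator D.conformal u v 1 n
  have d : 𝒴 (((Y₁ D.conformal)[[0]]) u) (1 + n) v = _ :=
    congrArg (fun f => f v) (h.derivative u (1 + n))
  norm_num [Finset.sum_range_succ, d] at e
  show ((Y₃ D.conformal)[[1]]) (𝒴 u n v) = 𝒴 u n (((Y₂ D.conformal)[[1]]) v) +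
    𝒴 (((Y₁ D.conformal)[[1]]) u) n v - (n + 1) • 𝒴 u n v
  linear_combination (norm := module) e

theorem vir_one_apply (h : D.IsIntertwining Y₁ Y₂ Y₃ 𝒴) (u : M₁) (n : ℂ) (v : M₂) :
    D.vir Y₃ 1 (𝒴 u n v) = 𝒴 u n (D.vir Y₂ 1 v) - (n + 2) • 𝒴 u (n + 1) v +
      (2 : ℂ) • 𝒴 (D.vir Y₁ 0 u) (n + 1) v + 𝒴 (D.vir Y₁ 1 u) n v := by
  have e := h.jacobi.commutator D.conformal u v 2 n
  have d : 𝒴 (((Y₁ D.conformal)[[0]]) u) (2 + n) v = _ :=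
    congrArg (fun f => f v) (h.derivative u (2 + n))
  rw [show 2 + n - 1 = n + 1 by ring] at d
  norm_num [Finset.sum_range_succ, d, show 2 + n - 1 = n + 1 by ring] at e
  show ((Y₃ D.conformal)[[2]]) (𝒴 u n v) = 𝒴 u n (((Y₂ D.conformal)[[2]]) v) -
    (n + 2) • 𝒴 u (n + 1) v + (2 : ℂ) • 𝒴 (((Y₁ D.conformal)[[1]]) u) (n + 1) v +
    𝒴 (((Y₁ D.conformal)[[2]]) u) n v
  linear_combination (norm := module) e

/-- `uₙ v` has weight `wt u + wt v - n - 1`. -/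
theorem mem_weightSpace (h : D.IsIntertwining Y₁ Y₂ Y₃ 𝒴) {s t : ℂ} {u : M₁} {v : M₂}
    (hu : u ∈ D.weightSpace Y₁ s) (hv : v ∈ D.weightSpace Y₂ t) (n : ℂ) :
    𝒴 u n v ∈ D.weightSpace Y₃ (s + t - n - 1) := by
  rw [weightSpace, Module.End.mem_eigenspace_iff] at hu hv ⊢
  rw [h.vir_zero_apply, hu, hv, map_smul, map_smul, Pi.smul_apply, LinearMap.smul_apply]
  module

/-- The commutator of `L(1)` with the coefficient of index `n - 1` contains `(2 s - n - 1) uₙ v`;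
its other terms come from the three coefficients in the conclusion. -/
theorem descent_step (h : D.IsIntertwining Y₁ Y₂ Y₃ 𝒴) {s : ℂ} {u : M₁} {v : M₂}
    (hu : u ∈ D.weightSpace Y₁ s) {n : ℂ} (hn : n + 1 ≠ 2 * s) (h0 : 𝒴 u n v ≠ 0) :
    𝒴 u (n - 1) v ≠ 0 ∨ 𝒴 u (n - 1) (D.vir Y₂ 1 v) ≠ 0 ∨ 𝒴 (D.vir Y₁ 1 u) (n - 1) v ≠ 0 := by
  by_contra! hc
  obtain ⟨h1, h2, h3⟩ := hc
  rw [weightSpace, Module.End.mem_eigenspace_iff] at hu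
  have e := h.vir_one_apply u (n - 1) v
  rw [h1, h2, h3, hu, map_smul, Pi.smul_apply, LinearMap.smul_apply, map_zero,
    sub_add_cancel] at e
  have e' : (2 * s - (n + 1)) • 𝒴 u n v = 0 := by
    linear_combination (norm := module) (-1 : ℂ) • e
  rcases smul_eq_zero.1 e' with h4 | h4
  · exact hn (by linear_combination -h4)
  · exact h0 h4

end IsIntertwining

end VertexData

end Modes

/-! ### Cosets of the integers in the complex numbers -/

/-- The coset `z + ℤ`. -/
def intCoset (z : ℂ) : ℂ ⧸ AddSubgroup.zmultiples (1 : ℂ) := QuotientAddGroup.mk z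

theorem intCoset_eq_iff {x y : ℂ} : intCoset x = intCoset y ↔ ∃ k : ℤ, y + k = x := by
  rw [intCoset, intCoset, eq_comm, QuotientAddGroup.eq, AddSubgroup.mem_zmultiples_iff]
  refine exists_congr fun k => ?_
  rw [zsmul_one]
  constructor <;> intro h
  · rw [h]; ring
  · rw [← h]; ring

theorem intCoset_add (x y : ℂ) : intCoset (x + y) = intCoset x + intCoset y := rfl

theorem intCoset_sub (x y : ℂ) : intCoset (x - y) = intCoset x - intCoset y := rfl

theorem intCoset_intCast (k : ℤ) : intCoset (k : ℂ) = 0 :=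
  intCoset_eq_iff.2 ⟨k, zero_add _⟩

theorem intCoset_natCast (k : ℕ) : intCoset (k : ℂ) = 0 := by
  rw [← Int.cast_natCast, intCoset_intCast]

theorem intCoset_one : intCoset 1 = 0 := by
  simpa using intCoset_natCast 1

theorem exists_intCoset_eq (s : ℂ ⧸ AddSubgroup.zmultiples (1 : ℂ)) : ∃ z, intCoset z = s :=
  QuotientAddGroup.mk_surjective s

/-! ### Products of truncated series with complex exponents -/

section Truncated

variable {X X' : Type*} [AddCommGroup X] [Module ℂ X] [AddCommGroup X'] [Module ℂ X']

theorem tmul_ne_zero_of_ne_zero {x : X} {y : X'} (hx : x ≠ 0) (hy : y ≠ 0) : x ⊗ₜ[ℂ] y ≠ 0 := by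
  intro h
  have h1 : ¬ ∀ φ : Module.Dual ℂ X, φ x = 0 := fun h0 =>
    hx ((Module.forall_dual_apply_eq_zero_iff ℂ x).1 h0)
  push Not at h1
  obtain ⟨φ, hφ⟩ := h1
  have h2 := congrArg (fun t => TensorProduct.lid ℂ X' (φ.rTensor X' t)) h
  simp only [LinearMap.rTensor_tmul, TensorProduct.lid_tmul, map_zero] at h2
  exact hy ((smul_eq_zero.1 h2).resolve_left hφ)

/-- In each coset of `ℤ`, the coefficients vanish for large indices. -/
def IsTruncated (f : ℂ → X) : Prop := ∀ c : ℂ, ∃ N : ℤ, ∀ n : ℤ, N ≤ n → f (n + c) = 0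

variable {f : ℂ → X} {g : ℂ → X'}

/-- In one coset, truncation of `f` bounds `i` above and truncation of `g` bounds `n - 1 - i` above,
hence `i` below. -/
theorem IsTruncated.tmul_finite (hf : IsTruncated f) (hg : IsTruncated g)
    {S : Set (ℂ ⧸ AddSubgroup.zmultiples (1 : ℂ))} (hS : S.Finite) (n : ℂ)
    (h : ∀ i, f i ⊗ₜ[ℂ] g (n - 1 - i) ≠ 0 → intCoset i ∈ S) :
    {i | f i ⊗ₜ[ℂ] g (n - 1 - i) ≠ 0}.Finite := by
  have key : ∀ s ∈ S, {i | intCoset i = s ∧ f i ⊗ₜ[ℂ] g (n - 1 - i) ≠ 0}.Finite := by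
    intro s _
    obtain ⟨r, rfl⟩ := exists_intCoset_eq s
    obtain ⟨N, hN⟩ := hf r
    obtain ⟨N', hN'⟩ := hg (n - 1 - r)
    refine ((Set.finite_Ioo (-N') N).image fun k : ℤ => (r + k : ℂ)).subset ?_
    rintro i ⟨hi, hi0⟩
    obtain ⟨k, rfl⟩ := intCoset_eq_iff.1 hi
    refine ⟨k, ⟨?_, ?_⟩, rfl⟩
    · by_contra hk
      refine hi0 ?_
      rw [show n - 1 - (r + k) = ((-k : ℤ) : ℂ) + (n - 1 - r) by push_cast; ring,
        hN' _ (by omega), TensorProduct.tmul_zero]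
    · by_contra hk
      refine hi0 ?_
      rw [add_comm, hN _ (by omega), TensorProduct.zero_tmul]
  refine (hS.biUnion key).subset fun i hi => ?_
  exact Set.mem_biUnion (h i hi) ⟨rfl, hi⟩

/-- Every coset has its own bound. A common one exists because the finite set `S` serves all `n` at
once. -/
theorem IsTruncated.tmul_bound (hf : IsTruncated f) (hg : IsTruncated g)
    {S : Set (ℂ ⧸ AddSubgroup.zmultiples (1 : ℂ))} (hS : S.Finite) (c : ℂ)
    (h : ∀ (n : ℕ) (i : ℂ), f i ⊗ₜ[ℂ] g (n + c - 1 - i) ≠ 0 → intCoset i ∈ S) :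
    ∃ N : ℤ, ∀ n : ℤ, N ≤ n → ∀ i, f i ⊗ₜ[ℂ] g (n + c - 1 - i) = 0 := by
  have key : ∀ s, ∃ N : ℤ, ∀ n : ℤ, N ≤ n → ∀ i, intCoset i = s →
      f i ⊗ₜ[ℂ] g (n + c - 1 - i) = 0 := by
    intro s
    obtain ⟨r, rfl⟩ := exists_intCoset_eq s
    obtain ⟨N, hN⟩ := hf r
    obtain ⟨N', hN'⟩ := hg (c - 1 - r)
    refine ⟨N + N', fun n hn i hi => ?_⟩
    obtain ⟨k, rfl⟩ := intCoset_eq_iff.1 hi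
    by_cases hk : N ≤ k
    · rw [add_comm, hN _ hk, TensorProduct.zero_tmul]
    · rw [show n + c - 1 - (r + k) = ((n - k : ℤ) : ℂ) + (c - 1 - r) by push_cast; ring,
        hN' _ (by omega), TensorProduct.tmul_zero]
  choose N hN using key
  obtain ⟨B, hB⟩ := (hS.image N).bddAbove
  -- The hypothesis `h` covers natural `n` only, hence the maximum with `0`.
  refine ⟨max 0 B, fun n hn i => ?_⟩
  by_contra hi
  have hi' := hi
  lift n to ℕ using (le_max_left _ _).trans hn
  rw [Int.cast_natCast] at hi
  exact hi' (hN _ n ((hB (Set.mem_image_of_mem N (h n i hi))).trans ((le_max_right _ _).trans hn))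
    i rfl)

end Truncated

/-- A family in a finite-dimensional space that has a biorthogonal family of maps is finite. -/
theorem finite_of_biorthogonal {κ A X : Type*} [AddCommMonoid A] [Module ℂ A] [Module.Finite ℂ A]
    [AddCommGroup X] [Module ℂ X] (p : κ → A) (φ : κ → A →ₗ[ℂ] X)
    (h0 : ∀ s t, s ≠ t → φ s (p t) = 0) (h1 : ∀ s, φ s (p s) ≠ 0) : Finite κ := by
  let _ : AddCommGroup A := Module.addCommMonoidToAddCommGroup ℂ
  have hli : LinearIndependent ℂ p := by
    refine linearIndependent_iff'.2 fun S c hc s hs => ?_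
    have e := congrArg (φ s) hc
    rw [map_zero, map_sum, Finset.sum_eq_single_of_mem _ hs, map_smul] at e
    · exact (smul_eq_zero.1 e).resolve_right (h1 s)
    · intro r _ hr
      rw [map_smul, h0 _ _ hr.symm, smul_zero]
  exact hli.finite

section Intertwiners

variable {V M₁ M₂ M₃ : Type*} [AddCommGroup V] [Module ℂ V]
  [AddCommGroup M₁] [Module ℂ M₁] [AddCommGroup M₂] [Module ℂ M₂] [AddCommGroup M₃] [Module ℂ M₃]
  {W N₁ N₂ N₃ : Type*} [AddCommGroup W] [Module ℂ W]
  [AddCommGroup N₁] [Module ℂ N₁] [AddCommGroup N₂] [Module ℂ N₂] [AddCommGroup N₃] [Module ℂ N₃]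

/-- The linear map sending `𝒴` to `uᵢ v`. -/
def modeAt (u : M₁) (i : ℂ) (v : M₂) : (M₁ →ₗ[ℂ] ℂ → M₂ →ₗ[ℂ] M₃) →ₗ[ℂ] M₃ where
  toFun 𝒴 := 𝒴 u i v
  map_add' _ _ := rfl
  map_smul' _ _ := rfl

namespace VertexData

variable {D : VertexData V} {E : VertexData W}
  {Y₁ : V →ₗ[ℂ] VertexOperator ℂ M₁} {Y₂ : V →ₗ[ℂ] VertexOperator ℂ M₂}
  {Y₃ : V →ₗ[ℂ] VertexOperator ℂ M₃}
  {Z₁ : W →ₗ[ℂ] VertexOperator ℂ N₁} {Z₂ : W →ₗ[ℂ] VertexOperator ℂ N₂}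
  {Z₃ : W →ₗ[ℂ] VertexOperator ℂ N₃}
  {𝒴 : M₁ →ₗ[ℂ] ℂ → M₂ →ₗ[ℂ] M₃} {𝒵 : N₁ →ₗ[ℂ] ℂ → N₂ →ₗ[ℂ] N₃}

theorem IsIntertwining.isTruncated (h : D.IsIntertwining Y₁ Y₂ Y₃ 𝒴) (u : M₁) (v : M₂) :
    IsTruncated fun i => 𝒴 u i v := h.truncation u v

/-! ### When products are well defined -/

theorem IsIntertwining.hasTensor_of_left (h : D.IsIntertwining Y₁ Y₂ Y₃ 𝒴)
    (h' : E.IsIntertwining Z₁ Z₂ Z₃ 𝒵)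
    (hfin : ∀ u v, (intCoset '' {i | 𝒴 u i v ≠ 0}).Finite) : HasTensor 𝒴 𝒵 :=
  fun u₁ u₂ v₁ v₂ n => (h.isTruncated u₁ u₂).tmul_finite (h'.isTruncated v₁ v₂) (hfin u₁ u₂) n
    fun i hi => ⟨i, fun h0 => hi (by rw [h0, TensorProduct.zero_tmul]), rfl⟩

theorem IsIntertwining.hasTensor_of_right (h : D.IsIntertwining Y₁ Y₂ Y₃ 𝒴)
    (h' : E.IsIntertwining Z₁ Z₂ Z₃ 𝒵)
    (hfin : ∀ u v, (intCoset '' {i | 𝒵 u i v ≠ 0}).Finite) : HasTensor 𝒴 𝒵 :=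
  fun u₁ u₂ v₁ v₂ n => (h.isTruncated u₁ u₂).tmul_finite (h'.isTruncated v₁ v₂)
    ((hfin v₁ v₂).image fun s => intCoset (n - 1) - s) n
    fun i hi => ⟨_, ⟨n - 1 - i, fun h0 => hi (by rw [h0, TensorProduct.tmul_zero]), rfl⟩, by
      simp only [intCoset_sub (n - 1) i, sub_sub_cancel]⟩

/-- For homogeneous vectors `uᵢ v` has weight `s + t - i - 1`, so the coset of the weight determines
that of `i`. Sums of homogeneous vectors lead to finite unions. -/
theorem FinitelyManyCosets.finite_intCoset (hfin : D.FinitelyManyCosets Y₃)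
    (h₁ : D.IsModule Y₁) (h₂ : D.IsModule Y₂) (h : D.IsIntertwining Y₁ Y₂ Y₃ 𝒴) (u : M₁)
    (v : M₂) : (intCoset '' {i | 𝒴 u i v ≠ 0}).Finite := by
  obtain ⟨S, hS⟩ := hfin
  induction u using h₁.induction_on with
  | mem s u hu =>
    induction v using h₂.induction_on with
    | mem t v hv =>
      refine (S.finite_toSet.image fun r => intCoset (s + t - 1 - r)).subset ?_
      rintro _ ⟨i, hi, rfl⟩
      obtain ⟨r, hr, k, hk⟩ := hS (s + t - i - 1) fun h0 =>
        hi ((Submodule.mem_bot ℂ).1 (h0 ▸ h.mem_weightSpace hu hv i))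
      exact ⟨r, hr, intCoset_eq_iff.2 ⟨k, by linear_combination -hk⟩⟩
    | zero => simp
    | add x y hx hy =>
      refine (hx.union hy).subset ?_
      rw [← Set.image_union]
      refine Set.image_mono fun i hi => ?_
      by_contra hc
      simp only [Set.mem_union, Set.mem_ofPred_eq, not_or, not_not] at hc
      exact hi (by rw [map_add, hc.1, hc.2, add_zero])
  | zero => simp
  | add x y hx hy =>
    refine (hx.union hy).subset ?_
    rw [← Set.image_union]
    refine Set.image_mono fun i hi => ?_
    by_contra hc
    simp only [Set.mem_union, Set.mem_ofPred_eq, not_or, not_not] at hc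
    exact hi (by rw [map_add, Pi.add_apply, LinearMap.add_apply, hc.1, hc.2, add_zero])

/-! ### Truncation of products -/

/-- Iterated `descent_step`. The vector `L(1)^a u` has weight `s - a`, so an index outside the coset
of `2 s` never meets the exceptional value. -/
theorem IsIntertwining.descent (hD : D.IsVOA) (h₁ : D.IsModule Y₁)
    (h : D.IsIntertwining Y₁ Y₂ Y₃ 𝒴) {s : ℂ} {u : M₁} {v : M₂} (hu : u ∈ D.weightSpace Y₁ s)
    {n : ℂ} (hn : intCoset n ≠ intCoset (2 * s)) (h0 : 𝒴 u n v ≠ 0) (d : ℕ) :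
    ∃ a b : ℕ, 𝒴 (((D.vir Y₁ 1) ^ a) u) (n - d) (((D.vir Y₂ 1) ^ b) v) ≠ 0 := by
  induction d with
  | zero => exact ⟨0, 0, by simpa using h0⟩
  | succ d ih =>
    obtain ⟨a, b, hab⟩ := ih
    rw [Nat.cast_succ, ← sub_sub]
    rcases h.descent_step (iterate_vir_one_mem_weightSpace hD h₁.toIsWeakModule hu a)
      (fun hn' => hn (intCoset_eq_iff.2 ⟨d - 2 * a - 1, by push_cast; linear_combination -hn'⟩))
      hab with h1 | h1 | h1
    · exact ⟨a, b, h1⟩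
    · exact ⟨a, b + 1, by rwa [pow_succ']⟩
    · exact ⟨a + 1, b, by rwa [pow_succ']⟩

/-- This gives truncation of a product, even when infinitely many cosets of exponents occur. A
nonzero term of total index `n + c` descends in its first factor to a nonzero term of total index
`c`, with `u` and `v` replaced by `L(1)^a u` and `L(1)^b v`. Local nilpotence of `L(1)` leaves
finitely many `(a, b)`, and for each of them well-definedness at `c` leaves finitely many terms. So
finitely many cosets occur for all `n ≥ 0` together. -/
theorem exists_tensor_bound (hD : D.IsVOA) (h₁ : D.IsModule Y₁) (h₂ : D.IsModule Y₂)
    (h : D.IsIntertwining Y₁ Y₂ Y₃ 𝒴) (h' : E.IsIntertwining Z₁ Z₂ Z₃ 𝒵) (ht : HasTensor 𝒴 𝒵)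
    (u₁ : M₁) (u₂ : M₂) (v₁ : N₁) (v₂ : N₂) (c : ℂ) :
    ∃ N : ℤ, ∀ n : ℤ, N ≤ n → ∀ i, 𝒴 u₁ i u₂ ⊗ₜ[ℂ] 𝒵 v₁ (n + c - 1 - i) v₂ = 0 := by
  induction u₁ using h₁.induction_on with
  | mem s u hu =>
    induction u₂ using h₂.induction_on with
    | mem t v hv =>
      obtain ⟨A, hA⟩ := h₁.exists_iterate_vir_one_eq_zero hD hu
      obtain ⟨B, hB⟩ := h₂.exists_iterate_vir_one_eq_zero hD hv
      set T : Set ℂ := ⋃ x ∈ (Finset.range A ×ˢ Finset.range B : Finset (ℕ × ℕ)),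
        {i | 𝒴 (((D.vir Y₁ 1) ^ x.1) u) i (((D.vir Y₂ 1) ^ x.2) v) ⊗ₜ[ℂ]
          𝒵 v₁ (c - 1 - i) v₂ ≠ 0} with hT
      have hTfin : T.Finite := Set.Finite.biUnion (Finset.finite_toSet _) fun x _ => ht _ _ _ _ c
      refine (h.isTruncated u v).tmul_bound (h'.isTruncated v₁ v₂)
        ((hTfin.image intCoset).insert (intCoset (2 * s))) c fun n i hi => ?_
      by_cases his : intCoset i = intCoset (2 * s)
      · exact Or.inl his
      · right
        obtain ⟨a, b, hab⟩ := h.descent hD h₁ hu his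
          (fun h0 => hi (by rw [h0, TensorProduct.zero_tmul])) n
        -- Lowering the first index by `n` keeps the coset and turns the total index `n + c` into
        -- `c`; the second index `n + c - 1 - i` does not change.
        refine ⟨i - n, Set.mem_biUnion (x := (a, b)) ?_ ?_, by
          rw [intCoset_sub, intCoset_natCast, sub_zero]⟩
        · simp only [Finset.coe_product, Finset.coe_range, Set.mem_prod, Set.mem_Iio]
          constructor
          · by_contra hc
            exact hab (by rw [hA _ (not_lt.1 hc), map_zero]; rfl)
          · by_contra hc
            exact hab (by rw [hB _ (not_lt.1 hc), map_zero])
        · refine tmul_ne_zero_of_ne_zero hab fun h0 => hi ?_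
          rw [show (n : ℂ) + c - 1 - i = c - 1 - (i - n) by ring, h0, TensorProduct.tmul_zero]
    | zero => exact ⟨0, fun n _ i => by rw [map_zero, TensorProduct.zero_tmul]⟩
    | add x y hx hy =>
      obtain ⟨N, hN⟩ := hx
      obtain ⟨N', hN'⟩ := hy
      refine ⟨max N N', fun n hn i => ?_⟩
      rw [map_add, TensorProduct.add_tmul, hN n ((le_max_left _ _).trans hn),
        hN' n ((le_max_right _ _).trans hn), add_zero]
  | zero => exact ⟨0, fun n _ i => by
      rw [map_zero, Pi.zero_apply, LinearMap.zero_apply, TensorProduct.zero_tmul]⟩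
  | add x y hx hy =>
    obtain ⟨N, hN⟩ := hx
    obtain ⟨N', hN'⟩ := hy
    refine ⟨max N N', fun n hn i => ?_⟩
    rw [map_add, Pi.add_apply, LinearMap.add_apply, TensorProduct.add_tmul,
      hN n ((le_max_left _ _).trans hn), hN' n ((le_max_right _ _).trans hn), add_zero]

/-! ### Splitting intertwining operators along cosets of exponents -/

/-- Multiply the coefficient of index `n` by a number that depends on the coset `n + ℤ` only. -/
def cosetSMul (χ : ℂ ⧸ AddSubgroup.zmultiples (1 : ℂ) → ℂ) (𝒴 : M₁ →ₗ[ℂ] ℂ → M₂ →ₗ[ℂ] M₃) :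
    M₁ →ₗ[ℂ] ℂ → M₂ →ₗ[ℂ] M₃ where
  toFun u n := χ (intCoset n) • 𝒴 u n
  map_add' u v := by funext n; simp
  map_smul' c u := by funext n; simp [smul_comm c]

/-- In each instance of the Jacobi identity or of the derivative property, all indices of `𝒴` lie in
one coset, so the instance is just multiplied by a constant. -/
theorem IsIntertwining.cosetSMul (h : D.IsIntertwining Y₁ Y₂ Y₃ 𝒴)
    (χ : ℂ ⧸ AddSubgroup.zmultiples (1 : ℂ) → ℂ) :
    D.IsIntertwining Y₁ Y₂ Y₃ (cosetSMul χ 𝒴) where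
  truncation u v c := by
    obtain ⟨N, hN⟩ := h.truncation u v c
    exact ⟨N, fun n hn => by simp [VertexData.cosetSMul, hN n hn]⟩
  jacobi a u v l m n := by
    have e := (h.smul (χ (intCoset n))).jacobi a u v l m n
    simpa only [VertexData.cosetSMul, LinearMap.coe_mk, AddHom.coe_mk,
      LinearMap.smul_apply, Pi.smul_apply, intCoset_add, intCoset_sub,
      intCoset_intCast, intCoset_natCast, add_zero, zero_add, sub_zero] using e
  derivative u n := by
    have e := (h.smul (χ (intCoset n))).derivative u n
    simpa only [VertexData.cosetSMul, LinearMap.coe_mk, AddHom.coe_mk,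
      LinearMap.smul_apply, Pi.smul_apply, intCoset_sub, intCoset_one,
      sub_zero] using e

/-- The intertwining operators whose exponents lie in finitely many cosets of `ℤ`. -/
def finiteCosetIntertwiners (D : VertexData V) (Y₁ : V →ₗ[ℂ] VertexOperator ℂ M₁)
    (Y₂ : V →ₗ[ℂ] VertexOperator ℂ M₂) (Y₃ : V →ₗ[ℂ] VertexOperator ℂ M₃) :
    Submodule ℂ (M₁ →ₗ[ℂ] ℂ → M₂ →ₗ[ℂ] M₃) where
  carrier := {𝒴 | D.IsIntertwining Y₁ Y₂ Y₃ 𝒴 ∧ (intCoset '' {i | ∃ u v, 𝒴 u i v ≠ 0}).Finite}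
  add_mem' {𝒴 𝒵} h h' := by
    refine ⟨h.1.add h'.1, (h.2.union h'.2).subset ?_⟩
    rw [← Set.image_union]
    refine Set.image_mono ?_
    rintro i ⟨u, v, hi⟩
    by_contra hc
    simp only [Set.mem_union, Set.mem_ofPred_eq, not_or, not_exists, not_not] at hc
    refine hi ?_
    rw [LinearMap.add_apply, Pi.add_apply, LinearMap.add_apply, hc.1, hc.2, add_zero]
  zero_mem' := ⟨IsIntertwining.zero, by simp⟩
  smul_mem' c 𝒴 h := by
    refine ⟨h.1.smul c, h.2.subset (Set.image_mono ?_)⟩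
    rintro i ⟨u, v, hi⟩
    refine ⟨u, v, fun h0 => hi ?_⟩
    rw [LinearMap.smul_apply, Pi.smul_apply, LinearMap.smul_apply, h0, smul_zero]

theorem finiteCosetIntertwiners_le : D.finiteCosetIntertwiners Y₁ Y₂ Y₃ ≤ D.intertwiners Y₁ Y₂ Y₃ :=
  fun _ h => h.1

theorem finite_intCoset_of_mem (h : 𝒴 ∈ D.finiteCosetIntertwiners Y₁ Y₂ Y₃) (u : M₁) (v : M₂) :
    (intCoset '' {i | 𝒴 u i v ≠ 0}).Finite :=
  h.2.subset (Set.image_mono fun _ hi => ⟨u, v, hi⟩)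

/-- The part of an intertwining operator with exponents in one coset of `ℤ`. -/
def cosetPiece (h : D.IsIntertwining Y₁ Y₂ Y₃ 𝒴) (s : ℂ ⧸ AddSubgroup.zmultiples (1 : ℂ)) :
    D.finiteCosetIntertwiners Y₁ Y₂ Y₃ := by
  classical
  refine ⟨VertexData.cosetSMul (Pi.single s 1) 𝒴, h.cosetSMul _,
    (Set.finite_singleton s).subset ?_⟩
  rintro _ ⟨i, ⟨u, v, hi⟩, rfl⟩
  by_contra hc
  refine hi ?_
  show (Pi.single (M := fun _ => ℂ) s 1 (intCoset i) • 𝒴 u i) v = 0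
  rw [Pi.single_eq_of_ne hc, zero_smul, LinearMap.zero_apply]

theorem cosetPiece_apply_self (h : D.IsIntertwining Y₁ Y₂ Y₃ 𝒴) (u : M₁) (i : ℂ) (v : M₂) :
    (cosetPiece h (intCoset i)).1 u i v = 𝒴 u i v := by
  classical
  show (Pi.single (M := fun _ => ℂ) (intCoset i) 1 (intCoset i) • 𝒴 u i) v = _
  rw [Pi.single_eq_same, one_smul]

theorem cosetPiece_apply_of_ne (h : D.IsIntertwining Y₁ Y₂ Y₃ 𝒴)
    {s : ℂ ⧸ AddSubgroup.zmultiples (1 : ℂ)} (u : M₁) {i : ℂ} (hi : intCoset i ≠ s) (v : M₂) :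
    (cosetPiece h s).1 u i v = 0 := by
  classical
  show (Pi.single (M := fun _ => ℂ) s 1 (intCoset i) • 𝒴 u i) v = _
  rw [Pi.single_eq_of_ne hi, zero_smul, LinearMap.zero_apply]

/-- Choosing a nonzero coefficient in each coset that `𝒴` uses gives maps that are biorthogonal to
the pieces of `𝒴`. All pieces lie in a finite-dimensional space, so there are finitely many.
Assuming finiteness of the smaller space only is what the case of infinite fusion rules needs. -/
theorem finiteCosetIntertwiners_eq (hf : Module.Finite ℂ (D.finiteCosetIntertwiners Y₁ Y₂ Y₃)) :
    D.finiteCosetIntertwiners Y₁ Y₂ Y₃ = D.intertwiners Y₁ Y₂ Y₃ := by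
  refine le_antisymm finiteCosetIntertwiners_le fun 𝒴 h' => ?_
  have h : D.IsIntertwining Y₁ Y₂ Y₃ 𝒴 := h'
  have hfin : {s | ∃ i u v, intCoset i = s ∧ 𝒴 u i v ≠ 0}.Finite := by
    have hc : ∀ s : {s | ∃ i u v, intCoset i = s ∧ 𝒴 u i v ≠ 0}, ∃ i u v,
        intCoset i = s.1 ∧ 𝒴 u i v ≠ 0 := fun s => s.2
    choose i u v hi hne using hc
    refine finite_of_biorthogonal (fun s => cosetPiece h s.1)
      (fun s => (modeAt (u s) (i s) (v s)).comp (D.finiteCosetIntertwiners Y₁ Y₂ Y₃).subtype)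
      (fun s t hst => ?_) fun s => ?_
    · exact cosetPiece_apply_of_ne h _ (by rw [hi]; exact fun h0 => hst (Subtype.ext h0)) _
    · have := cosetPiece_apply_self h (u s) (i s) (v s)
      rw [hi] at this
      exact fun h0 => hne s (this.symm.trans h0)
  refine ⟨h, hfin.subset ?_⟩
  rintro _ ⟨i, ⟨u, v, hi⟩, rfl⟩
  exact ⟨i, u, v, rfl, hi⟩

end VertexData

end Intertwiners

theorem finite_support_of_fibers {α β X : Type*} [Zero X] (f : α × β → X) {S : Set α}
    (hS : S.Finite) (h1 : ∀ a b, f (a, b) ≠ 0 → a ∈ S)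
    (h2 : ∀ a, (Function.support fun b => f (a, b)).Finite) : (Function.support f).Finite :=
  (hS.biUnion fun a _ => (h2 a).image (Prod.mk a)).subset fun x hx =>
    Set.mem_biUnion (h1 x.1 x.2 hx) ⟨x.2, hx, rfl⟩

namespace IsJacobiTriple

variable {ι X : Type*} [CommRing ι] [AddCommGroup X]

theorem zero : IsJacobiTriple (0 : ℤ → ι → X) 0 0 where
  finite₁₂ p q := by simp
  bound₂₁ := ⟨0, fun _ _ _ => rfl⟩
  bound₀ := ⟨0, fun _ _ _ => rfl⟩
  jacobi l m n := by simp [leftExpansion, rightExpansion, innerExpansion]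

theorem add {F₁₂ F₂₁ F₀ G₁₂ G₂₁ G₀ : ℤ → ι → X} (h : IsJacobiTriple F₁₂ F₂₁ F₀)
    (h' : IsJacobiTriple G₁₂ G₂₁ G₀) :
    IsJacobiTriple (F₁₂ + G₁₂) (F₂₁ + G₂₁) (F₀ + G₀) where
  finite₁₂ p q := by
    refine ((h.finite₁₂ p q).union (h'.finite₁₂ p q)).subset fun i hi => ?_
    by_contra hc
    simp only [Set.mem_union, Function.mem_support, not_or, not_not] at hc
    exact hi (by simp [hc.1, hc.2])
  bound₂₁ := by
    obtain ⟨P, hP⟩ := h.bound₂₁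
    obtain ⟨P', hP'⟩ := h'.bound₂₁
    exact ⟨P + P', fun p q hp => by
      simp [hP p q (by push_cast at hp; omega), hP' p q (by push_cast at hp; omega)]⟩
  bound₀ := by
    obtain ⟨P, hP⟩ := h.bound₀
    obtain ⟨P', hP'⟩ := h'.bound₀
    exact ⟨P + P', fun p q hp => by
      simp [hP p q (by push_cast at hp; omega), hP' p q (by push_cast at hp; omega)]⟩
  jacobi l m n := by
    have hs {f : ℕ → X} (hf : (Function.support f).Finite) (c : ℕ → ℤ) :
        (Function.support fun i => c i • f i).Finite :=
      hf.subset fun i hi h0 => hi (by simp [h0])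
    obtain ⟨P, hP⟩ := h.bound₂₁
    obtain ⟨P', hP'⟩ := h'.bound₂₁
    obtain ⟨Q, hQ⟩ := h.bound₀
    obtain ⟨Q', hQ'⟩ := h'.bound₀
    have e1 : leftExpansion (F₁₂ + G₁₂) l m n =
        leftExpansion F₁₂ l m n + leftExpansion G₁₂ l m n := by
      simp only [leftExpansion, Pi.add_apply, smul_add]
      exact finsum_add_distrib (hs (h.finite₁₂ _ _) _) (hs (h'.finite₁₂ _ _) _)
    have e2 : rightExpansion (F₂₁ + G₂₁) l m n =
        rightExpansion F₂₁ l m n + rightExpansion G₂₁ l m n := by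
      simp only [rightExpansion, Pi.add_apply, smul_add]
      exact finsum_add_distrib (hs (support_finite_of_bound hP _ _) _)
        (hs (support_finite_of_bound hP' _ _) _)
    have e3 : innerExpansion (F₀ + G₀) l m n =
        innerExpansion F₀ l m n + innerExpansion G₀ l m n := by
      simp only [innerExpansion, Pi.add_apply, smul_add]
      exact finsum_add_distrib (hs (support_finite_of_bound hQ _ _) _)
        (hs (support_finite_of_bound hQ' _ _) _)
    rw [e1, e2, e3, ← h.jacobi, ← h'.jacobi]
    abel

end IsJacobiTriple

/-! ### The Jacobi identity for fixed vectors -/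

section JacobiTriples

variable {V M M₁ M₂ M₃ : Type*} [AddCommGroup V] [Module ℂ V] [AddCommGroup M] [Module ℂ M]
  [AddCommGroup M₁] [Module ℂ M₁] [AddCommGroup M₂] [Module ℂ M₂] [AddCommGroup M₃] [Module ℂ M₃]

theorem exists_ncoeff_bound (A : VertexOperator ℂ M) (x : M) :
    ∃ P : ℕ, ∀ p : ℤ, (P : ℤ) ≤ p → (A[[p]]) x = 0 :=
  ⟨(-HahnSeries.order ((HahnModule.of ℂ).symm (A x))).toNat, fun p hp =>
    VertexOperator.ncoeff_eq_zero_of_lt_order A _ x (by omega)⟩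

/-- The three expansions in the Jacobi identity for `a`, `u` and `v`. -/
def JacobiAt {ι : Type*} [CommRing ι] (Y₁ : V →ₗ[ℂ] VertexOperator ℂ M₁)
    (Y₂ : V →ₗ[ℂ] VertexOperator ℂ M₂) (Y₃ : V →ₗ[ℂ] VertexOperator ℂ M₃)
    (𝒴 : M₁ →ₗ[ℂ] ι → M₂ →ₗ[ℂ] M₃) (a : V) (u : M₁) (v : M₂) : Prop :=
  IsJacobiTriple (fun p q => ((Y₃ a)[[p]]) (𝒴 u q v)) (fun p q => 𝒴 u q (((Y₂ a)[[p]]) v))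
    (fun p q => 𝒴 (((Y₁ a)[[p]]) u) q v)

variable {ι : Type*} [CommRing ι] {Y₁ : V →ₗ[ℂ] VertexOperator ℂ M₁}
  {Y₂ : V →ₗ[ℂ] VertexOperator ℂ M₂} {Y₃ : V →ₗ[ℂ] VertexOperator ℂ M₃}
  {𝒴 : M₁ →ₗ[ℂ] ι → M₂ →ₗ[ℂ] M₃}

theorem JacobiIdentity.jacobiAt (h : JacobiIdentity Y₁ Y₂ Y₃ fun u n => 𝒴 u n) (a : V) (u : M₁)
    (v : M₂) (hfin : ∀ q, (Function.support fun i : ℕ => 𝒴 u (q + i) v).Finite) :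
    JacobiAt Y₁ Y₂ Y₃ 𝒴 a u v where
  finite₁₂ p q := (hfin q).subset fun i hi h0 => hi (by
    have h0 : 𝒴 u (q + i) v = 0 := h0
    simp only; rw [h0, map_zero])
  bound₂₁ := (exists_ncoeff_bound (Y₂ a) v).imp fun P hP p q hp => by
    rw [hP p hp, map_zero]
  bound₀ := (exists_ncoeff_bound (Y₁ a) u).imp fun P hP p q hp => by
    rw [hP p hp, map_zero]; rfl
  jacobi l m n := by
    have e := h a u v l m n
    simpa only [leftExpansion, rightExpansion, innerExpansion, altChoose, ← mul_assoc] using e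

theorem jacobiIdentity_of_jacobiAt (h : ∀ a u v, JacobiAt Y₁ Y₂ Y₃ 𝒴 a u v) :
    JacobiIdentity Y₁ Y₂ Y₃ fun u n => 𝒴 u n := fun a u v l m n => by
  have e := (h a u v).jacobi l m n
  simpa only [leftExpansion, rightExpansion, innerExpansion, altChoose, ← mul_assoc] using e

namespace JacobiAt

variable {a a' : V} {u u' : M₁} {v v' : M₂}

theorem _root_.IsJacobiTriple.congr {ι X : Type*} [CommRing ι] [AddCommGroup X]
    {F₁₂ F₂₁ F₀ G₁₂ G₂₁ G₀ : ℤ → ι → X} (h : IsJacobiTriple F₁₂ F₂₁ F₀)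
    (h1 : ∀ p q, G₁₂ p q = F₁₂ p q) (h2 : ∀ p q, G₂₁ p q = F₂₁ p q)
    (h3 : ∀ p q, G₀ p q = F₀ p q) : IsJacobiTriple G₁₂ G₂₁ G₀ := by
  obtain rfl : G₁₂ = F₁₂ := funext₂ h1
  obtain rfl : G₂₁ = F₂₁ := funext₂ h2
  obtain rfl : G₀ = F₀ := funext₂ h3
  exact h

theorem add_algebra (h : JacobiAt Y₁ Y₂ Y₃ 𝒴 a u v) (h' : JacobiAt Y₁ Y₂ Y₃ 𝒴 a' u v) :
    JacobiAt Y₁ Y₂ Y₃ 𝒴 (a + a') u v :=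
  (IsJacobiTriple.add h h').congr (fun p q => by simp) (fun p q => by simp) fun p q => by simp

theorem add_left (h : JacobiAt Y₁ Y₂ Y₃ 𝒴 a u v) (h' : JacobiAt Y₁ Y₂ Y₃ 𝒴 a u' v) :
    JacobiAt Y₁ Y₂ Y₃ 𝒴 a (u + u') v :=
  (IsJacobiTriple.add h h').congr (fun p q => by simp) (fun p q => by simp) fun p q => by simp

theorem add_right (h : JacobiAt Y₁ Y₂ Y₃ 𝒴 a u v) (h' : JacobiAt Y₁ Y₂ Y₃ 𝒴 a u v') :
    JacobiAt Y₁ Y₂ Y₃ 𝒴 a u (v + v') :=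
  (IsJacobiTriple.add h h').congr (fun p q => by simp) (fun p q => by simp) fun p q => by simp

theorem zero_algebra : JacobiAt Y₁ Y₂ Y₃ 𝒴 0 u v :=
  IsJacobiTriple.zero.congr (fun p q => by simp) (fun p q => by simp) fun p q => by simp

theorem zero_left : JacobiAt Y₁ Y₂ Y₃ 𝒴 a 0 v :=
  IsJacobiTriple.zero.congr (fun p q => by simp) (fun p q => by simp) fun p q => by simp

theorem zero_right : JacobiAt Y₁ Y₂ Y₃ 𝒴 a u 0 :=
  IsJacobiTriple.zero.congr (fun p q => by simp) (fun p q => by simp) fun p q => by simp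

end JacobiAt

end JacobiTriples

/-! ### The product of two intertwining operators -/

section TensorModes

variable {V W M N : Type*} [AddCommGroup V] [Module ℂ V] [AddCommGroup W] [Module ℂ W]
  [AddCommGroup M] [Module ℂ M] [AddCommGroup N] [Module ℂ N]

theorem tmul_ncoeff_support_finite (A : VertexOperator ℂ M) (B : VertexOperator ℂ N) (m : ℤ)
    (x : M) (y : N) :
    (Function.support fun i : ℤ => (A[[i]]) x ⊗ₜ[ℂ] (B[[m - 1 - i]]) y).Finite := by
  obtain ⟨P, hP⟩ := exists_ncoeff_bound A x
  obtain ⟨Q, hQ⟩ := exists_ncoeff_bound B y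
  refine (Set.finite_Icc (m - Q) P).subset fun i hi => ⟨?_, ?_⟩
  · by_contra hc
    exact hi (by simp only; rw [hQ _ (by omega), TensorProduct.tmul_zero])
  · by_contra hc
    exact hi (by simp only; rw [hP _ (by omega), TensorProduct.zero_tmul])

variable {D : VertexData V} {E : VertexData W} {Y : V →ₗ[ℂ] VertexOperator ℂ M}
  {Z : W →ₗ[ℂ] VertexOperator ℂ N}

theorem tensorAction_tmul_vacuum (hZ : E.IsWeakModule Z) (a : V) (n : ℤ) (u : M) (v : N) :
    ((tensorAction Y Z (a ⊗ₜ E.vacuum))[[n]]) (u ⊗ₜ v) = ((Y a)[[n]]) u ⊗ₜ v := by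
  rw [tensorAction_ncoeff, finsum_eq_single _ n]
  · simp [hZ.vacuum]
  · intro i hi
    rw [hZ.vacuum, if_neg (by omega), LinearMap.zero_apply, TensorProduct.tmul_zero]

theorem tensorAction_vacuum_tmul (hY : D.IsWeakModule Y) (b : W) (n : ℤ) (u : M) (v : N) :
    ((tensorAction Y Z (D.vacuum ⊗ₜ b))[[n]]) (u ⊗ₜ v) = u ⊗ₜ ((Z b)[[n]]) v := by
  rw [tensorAction_ncoeff, finsum_eq_single _ (-1)]
  · simp [hY.vacuum]
  · intro i hi
    rw [hY.vacuum, if_neg hi, LinearMap.zero_apply, TensorProduct.zero_tmul]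

theorem vir_tensor_tmul (hY : D.IsWeakModule Y) (hZ : E.IsWeakModule Z) (n : ℤ) (u : M) (v : N) :
    (D.tensor E).vir (tensorAction Y Z) n (u ⊗ₜ v) =
      D.vir Y n u ⊗ₜ v + u ⊗ₜ E.vir Z n v := by
  show ((tensorAction Y Z (D.conformal ⊗ₜ E.vacuum + D.vacuum ⊗ₜ E.conformal))[[n + 1]])
    (u ⊗ₜ v) = _
  rw [map_add, map_add, Pi.add_apply, LinearMap.add_apply, tensorAction_tmul_vacuum hZ,
    tensorAction_vacuum_tmul hY]
  rfl

end TensorModes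

section TensorIntertwiner

variable {M₁ M₂ M₃ N₁ N₂ N₃ : Type*}
  [AddCommGroup M₁] [Module ℂ M₁] [AddCommGroup M₂] [Module ℂ M₂] [AddCommGroup M₃] [Module ℂ M₃]
  [AddCommGroup N₁] [Module ℂ N₁] [AddCommGroup N₂] [Module ℂ N₂] [AddCommGroup N₃] [Module ℂ N₃]
  {𝒴 : M₁ →ₗ[ℂ] ℂ → M₂ →ₗ[ℂ] M₃} {𝒵 : N₁ →ₗ[ℂ] ℂ → N₂ →ₗ[ℂ] N₃}

/-- The coefficient of index `n` in `𝒴(u₁, z) ⊗ 𝒵(v₁, z)`. -/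
def tensorMode (h : HasTensor 𝒴 𝒵) (u₁ : M₁) (v₁ : N₁) (n : ℂ) :
    M₂ ⊗[ℂ] N₂ →ₗ[ℂ] M₃ ⊗[ℂ] N₃ :=
  TensorProduct.lift <| LinearMap.mk₂ ℂ
    (fun u₂ v₂ => ∑ᶠ i : ℂ, 𝒴 u₁ i u₂ ⊗ₜ[ℂ] 𝒵 v₁ (n - 1 - i) v₂)
    (fun u u' v => by
      rw [← finsum_add_distrib (h u₁ u v₁ v n) (h u₁ u' v₁ v n)]
      exact finsum_congr fun i => by rw [map_add, TensorProduct.add_tmul])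
    (fun c u v => by
      rw [smul_finsum' c (h u₁ u v₁ v n)]
      exact finsum_congr fun i => by rw [map_smul, TensorProduct.smul_tmul'])
    (fun u v v' => by
      rw [← finsum_add_distrib (h u₁ u v₁ v n) (h u₁ u v₁ v' n)]
      exact finsum_congr fun i => by rw [map_add, TensorProduct.tmul_add])
    (fun c u v => by
      rw [smul_finsum' c (h u₁ u v₁ v n)]
      exact finsum_congr fun i => by rw [map_smul, TensorProduct.tmul_smul])

theorem tensorMode_tmul (h : HasTensor 𝒴 𝒵) (u₁ : M₁) (v₁ : N₁) (n : ℂ) (u₂ : M₂) (v₂ : N₂) :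
    tensorMode h u₁ v₁ n (u₂ ⊗ₜ v₂) = ∑ᶠ i : ℂ, 𝒴 u₁ i u₂ ⊗ₜ[ℂ] 𝒵 v₁ (n - 1 - i) v₂ := rfl

/-- The operator `𝒴 ⊗ 𝒵`, given by `u₁ ⊗ v₁ ↦ 𝒴(u₁, z) ⊗ 𝒵(v₁, z)`. -/
def tensorIntertwiner (h : HasTensor 𝒴 𝒵) :
    M₁ ⊗[ℂ] N₁ →ₗ[ℂ] ℂ → M₂ ⊗[ℂ] N₂ →ₗ[ℂ] M₃ ⊗[ℂ] N₃ :=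
  TensorProduct.lift <| LinearMap.mk₂ ℂ (tensorMode h)
    (fun u u' v => funext fun n => TensorProduct.ext' fun u₂ v₂ => by
      simp only [Pi.add_apply, LinearMap.add_apply, tensorMode_tmul]
      rw [← finsum_add_distrib (h u u₂ v v₂ n) (h u' u₂ v v₂ n)]
      exact finsum_congr fun i => by
        rw [map_add, Pi.add_apply, LinearMap.add_apply, TensorProduct.add_tmul])
    (fun c u v => funext fun n => TensorProduct.ext' fun u₂ v₂ => by
      simp only [Pi.smul_apply, LinearMap.smul_apply, tensorMode_tmul]
      rw [smul_finsum' c (h u u₂ v v₂ n)]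
      exact finsum_congr fun i => by
        rw [map_smul, Pi.smul_apply, LinearMap.smul_apply, TensorProduct.smul_tmul'])
    (fun u v v' => funext fun n => TensorProduct.ext' fun u₂ v₂ => by
      simp only [Pi.add_apply, LinearMap.add_apply, tensorMode_tmul]
      rw [← finsum_add_distrib (h u u₂ v v₂ n) (h u u₂ v' v₂ n)]
      exact finsum_congr fun i => by
        rw [map_add, Pi.add_apply, LinearMap.add_apply, TensorProduct.tmul_add])
    (fun c u v => funext fun n => TensorProduct.ext' fun u₂ v₂ => by
      simp only [Pi.smul_apply, LinearMap.smul_apply, tensorMode_tmul]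
      rw [smul_finsum' c (h u u₂ v v₂ n)]
      exact finsum_congr fun i => by
        rw [map_smul, Pi.smul_apply, LinearMap.smul_apply, TensorProduct.tmul_smul])

theorem tensorIntertwiner_tmul (h : HasTensor 𝒴 𝒵) (u₁ : M₁) (v₁ : N₁) (n : ℂ) (u₂ : M₂)
    (v₂ : N₂) : tensorIntertwiner h (u₁ ⊗ₜ v₁) n (u₂ ⊗ₜ v₂) =
      ∑ᶠ i : ℂ, 𝒴 u₁ i u₂ ⊗ₜ[ℂ] 𝒵 v₁ (n - 1 - i) v₂ := rfl

theorem isTensor_tensorIntertwiner (h : HasTensor 𝒴 𝒵) :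
    IsTensor 𝒴 𝒵 (tensorIntertwiner h) :=
  ⟨h, fun u₁ u₂ v₁ v₂ n => tensorIntertwiner_tmul h u₁ v₁ n u₂ v₂⟩

end TensorIntertwiner

section TensorIntertwiner

variable {V W M₁ M₂ M₃ N₁ N₂ N₃ : Type*} [AddCommGroup V] [Module ℂ V] [AddCommGroup W] [Module ℂ W]
  [AddCommGroup M₁] [Module ℂ M₁] [AddCommGroup M₂] [Module ℂ M₂] [AddCommGroup M₃] [Module ℂ M₃]
  [AddCommGroup N₁] [Module ℂ N₁] [AddCommGroup N₂] [Module ℂ N₂] [AddCommGroup N₃] [Module ℂ N₃]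
  {D : VertexData V} {E : VertexData W}
  {Y₁ : V →ₗ[ℂ] VertexOperator ℂ M₁} {Y₂ : V →ₗ[ℂ] VertexOperator ℂ M₂}
  {Y₃ : V →ₗ[ℂ] VertexOperator ℂ M₃}
  {Z₁ : W →ₗ[ℂ] VertexOperator ℂ N₁} {Z₂ : W →ₗ[ℂ] VertexOperator ℂ N₂}
  {Z₃ : W →ₗ[ℂ] VertexOperator ℂ N₃}
  {𝒴 : M₁ →ₗ[ℂ] ℂ → M₂ →ₗ[ℂ] M₃} {𝒵 : N₁ →ₗ[ℂ] ℂ → N₂ →ₗ[ℂ] N₃}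

/-- The coefficientwise bound on `𝒴(u₁, z) u₂ ⊗ 𝒵(v₁, z) v₂` from above. -/
def TensorBounded (𝒴 : M₁ →ₗ[ℂ] ℂ → M₂ →ₗ[ℂ] M₃) (𝒵 : N₁ →ₗ[ℂ] ℂ → N₂ →ₗ[ℂ] N₃) : Prop :=
  ∀ (u₁ : M₁) (u₂ : M₂) (v₁ : N₁) (v₂ : N₂) (c : ℂ),
    ∃ N : ℤ, ∀ n : ℤ, N ≤ n → ∀ i, 𝒴 u₁ i u₂ ⊗ₜ[ℂ] 𝒵 v₁ (n + c - 1 - i) v₂ = 0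

theorem tensorIntertwiner_truncation (ht : HasTensor 𝒴 𝒵) (hb : TensorBounded 𝒴 𝒵)
    (x : M₁ ⊗[ℂ] N₁) (y : M₂ ⊗[ℂ] N₂) (c : ℂ) :
    ∃ N : ℤ, ∀ n : ℤ, N ≤ n → tensorIntertwiner ht x (n + c) y = 0 := by
  induction x using TensorProduct.induction_on with
  | zero => exact ⟨0, fun n _ => by rw [map_zero]; rfl⟩
  | tmul u₁ v₁ =>
    induction y using TensorProduct.induction_on with
    | zero => exact ⟨0, fun n _ => map_zero _⟩
    | tmul u₂ v₂ =>
      obtain ⟨N, hN⟩ := hb u₁ u₂ v₁ v₂ c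
      exact ⟨N, fun n hn => finsum_eq_zero_of_forall_eq_zero (hN n hn)⟩
    | add y y' hy hy' =>
      obtain ⟨N, hN⟩ := hy
      obtain ⟨N', hN'⟩ := hy'
      exact ⟨max N N', fun n hn => by
        rw [map_add, hN n ((le_max_left _ _).trans hn), hN' n ((le_max_right _ _).trans hn),
          add_zero]⟩
  | add x x' hx hx' =>
    obtain ⟨N, hN⟩ := hx
    obtain ⟨N', hN'⟩ := hx'
    exact ⟨max N N', fun n hn => by
      rw [map_add, Pi.add_apply, LinearMap.add_apply, hN n ((le_max_left _ _).trans hn),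
        hN' n ((le_max_right _ _).trans hn), add_zero]⟩

/-- A vanishing tensor stays zero under the modes of `Y` and `Z`. Since `i` raises the total index
of `𝒴 ⊗ 𝒵`, `TensorBounded` bounds `i`. For each `i`, `HasTensor` leaves finitely many indices of
`𝒴`, and for each of these finitely many pairs of modes act nontrivially. -/
theorem tmul_support_finite₁₂ (Y : VertexOperator ℂ M₃) (Z : VertexOperator ℂ N₃)
    (ht : HasTensor 𝒴 𝒵) (hb : TensorBounded 𝒴 𝒵) (u₁ : M₁) (v₁ : N₁) (u₂ : M₂) (v₂ : N₂)
    (l : ℤ) (n : ℂ) :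
    (Function.support fun x : ℕ × ℤ × ℂ => (Y[[x.2.1]]) (𝒴 u₁ x.2.2 u₂) ⊗ₜ[ℂ]
      (Z[[l - x.1 - 1 - x.2.1]]) (𝒵 v₁ (n + x.1 - 1 - x.2.2) v₂)).Finite := by
  have hzero : ∀ (i : ℕ) (a : ℤ) (b : ℂ), 𝒴 u₁ b u₂ ⊗ₜ[ℂ] 𝒵 v₁ (n + i - 1 - b) v₂ = 0 →
      (Y[[a]]) (𝒴 u₁ b u₂) ⊗ₜ[ℂ] (Z[[l - i - 1 - a]]) (𝒵 v₁ (n + i - 1 - b) v₂) = 0 := by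
    intro i a b h0
    have := congrArg (TensorProduct.map (Y[[a]]) (Z[[l - i - 1 - a]])) h0
    rwa [map_zero, TensorProduct.map_tmul] at this
  obtain ⟨N, hN⟩ := hb u₁ u₂ v₁ v₂ n
  refine finite_support_of_fibers _ (Set.finite_Iio N.toNat) ?_ fun i => ?_
  · rintro i ⟨a, b⟩ hx
    by_contra hc
    refine hx (hzero i a b ?_)
    have := hN i (by simp only [Set.mem_Iio, not_lt] at hc; omega) b
    rwa [Int.cast_natCast, add_comm (i : ℂ)] at this
  · have h : (Function.support fun x : ℂ × ℤ => (Y[[x.2]]) (𝒴 u₁ x.1 u₂) ⊗ₜ[ℂ]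
        (Z[[l - i - 1 - x.2]]) (𝒵 v₁ (n + i - 1 - x.1) v₂)).Finite :=
      finite_support_of_fibers _ (ht u₁ u₂ v₁ v₂ (n + i))
        (fun b a hx h0 => hx (hzero i a b h0))
        fun b => tmul_ncoeff_support_finite Y Z (l - i) (𝒴 u₁ b u₂) (𝒵 v₁ (n + i - 1 - b) v₂)
    exact h.preimage (f := Prod.swap) Prod.swap_injective.injOn

theorem convFinite₂₁ (Y : VertexOperator ℂ M₂) (Z : VertexOperator ℂ N₂)
    (ht : HasTensor 𝒴 𝒵) (u₁ : M₁) (v₁ : N₁) (u₂ : M₂) (v₂ : N₂) :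
    ConvFinite (fun p q => 𝒴 u₁ q ((Y[[p]]) u₂)) (fun p q => 𝒵 v₁ q ((Z[[p]]) v₂)) :=
  fun p q => finite_support_of_fibers _ (tmul_ncoeff_support_finite Y Z p u₂ v₂)
    (fun a b hx h0 => hx (by
      have := congrArg (TensorProduct.map (𝒴 u₁ b) (𝒵 v₁ (q - 1 - b))) h0
      rwa [map_zero, TensorProduct.map_tmul] at this))
    fun a => ht u₁ ((Y[[a]]) u₂) v₁ ((Z[[p - 1 - a]]) v₂) q

theorem convFinite₀ (Y : VertexOperator ℂ M₁) (Z : VertexOperator ℂ N₁)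
    (ht : HasTensor 𝒴 𝒵) (u₁ : M₁) (v₁ : N₁) (u₂ : M₂) (v₂ : N₂) :
    ConvFinite (fun p q => 𝒴 ((Y[[p]]) u₁) q u₂) (fun p q => 𝒵 ((Z[[p]]) v₁) q v₂) :=
  fun p q => finite_support_of_fibers _ (tmul_ncoeff_support_finite Y Z p u₁ v₁)
    (fun a b hx h0 => hx (by
      have := congrArg (TensorProduct.map (LinearMap.applyₗ u₂ ∘ₗ LinearMap.proj b ∘ₗ 𝒴)
        (LinearMap.applyₗ v₂ ∘ₗ LinearMap.proj (q - 1 - b) ∘ₗ 𝒵)) h0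
      rwa [map_zero, TensorProduct.map_tmul] at this))
    fun a => ht ((Y[[a]]) u₁) u₂ ((Z[[p - 1 - a]]) v₁) v₂ q

/-- The Jacobi identity for a product of intertwining operators. -/
theorem jacobiAt_tmul (h : D.IsIntertwining Y₁ Y₂ Y₃ 𝒴) (h' : E.IsIntertwining Z₁ Z₂ Z₃ 𝒵)
    (ht : HasTensor 𝒴 𝒵) (hb : TensorBounded 𝒴 𝒵) (a : V) (b : W) (u₁ : M₁) (v₁ : N₁) (u₂ : M₂)
    (v₂ : N₂) :
    JacobiAt (tensorAction Y₁ Z₁) (tensorAction Y₂ Z₂) (tensorAction Y₃ Z₃) (tensorIntertwiner ht)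
      (a ⊗ₜ b) (u₁ ⊗ₜ v₁) (u₂ ⊗ₜ v₂) := by
  refine ((h.jacobi.jacobiAt a u₁ u₂ (h.support_finite u₁ u₂)).conv
    (h'.jacobi.jacobiAt b v₁ v₂ (h'.support_finite v₁ v₂))
    (tmul_support_finite₁₂ (Y₃ a) (Z₃ b) ht hb u₁ v₁ u₂ v₂)
    (convFinite₂₁ (Y₂ a) (Z₂ b) ht u₁ v₁ u₂ v₂)
    (convFinite₀ (Y₁ a) (Z₁ b) ht u₁ v₁ u₂ v₂)).congr (fun p q => ?_) (fun p q => ?_) fun p q => ?_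
  -- Here the algebra acts after the intertwining operators, so the index of `𝒴` must be the outer
  -- one; in the other two expansions the algebra acts on an argument, and its index is the outer
  -- one.
  · have hfin := (tmul_support_finite₁₂ (Y₃ a) (Z₃ b) ht hb u₁ v₁ u₂ v₂ p q).preimage
      (f := fun x : ℂ × ℤ => (0, x.2, x.1)) (fun x _ y _ hxy => by
        simp only [Prod.mk.injEq, true_and] at hxy
        exact Prod.ext hxy.2 hxy.1)
    have hfin' : (Function.support fun x : ℂ × ℤ => ((Y₃ a)[[x.2]]) (𝒴 u₁ x.1 u₂) ⊗ₜ[ℂ]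
        ((Z₃ b)[[p - 1 - x.2]]) (𝒵 v₁ (q - 1 - x.1) v₂)).Finite := by
      refine hfin.subset fun x hx => ?_
      simpa using hx
    rw [conv, ← finsum_comp_equiv (Equiv.prodComm ℂ ℤ)]
    simp only [Equiv.prodComm_apply, Prod.fst_swap, Prod.snd_swap]
    rw [finsum_curry _ hfin', tensorIntertwiner_tmul, map_finsum _ (ht u₁ u₂ v₁ v₂ q)]
    exact finsum_congr fun i => tensorAction_ncoeff Y₃ Z₃ a b p _ _
  · rw [conv, finsum_curry _ (convFinite₂₁ (Y₂ a) (Z₂ b) ht u₁ v₁ u₂ v₂ p q), tensorAction_ncoeff,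
      map_finsum _ (tmul_ncoeff_support_finite (Y₂ a) (Z₂ b) p u₂ v₂)]
    exact finsum_congr fun i => tensorIntertwiner_tmul ht _ _ _ _ _
  · rw [conv, finsum_curry _ (convFinite₀ (Y₁ a) (Z₁ b) ht u₁ v₁ u₂ v₂ p q), tensorAction_ncoeff]
    have := map_finsum (LinearMap.applyₗ (u₂ ⊗ₜ[ℂ] v₂) ∘ₗ LinearMap.proj q ∘ₗ tensorIntertwiner ht)
      (tmul_ncoeff_support_finite (Y₁ a) (Z₁ b) p u₁ v₁)
    refine this.trans (finsum_congr fun i => tensorIntertwiner_tmul ht _ _ _ _ _)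

theorem jacobiIdentity_tensorIntertwiner (h : D.IsIntertwining Y₁ Y₂ Y₃ 𝒴)
    (h' : E.IsIntertwining Z₁ Z₂ Z₃ 𝒵) (ht : HasTensor 𝒴 𝒵) (hb : TensorBounded 𝒴 𝒵) :
    JacobiIdentity (tensorAction Y₁ Z₁) (tensorAction Y₂ Z₂) (tensorAction Y₃ Z₃)
      fun x n => tensorIntertwiner ht x n := by
  refine jacobiIdentity_of_jacobiAt fun c x y => ?_
  induction c using TensorProduct.induction_on with
  | zero => exact JacobiAt.zero_algebra
  | add c c' hc hc' => exact hc.add_algebra hc'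
  | tmul a b =>
    induction x using TensorProduct.induction_on with
    | zero => exact JacobiAt.zero_left
    | add x x' hx hx' => exact hx.add_left hx'
    | tmul u₁ v₁ =>
      induction y using TensorProduct.induction_on with
      | zero => exact JacobiAt.zero_right
      | add y y' hy hy' => exact hy.add_right hy'
      | tmul u₂ v₂ => exact jacobiAt_tmul h h' ht hb a b u₁ v₁ u₂ v₂

theorem derivative_tensorIntertwiner (h : D.IsIntertwining Y₁ Y₂ Y₃ 𝒴)
    (h' : E.IsIntertwining Z₁ Z₂ Z₃ 𝒵) (ht : HasTensor 𝒴 𝒵) (hY₁ : D.IsWeakModule Y₁)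
    (hZ₁ : E.IsWeakModule Z₁) (x : M₁ ⊗[ℂ] N₁) (n : ℂ) :
    tensorIntertwiner ht ((D.tensor E).vir (tensorAction Y₁ Z₁) (-1) x) n =
      (-n) • tensorIntertwiner ht x (n - 1) := by
  induction x using TensorProduct.induction_on with
  | zero => simp only [map_zero, Pi.zero_apply, smul_zero]
  | add x x' hx hx' => simp only [map_add, Pi.add_apply, smul_add, hx, hx']
  | tmul u₁ v₁ =>
    refine TensorProduct.ext' fun u₂ v₂ => ?_
    rw [vir_tensor_tmul hY₁ hZ₁, map_add, Pi.add_apply, LinearMap.add_apply,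
      tensorIntertwiner_tmul, tensorIntertwiner_tmul, LinearMap.smul_apply, tensorIntertwiner_tmul,
      smul_finsum' _ (ht u₁ u₂ v₁ v₂ (n - 1))]
    have hfin := ht u₁ u₂ v₁ v₂ (n - 1)
    have hs (c : ℂ → ℂ) : (Function.support fun i : ℂ =>
        c i • (𝒴 u₁ i u₂ ⊗ₜ[ℂ] 𝒵 v₁ (n - 1 - 1 - i) v₂)).Finite :=
      hfin.subset fun i hi h0 => hi (by simp only; rw [h0, smul_zero])
    -- The Leibniz rule: after the shift `i ↦ i + 1` in this sum, both sums run over the same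
    -- tensors, with factors `-(i + 1)` and `-(n - 1 - i)` adding up to `-n`.
    have e1 : ∑ᶠ i : ℂ, 𝒴 (D.vir Y₁ (-1) u₁) i u₂ ⊗ₜ[ℂ] 𝒵 v₁ (n - 1 - i) v₂ =
        ∑ᶠ i : ℂ, (-(i + 1)) • (𝒴 u₁ i u₂ ⊗ₜ[ℂ] 𝒵 v₁ (n - 1 - 1 - i) v₂) := by
      rw [← finsum_comp_equiv (Equiv.addRight (1 : ℂ))]
      refine finsum_congr fun i => ?_
      rw [Equiv.coe_addRight, h.derivative, LinearMap.smul_apply, TensorProduct.smul_tmul',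
        add_sub_cancel_right, show n - 1 - (i + 1) = n - 1 - 1 - i by ring]
    have e2 : ∑ᶠ i : ℂ, 𝒴 u₁ i u₂ ⊗ₜ[ℂ] 𝒵 (E.vir Z₁ (-1) v₁) (n - 1 - i) v₂ =
        ∑ᶠ i : ℂ, (-(n - 1 - i)) • (𝒴 u₁ i u₂ ⊗ₜ[ℂ] 𝒵 v₁ (n - 1 - 1 - i) v₂) := by
      refine finsum_congr fun i => ?_
      rw [h'.derivative, LinearMap.smul_apply, TensorProduct.tmul_smul,
        show n - 1 - i - 1 = n - 1 - 1 - i by ring]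
    rw [e1, e2, ← finsum_add_distrib (hs _) (hs _)]
    refine finsum_congr fun i => ?_
    rw [← add_smul]
    congr 1
    ring

/-- The product of two intertwining operators is an intertwining operator, if it is well defined. -/
theorem isIntertwining_tensorIntertwiner (hD : D.IsVOA) (hY₁ : D.IsModule Y₁)
    (hY₂ : D.IsModule Y₂) (hZ₁ : E.IsModule Z₁) (h : D.IsIntertwining Y₁ Y₂ Y₃ 𝒴)
    (h' : E.IsIntertwining Z₁ Z₂ Z₃ 𝒵) (ht : HasTensor 𝒴 𝒵) :
    (D.tensor E).IsIntertwining (tensorAction Y₁ Z₁) (tensorAction Y₂ Z₂) (tensorAction Y₃ Z₃)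
      (tensorIntertwiner ht) where
  truncation := tensorIntertwiner_truncation ht
    (VertexData.exists_tensor_bound hD hY₁ hY₂ h h' ht)
  jacobi := jacobiIdentity_tensorIntertwiner h h' ht
    (VertexData.exists_tensor_bound hD hY₁ hY₂ h h' ht)
  derivative := derivative_tensorIntertwiner h h' ht hY₁.toIsWeakModule hZ₁.toIsWeakModule

end TensorIntertwiner

/-! ### Linear algebra -/

section LinearAlgebra

variable {A B C X X' : Type*} [AddCommMonoid A] [Module ℂ A] [AddCommMonoid B] [Module ℂ B]
  [AddCommMonoid C] [Module ℂ C]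

/-- Products of functionals from two separating families separate the points of the tensor
product. -/
theorem tensor_eq_zero_of_separating {φ : X → Module.Dual ℂ A} {ψ : X' → Module.Dual ℂ B}
    (hφ : ∀ a, (∀ x, φ x a = 0) → a = 0) (hψ : ∀ b, (∀ y, ψ y b = 0) → b = 0) (t : A ⊗[ℂ] B)
    (ht : ∀ x y, TensorProduct.dualDistrib ℂ A B (φ x ⊗ₜ ψ y) t = 0) : t = 0 := by
  classical
  let _ : AddCommGroup A := Module.addCommMonoidToAddCommGroup ℂ
  let _ : AddCommGroup B := Module.addCommMonoidToAddCommGroup ℂ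
  have h1 : ∀ x, TensorProduct.lid ℂ B ((φ x).rTensor B t) = 0 := by
    refine fun x => hψ _ fun y => ?_
    have e : ψ y ∘ₗ (TensorProduct.lid ℂ B).toLinearMap ∘ₗ (φ x).rTensor B =
        TensorProduct.dualDistrib ℂ A B (φ x ⊗ₜ ψ y) :=
      TensorProduct.ext' fun a b => by simp
    exact (LinearMap.congr_fun e t).trans (ht x y)
  let b := Module.Basis.ofVectorSpace ℂ B
  let e := TensorProduct.equivFinsuppOfBasisRight (M := A) b
  have h2 : ∀ (x : X) k, φ x (e t k) = b.repr (TensorProduct.lid ℂ B ((φ x).rTensor B t)) k := by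
    intro x k
    have e2 : φ x ∘ₗ Finsupp.lapply k ∘ₗ e.toLinearMap =
        Finsupp.lapply k ∘ₗ b.repr.toLinearMap ∘ₗ (TensorProduct.lid ℂ B).toLinearMap ∘ₗ
          (φ x).rTensor B :=
      TensorProduct.ext' fun a b' => by
        simp [e, mul_comm]
    exact LinearMap.congr_fun e2 t
  refine (LinearEquiv.map_eq_zero_iff e).1 (Finsupp.ext fun k => hφ _ fun x => ?_)
  rw [h2, h1, map_zero, Finsupp.zero_apply]

/-- In a finite-dimensional space, a separating family of functionals spans the dual. -/
theorem span_range_eq_top_of_separating [Module.Finite ℂ A] {φ : X → Module.Dual ℂ A}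
    (hφ : ∀ a, (∀ x, φ x a = 0) → a = 0) : Submodule.span ℂ (Set.range φ) = ⊤ := by
  let _ : AddCommGroup A := Module.addCommMonoidToAddCommGroup ℂ
  rw [← Subspace.dualCoannihilator_dualAnnihilator_eq (W := Submodule.span ℂ (Set.range φ)),
    show (Submodule.span ℂ (Set.range φ)).dualCoannihilator = ⊥ from ?_,
    Submodule.dualAnnihilator_bot]
  refine (Submodule.eq_bot_iff _).2 fun a ha => hφ a fun x => ?_
  exact (Submodule.mem_dualCoannihilator a).1 ha _ (Submodule.subset_span ⟨x, rfl⟩)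

variable {σ : A ⊗[ℂ] B →ₗ[ℂ] C} {φ : X → Module.Dual ℂ A} {ψ : X' → Module.Dual ℂ B}
  {θ : X → X' → Module.Dual ℂ C}

theorem dualDistrib_eq_of_tmul (hσ : ∀ x y a b, θ x y (σ (a ⊗ₜ b)) = φ x a * ψ y b) (x : X)
    (y : X') (t : A ⊗[ℂ] B) : θ x y (σ t) = TensorProduct.dualDistrib ℂ A B (φ x ⊗ₜ ψ y) t := by
  have e : θ x y ∘ₗ σ = TensorProduct.dualDistrib ℂ A B (φ x ⊗ₜ ψ y) :=
    TensorProduct.ext' fun a b => by simp [hσ]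
  exact LinearMap.congr_fun e t

theorem injective_of_separating (hφ : ∀ a, (∀ x, φ x a = 0) → a = 0)
    (hψ : ∀ b, (∀ y, ψ y b = 0) → b = 0)
    (hσ : ∀ x y a b, θ x y (σ (a ⊗ₜ b)) = φ x a * ψ y b) : Function.Injective σ := by
  let _ : AddCommGroup A := Module.addCommMonoidToAddCommGroup ℂ
  let _ : AddCommGroup C := Module.addCommMonoidToAddCommGroup ℂ
  refine (injective_iff_map_eq_zero σ).2 fun t ht => ?_
  refine tensor_eq_zero_of_separating hφ hψ t fun x y => ?_
  rw [← dualDistrib_eq_of_tmul hσ, ht, map_zero]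

/-- An element `c` is determined by the matrix `θ x y c`, whose columns come from `A` by `hf` and
whose rows come from `B` by `hg`. Since `A` is finite-dimensional, its coordinates are finite
combinations of the `φ x`. The same combinations of rows are the coefficients of the columns in a
basis of `A`. -/
theorem surjective_of_slices [Module.Finite ℂ A] (hφ : ∀ a, (∀ x, φ x a = 0) → a = 0)
    (hθ : ∀ c, (∀ x y, θ x y c = 0) → c = 0)
    (hσ : ∀ x y a b, θ x y (σ (a ⊗ₜ b)) = φ x a * ψ y b)
    (hf : ∀ c y, ∃ a, ∀ x, φ x a = θ x y c) (hg : ∀ c x, ∃ b, ∀ y, ψ y b = θ x y c) :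
    Function.Surjective σ := by
  let _ : AddCommGroup A := Module.addCommMonoidToAddCommGroup ℂ
  let _ : AddCommGroup C := Module.addCommMonoidToAddCommGroup ℂ
  intro c
  choose f hf using hf c
  choose g hg using hg c
  let b := Module.finBasis ℂ A
  have h1 : ∀ k, ∃ m : X →₀ ℂ, (m.sum fun x r => r • φ x) = b.coord k := fun k =>
    Finsupp.mem_span_range_iff_exists_finsupp.1
      (span_range_eq_top_of_separating hφ ▸ Submodule.mem_top)
  choose m hm using h1
  -- Applying `ψ y` to the second factor gives `∑ r * θ x y c = ∑ r * φ x (f y)`, the coordinate `k`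
  -- of `f y`.
  refine ⟨∑ k, b k ⊗ₜ (m k).sum fun x r => r • g x, ?_⟩
  refine sub_eq_zero.1 (hθ _ fun x y => ?_)
  rw [map_sub, sub_eq_zero, map_sum, map_sum, ← hf, ← b.sum_repr (f y), map_sum]
  refine Finset.sum_congr rfl fun k _ => ?_
  rw [hσ, map_smul, smul_eq_mul, mul_comm]
  congr 1
  have e := LinearMap.congr_fun (hm k) (f y)
  rw [Module.Basis.coord_apply] at e
  rw [← e, Finsupp.sum, Finsupp.sum, map_sum, LinearMap.sum_apply]
  refine Finset.sum_congr rfl fun z _ => ?_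
  rw [map_smul, LinearMap.smul_apply, hg, hf]

theorem bijective_of_slices (hφ : ∀ a, (∀ x, φ x a = 0) → a = 0)
    (hψ : ∀ b, (∀ y, ψ y b = 0) → b = 0) (hθ : ∀ c, (∀ x y, θ x y c = 0) → c = 0)
    (hσ : ∀ x y a b, θ x y (σ (a ⊗ₜ b)) = φ x a * ψ y b)
    (hf : ∀ c y, ∃ a, ∀ x, φ x a = θ x y c) (hg : ∀ c x, ∃ b, ∀ y, ψ y b = θ x y c)
    (hfin : Module.Finite ℂ A ∨ Module.Finite ℂ B) : Function.Bijective σ := by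
  refine ⟨injective_of_separating hφ hψ hσ, ?_⟩
  rcases hfin with hA | hB
  · exact surjective_of_slices hφ hθ hσ hf hg
  · have h := surjective_of_slices (σ := σ ∘ₗ (TensorProduct.comm ℂ B A).toLinearMap)
      (φ := ψ) (ψ := φ) (θ := fun y x => θ x y) hψ (fun c hc => hθ c fun x y => hc y x)
      (fun y x b a => by simp [hσ, mul_comm]) hg hf
    intro c
    obtain ⟨t, ht⟩ := h c
    exact ⟨_, ht⟩

theorem toENat_rank_of_bijective (hσ : Function.Bijective σ) :
    Cardinal.toENat (Module.rank ℂ C) =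
      Cardinal.toENat (Module.rank ℂ A) * Cardinal.toENat (Module.rank ℂ B) := by
  let _ : AddCommGroup A := Module.addCommMonoidToAddCommGroup ℂ
  let _ : AddCommGroup B := Module.addCommMonoidToAddCommGroup ℂ
  have h := (LinearEquiv.ofBijective σ hσ).lift_rank_eq
  rw [← Cardinal.toENat_lift, ← h, Cardinal.toENat_lift, rank_tensorProduct, map_mul,
    Cardinal.toENat_lift, Cardinal.toENat_lift]

theorem toENat_rank_eq_top (h : ¬ Module.Finite ℂ A) :
    Cardinal.toENat (Module.rank ℂ A) = ⊤ := by
  let _ : AddCommGroup A := Module.addCommMonoidToAddCommGroup ℂ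
  rw [Cardinal.toENat_eq_top, ← not_lt, Module.rank_lt_aleph0_iff]
  exact h

theorem not_finite_of_injective (hσ : Function.Injective σ) (hA : ¬ Module.Finite ℂ A)
    {b : B} (hb : b ≠ 0) : ¬ Module.Finite ℂ C := by
  let _ : AddCommGroup A := Module.addCommMonoidToAddCommGroup ℂ
  let _ : AddCommGroup B := Module.addCommMonoidToAddCommGroup ℂ
  let _ : AddCommGroup C := Module.addCommMonoidToAddCommGroup ℂ
  intro hC
  refine hA (Module.Finite.of_injective (σ ∘ₗ (TensorProduct.mk ℂ A B).flip b)
    (hσ.comp ((injective_iff_map_eq_zero _).2 fun a ha => ?_)))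
  by_contra h0
  exact tmul_ne_zero_of_ne_zero h0 hb ha

theorem finite_of_injective [Module.Finite ℂ B] (f : A →ₗ[ℂ] B) (hf : Function.Injective f) :
    Module.Finite ℂ A := by
  let _ : AddCommGroup A := Module.addCommMonoidToAddCommGroup ℂ
  let _ : AddCommGroup B := Module.addCommMonoidToAddCommGroup ℂ
  exact Module.Finite.of_injective f hf

theorem exists_ne_zero_of_not_finite (hA : ¬ Module.Finite ℂ A) : ∃ a : A, a ≠ 0 := by
  by_contra! h
  have : Subsingleton A := ⟨fun a b => (h a).trans (h b).symm⟩
  exact hA inferInstance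

end LinearAlgebra

/-! ### Slices of an intertwining operator -/

namespace IsJacobiTriple

variable {ι X X' : Type*} [CommRing ι] [AddCommGroup X] [AddCommGroup X'] {F₁₂ F₂₁ F₀ : ℤ → ι → X}

/-- The image of a Jacobi triple under an additive map, with the second index shifted. -/
theorem map_shift (h : IsJacobiTriple F₁₂ F₂₁ F₀) (π : X →+ X') (c : ι) :
    IsJacobiTriple (fun p q => π (F₁₂ p (q + c))) (fun p q => π (F₂₁ p (q + c)))
      (fun p q => π (F₀ p (q + c))) where
  finite₁₂ p q := (h.finite₁₂ p (q + c)).subset fun i hi h0 => hi (by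
    have h0 : F₁₂ (p - i) (q + c + i) = 0 := h0
    simp only
    rw [add_right_comm, h0, map_zero])
  bound₂₁ := h.bound₂₁.imp fun P hP p q hp => by rw [hP _ _ hp, map_zero]
  bound₀ := h.bound₀.imp fun P hP p q hp => by rw [hP _ _ hp, map_zero]
  jacobi l m n := by
    have hs {f : ℕ → X} (hf : (Function.support f).Finite) (c : ℕ → ℤ) :
        (Function.support fun i => c i • f i).Finite :=
      hf.subset fun i hi h0 => hi (by simp [h0])
    obtain ⟨P, hP⟩ := h.bound₂₁
    obtain ⟨Q, hQ⟩ := h.bound₀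
    have e := congrArg π (h.jacobi l m (n + c))
    simp only [leftExpansion, rightExpansion, innerExpansion] at e ⊢
    rw [map_sub, map_finsum π (hs (h.finite₁₂ _ _) _),
      map_finsum π (hs (support_finite_of_bound hP _ _) _),
      map_finsum π (hs (support_finite_of_bound hQ _ _) _)] at e
    simpa only [map_zsmul, add_right_comm _ c, ← add_assoc, add_sub_right_comm _ c] using e

end IsJacobiTriple

namespace VertexData

section Slices

variable {V M₁ M₂ M₃ : Type*} [AddCommGroup V] [Module ℂ V]
  [AddCommGroup M₁] [Module ℂ M₁] [AddCommGroup M₂] [Module ℂ M₂] [AddCommGroup M₃] [Module ℂ M₃]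
  {U B₁ B₂ B₃ : Type*} [AddCommGroup U] [Module ℂ U]
  [AddCommGroup B₁] [Module ℂ B₁] [AddCommGroup B₂] [Module ℂ B₂] [AddCommGroup B₃] [Module ℂ B₃]
  {D : VertexData V} {T : VertexData U}
  {Y₁ : V →ₗ[ℂ] VertexOperator ℂ M₁} {Y₂ : V →ₗ[ℂ] VertexOperator ℂ M₂}
  {Y₃ : V →ₗ[ℂ] VertexOperator ℂ M₃}
  {X₁ : U →ₗ[ℂ] VertexOperator ℂ B₁} {X₂ : U →ₗ[ℂ] VertexOperator ℂ B₂}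
  {X₃ : U →ₗ[ℂ] VertexOperator ℂ B₃} {𝒴 : B₁ →ₗ[ℂ] ℂ → B₂ →ₗ[ℂ] B₃}

/-- The operator `z ^ c π 𝒴(α₁ u, z) α₂`. -/
def slice (α₁ : M₁ →ₗ[ℂ] B₁) (α₂ : M₂ →ₗ[ℂ] B₂) (π : B₃ →ₗ[ℂ] M₃) (c : ℂ)
    (𝒴 : B₁ →ₗ[ℂ] ℂ → B₂ →ₗ[ℂ] B₃) : M₁ →ₗ[ℂ] ℂ → M₂ →ₗ[ℂ] M₃ where
  toFun u n := π ∘ₗ 𝒴 (α₁ u) (n + c) ∘ₗ α₂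
  map_add' u u' := by funext n; ext v; simp
  map_smul' r u := by funext n; ext v; simp

/-- The Jacobi identity restricts along `j` and is insensitive to the shift of the index. Only the
derivative property needs the power of `z`. In the application `b` is the Virasoro element of the
other factor, and `s₁`, `s₂`, `s₃` are weights for it. The commutator with `b₁` evaluates the
contribution of `b₀ (α₁ u)` as `-c`, with `c = s₁ + s₂ - s₃`, and this turns the factor `-(n + c)`
into `-n`. -/
theorem IsIntertwining.slice (h : T.IsIntertwining X₁ X₂ X₃ 𝒴) {α₁ : M₁ →ₗ[ℂ] B₁}
    {α₂ : M₂ →ₗ[ℂ] B₂} {π : B₃ →ₗ[ℂ] M₃} (j : V → U)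
    (h₁ : ∀ a p u, ((X₁ (j a))[[p]]) (α₁ u) = α₁ (((Y₁ a)[[p]]) u))
    (h₂ : ∀ a p v, ((X₂ (j a))[[p]]) (α₂ v) = α₂ (((Y₂ a)[[p]]) v))
    (h₃ : ∀ a p w, π (((X₃ (j a))[[p]]) w) = ((Y₃ a)[[p]]) (π w)) {b : U} {s₁ s₂ s₃ : ℂ}
    (hb : ∀ u, T.vir X₁ (-1) (α₁ u) = α₁ (D.vir Y₁ (-1) u) + ((X₁ b)[[0]]) (α₁ u))
    (hs₁ : ∀ u, ((X₁ b)[[1]]) (α₁ u) = s₁ • α₁ u) (hs₂ : ∀ v, ((X₂ b)[[1]]) (α₂ v) = s₂ • α₂ v)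
    (hs₃ : ∀ w, π (((X₃ b)[[1]]) w) = s₃ • π w) :
    D.IsIntertwining Y₁ Y₂ Y₃ (slice α₁ α₂ π (s₁ + s₂ - s₃) 𝒴) where
  truncation u v c := by
    obtain ⟨N, hN⟩ := h.truncation (α₁ u) (α₂ v) (c + (s₁ + s₂ - s₃))
    refine ⟨N, fun n hn => ?_⟩
    show π (𝒴 (α₁ u) (n + c + (s₁ + s₂ - s₃)) (α₂ v)) = 0
    rw [add_assoc (n : ℂ), hN n hn, map_zero]
  jacobi := jacobiIdentity_of_jacobiAt fun a u v =>
    ((h.jacobi.jacobiAt (j a) (α₁ u) (α₂ v) (h.support_finite _ _)).map_shift π.toAddMonoidHom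
      (s₁ + s₂ - s₃)).congr
      (fun p q => (h₃ a p _).symm)
      (fun p q => congrArg (fun x => π (𝒴 (α₁ u) (q + (s₁ + s₂ - s₃)) x)) (h₂ a p v).symm)
      (fun p q => congrArg (fun x => π (𝒴 x (q + (s₁ + s₂ - s₃)) (α₂ v))) (h₁ a p u).symm)
  derivative u n := LinearMap.ext fun v => by
    set c := s₁ + s₂ - s₃ with hc
    have e := congrArg π (h.jacobi.commutator b (α₁ u) (α₂ v) 1 (n + c - 1))
    have d := congrArg (fun f => π (f (α₂ v))) (h.derivative (α₁ u) (n + c))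
    simp only [hb, map_add, Pi.add_apply, LinearMap.add_apply, LinearMap.smul_apply,
      map_smul] at d
    norm_num [Finset.sum_range_succ, hs₁, hs₂, hs₃] at e
    show π (𝒴 (α₁ (D.vir Y₁ (-1) u)) (n + c) (α₂ v)) = (-n) • π (𝒴 (α₁ u) (n - 1 + c) (α₂ v))
    rw [show n - 1 + c = n + c - 1 by ring]
    rw [hc] at *
    linear_combination (norm := module) d + e

end Slices

/-! ### Homogeneous matrix coefficients -/

section HomogeneousModes

variable {V M M₁ M₂ M₃ : Type*} [AddCommGroup V] [Module ℂ V] [AddCommGroup M] [Module ℂ M]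
  [AddCommGroup M₁] [Module ℂ M₁] [AddCommGroup M₂] [Module ℂ M₂] [AddCommGroup M₃] [Module ℂ M₃]
  {W N₁ N₂ N₃ : Type*} [AddCommGroup W] [Module ℂ W]
  [AddCommGroup N₁] [Module ℂ N₁] [AddCommGroup N₂] [Module ℂ N₂] [AddCommGroup N₃] [Module ℂ N₃]

/-- The functional `ψ` is supported on the weight space `M_(h)`. -/
def IsHomogeneousFunctional (D : VertexData V) (YM : V →ₗ[ℂ] VertexOperator ℂ M) (h : ℂ)
    (ψ : Module.Dual ℂ M) : Prop := ∀ x, ψ (D.vir YM 0 x) = h * ψ x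

/-- The coordinates with respect to a basis of homogeneous vectors are homogeneous and separate
points. -/
theorem IsModule.exists_homogeneousFunctional {D : VertexData V}
    {YM : V →ₗ[ℂ] VertexOperator ℂ M} (hM : D.IsModule YM) {x : M} (hx : x ≠ 0) :
    ∃ h ψ, D.IsHomogeneousFunctional YM h ψ ∧ ψ x ≠ 0 := by
  classical
  let b := hM.grading.collectedBasis fun h => Module.Basis.ofVectorSpace ℂ (D.weightSpace YM h)
  obtain ⟨k, hk⟩ : ∃ k, b.coord k x ≠ 0 := by
    by_contra! hc
    exact hx ((Module.Basis.forall_coord_eq_zero_iff b).1 hc)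
  refine ⟨k.1, b.coord k, fun y => ?_, hk⟩
  have e : b.coord k ∘ₗ D.vir YM 0 = k.1 • b.coord k := by
    refine b.ext fun k' => ?_
    have h1 : D.vir YM 0 (b k') = k'.1 • b k' :=
      Module.End.mem_eigenspace_iff.1 (hM.grading.collectedBasis_mem _ k')
    rw [LinearMap.comp_apply, h1, map_smul, LinearMap.smul_apply, Module.Basis.coord_apply,
      Module.Basis.repr_self]
    by_cases h2 : k' = k
    · rw [h2]
    · rw [Finsupp.single_eq_of_ne (Ne.symm h2), smul_zero, smul_zero]
  exact LinearMap.congr_fun e y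

/-- Homogeneous `u`, `v` and a homogeneous functional `ψ`; these determine the index `n` for which
`ψ (uₙ v)` can be nonzero. -/
structure HomogeneousMode (D : VertexData V) (Y₁ : V →ₗ[ℂ] VertexOperator ℂ M₁)
    (Y₂ : V →ₗ[ℂ] VertexOperator ℂ M₂) (Y₃ : V →ₗ[ℂ] VertexOperator ℂ M₃) where
  wt₁ : ℂ
  wt₂ : ℂ
  wt₃ : ℂ
  u : M₁
  v : M₂
  ψ : Module.Dual ℂ M₃
  u_mem : u ∈ D.weightSpace Y₁ wt₁
  v_mem : v ∈ D.weightSpace Y₂ wt₂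
  functional : D.IsHomogeneousFunctional Y₃ wt₃ ψ

variable {D : VertexData V} {E : VertexData W}
  {Y₁ : V →ₗ[ℂ] VertexOperator ℂ M₁} {Y₂ : V →ₗ[ℂ] VertexOperator ℂ M₂}
  {Y₃ : V →ₗ[ℂ] VertexOperator ℂ M₃}
  {Z₁ : W →ₗ[ℂ] VertexOperator ℂ N₁} {Z₂ : W →ₗ[ℂ] VertexOperator ℂ N₂}
  {Z₃ : W →ₗ[ℂ] VertexOperator ℂ N₃}
  {𝒴 : M₁ →ₗ[ℂ] ℂ → M₂ →ₗ[ℂ] M₃} {𝒵 : N₁ →ₗ[ℂ] ℂ → N₂ →ₗ[ℂ] N₃}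

theorem IsHomogeneousFunctional.apply_eq_zero {h t : ℂ} {ψ : Module.Dual ℂ M₃}
    (hψ : D.IsHomogeneousFunctional Y₃ h ψ) {x : M₃} (hx : x ∈ D.weightSpace Y₃ t) (ht : t ≠ h) :
    ψ x = 0 := by
  have e := hψ x
  rw [Module.End.mem_eigenspace_iff.1 hx, map_smul, smul_eq_mul] at e
  exact (mul_eq_zero.1 (show (t - h) * ψ x = 0 by linear_combination e)).resolve_left
    (sub_ne_zero.2 ht)

theorem tmul_mem_weightSpace (hY : D.IsWeakModule Y₁) (hZ : E.IsWeakModule Z₁) {s t : ℂ} {u : M₁}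
    {v : N₁} (hu : u ∈ D.weightSpace Y₁ s) (hv : v ∈ E.weightSpace Z₁ t) :
    u ⊗ₜ v ∈ (D.tensor E).weightSpace (tensorAction Y₁ Z₁) (s + t) := by
  rw [weightSpace, Module.End.mem_eigenspace_iff] at hu hv ⊢
  rw [vir_tensor_tmul hY hZ, hu, hv, add_smul, TensorProduct.tmul_smul, ← TensorProduct.smul_tmul']

theorem IsHomogeneousFunctional.tmul (hY : D.IsWeakModule Y₃) (hZ : E.IsWeakModule Z₃) {s t : ℂ}
    {ψ : Module.Dual ℂ M₃} {φ : Module.Dual ℂ N₃} (hψ : D.IsHomogeneousFunctional Y₃ s ψ)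
    (hφ : E.IsHomogeneousFunctional Z₃ t φ) :
    (D.tensor E).IsHomogeneousFunctional (tensorAction Y₃ Z₃) (s + t)
      (TensorProduct.dualDistrib ℂ M₃ N₃ (ψ ⊗ₜ φ)) := fun x => by
  induction x using TensorProduct.induction_on with
  | zero => simp
  | add x y hx hy => rw [map_add, map_add, hx, hy, map_add]; ring
  | tmul x y =>
    rw [vir_tensor_tmul hY hZ, map_add, TensorProduct.dualDistrib_apply,
      TensorProduct.dualDistrib_apply, TensorProduct.dualDistrib_apply, hψ, hφ]
    ring

namespace HomogeneousMode

/-- The index of the coefficient picked out by a homogeneous mode. -/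
def index (x : D.HomogeneousMode Y₁ Y₂ Y₃) : ℂ := x.wt₁ + x.wt₂ - x.wt₃ - 1

/-- The linear functional `𝒴 ↦ ψ (uₙ v)`. -/
def eval (x : D.HomogeneousMode Y₁ Y₂ Y₃) : Module.Dual ℂ (M₁ →ₗ[ℂ] ℂ → M₂ →ₗ[ℂ] M₃) :=
  x.ψ ∘ₗ modeAt x.u x.index x.v

/-- The linear functional `𝒴 ↦ (ψ ⊗ φ) ((u ⊗ u')ₙ (v ⊗ v'))`. -/
def pairEval (x : D.HomogeneousMode Y₁ Y₂ Y₃) (y : E.HomogeneousMode Z₁ Z₂ Z₃) :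
    Module.Dual ℂ (M₁ ⊗[ℂ] N₁ →ₗ[ℂ] ℂ → M₂ ⊗[ℂ] N₂ →ₗ[ℂ] M₃ ⊗[ℂ] N₃) :=
  TensorProduct.dualDistrib ℂ M₃ N₃ (x.ψ ⊗ₜ y.ψ) ∘ₗ
    modeAt (x.u ⊗ₜ y.u) (x.index + y.index + 1) (x.v ⊗ₜ y.v)

theorem apply_eq_zero (x : D.HomogeneousMode Y₁ Y₂ Y₃) (h : D.IsIntertwining Y₁ Y₂ Y₃ 𝒴) {n : ℂ}
    (hn : n ≠ x.index) : x.ψ (𝒴 x.u n x.v) = 0 :=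
  x.functional.apply_eq_zero (h.mem_weightSpace x.u_mem x.v_mem n)
    fun h0 => hn (by rw [index, ← h0]; ring)

/-- By weights only the term `i = x.index` contributes. The `1` in the total index compensates for
the one in `n - 1 - i`, so that the second index is `y.index`. -/
theorem pairEval_tensorIntertwiner (x : D.HomogeneousMode Y₁ Y₂ Y₃)
    (y : E.HomogeneousMode Z₁ Z₂ Z₃) (h : D.IsIntertwining Y₁ Y₂ Y₃ 𝒴) (ht : HasTensor 𝒴 𝒵) :
    x.pairEval y (tensorIntertwiner ht) = x.eval 𝒴 * y.eval 𝒵 := by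
  show TensorProduct.dualDistrib ℂ M₃ N₃ (x.ψ ⊗ₜ y.ψ)
    (tensorIntertwiner ht (x.u ⊗ₜ y.u) (x.index + y.index + 1) (x.v ⊗ₜ y.v)) = _
  rw [tensorIntertwiner_tmul, map_finsum _ (ht _ _ _ _ _), finsum_eq_single _ x.index]
  · rw [TensorProduct.dualDistrib_apply, show x.index + y.index + 1 - 1 - x.index = y.index by ring]
    rfl
  · intro i hi
    rw [TensorProduct.dualDistrib_apply, x.apply_eq_zero h hi, zero_mul]

end HomogeneousMode

theorem IsIntertwining.eq_zero_of_eval (h₁ : D.IsModule Y₁) (h₂ : D.IsModule Y₂)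
    (h₃ : D.IsModule Y₃) (h : D.IsIntertwining Y₁ Y₂ Y₃ 𝒴)
    (h0 : ∀ x : D.HomogeneousMode Y₁ Y₂ Y₃, x.eval 𝒴 = 0) : 𝒴 = 0 := by
  refine LinearMap.ext fun u => funext fun n => LinearMap.ext fun v => ?_
  show 𝒴 u n v = 0
  induction u using h₁.induction_on with
  | zero => rw [map_zero]; rfl
  | add x y hx hy => rw [map_add, Pi.add_apply, LinearMap.add_apply, hx, hy, add_zero]
  | mem s u hu =>
    induction v using h₂.induction_on with
    | zero => exact map_zero _
    | add x y hx hy => rw [map_add, hx, hy, add_zero]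
    | mem t v hv =>
      by_contra hne
      obtain ⟨r, ψ, hψ, hne'⟩ := h₃.exists_homogeneousFunctional hne
      let x : D.HomogeneousMode Y₁ Y₂ Y₃ := ⟨s, t, r, u, v, ψ, hu, hv, hψ⟩
      by_cases hn : n = x.index
      · subst hn
        exact hne' (h0 x)
      · exact hne' (x.apply_eq_zero h hn)

/-- Products of homogeneous functionals separate the points of `M₃ ⊗ N₃`. The sum of their weights,
with the weights of the vectors, excludes every index except the one in `pairEval`, so no module
property of `M₃ ⊗ N₃` is needed. -/
theorem IsIntertwining.eq_zero_of_pairEval (hY₁ : D.IsModule Y₁) (hY₂ : D.IsModule Y₂)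
    (hY₃ : D.IsModule Y₃) (hZ₁ : E.IsModule Z₁) (hZ₂ : E.IsModule Z₂) (hZ₃ : E.IsModule Z₃)
    {𝒳 : M₁ ⊗[ℂ] N₁ →ₗ[ℂ] ℂ → M₂ ⊗[ℂ] N₂ →ₗ[ℂ] M₃ ⊗[ℂ] N₃}
    (h : (D.tensor E).IsIntertwining (tensorAction Y₁ Z₁) (tensorAction Y₂ Z₂)
      (tensorAction Y₃ Z₃) 𝒳)
    (h0 : ∀ (x : D.HomogeneousMode Y₁ Y₂ Y₃) (y : E.HomogeneousMode Z₁ Z₂ Z₃),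
      x.pairEval y 𝒳 = 0) : 𝒳 = 0 := by
  refine TensorProduct.ext' fun u u' => funext fun n => TensorProduct.ext' fun v v' => ?_
  show 𝒳 (u ⊗ₜ u') n (v ⊗ₜ v') = 0
  induction u using hY₁.induction_on with
  | zero => rw [TensorProduct.zero_tmul, map_zero]; rfl
  | add x y hx hy =>
    rw [TensorProduct.add_tmul, map_add, Pi.add_apply, LinearMap.add_apply, hx, hy, add_zero]
  | mem s u hu =>
  induction u' using hZ₁.induction_on with
  | zero => rw [TensorProduct.tmul_zero, map_zero]; rfl
  | add x y hx hy =>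
    rw [TensorProduct.tmul_add, map_add, Pi.add_apply, LinearMap.add_apply, hx, hy, add_zero]
  | mem s' u' hu' =>
  induction v using hY₂.induction_on with
  | zero => rw [TensorProduct.zero_tmul, map_zero]
  | add x y hx hy => rw [TensorProduct.add_tmul, map_add, hx, hy, add_zero]
  | mem t v hv =>
  induction v' using hZ₂.induction_on with
  | zero => rw [TensorProduct.tmul_zero, map_zero]
  | add x y hx hy => rw [TensorProduct.tmul_add, map_add, hx, hy, add_zero]
  | mem t' v' hv' =>
  refine tensor_eq_zero_of_separating
    (φ := fun x : {p : ℂ × Module.Dual ℂ M₃ // D.IsHomogeneousFunctional Y₃ p.1 p.2} => x.1.2)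
    (ψ := fun x : {p : ℂ × Module.Dual ℂ N₃ // E.IsHomogeneousFunctional Z₃ p.1 p.2} => x.1.2)
    ?_ ?_ _ ?_
  · intro a ha
    by_contra hne
    obtain ⟨r, ψ, hψ, hne'⟩ := hY₃.exists_homogeneousFunctional hne
    exact hne' (ha ⟨(r, ψ), hψ⟩)
  · intro a ha
    by_contra hne
    obtain ⟨r, ψ, hψ, hne'⟩ := hZ₃.exists_homogeneousFunctional hne
    exact hne' (ha ⟨(r, ψ), hψ⟩)
  · rintro ⟨⟨r, ψ⟩, hψ⟩ ⟨⟨r', φ⟩, hφ⟩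
    let x : D.HomogeneousMode Y₁ Y₂ Y₃ := ⟨s, t, r, u, v, ψ, hu, hv, hψ⟩
    let y : E.HomogeneousMode Z₁ Z₂ Z₃ := ⟨s', t', r', u', v', φ, hu', hv', hφ⟩
    by_cases hn : n = x.index + y.index + 1
    · subst hn
      exact h0 x y
    · refine (hψ.tmul hY₃.toIsWeakModule hZ₃.toIsWeakModule hφ).apply_eq_zero
        (h.mem_weightSpace (tmul_mem_weightSpace hY₁.toIsWeakModule hZ₁.toIsWeakModule hu hu')
          (tmul_mem_weightSpace hY₂.toIsWeakModule hZ₂.toIsWeakModule hv hv') n) fun h1 => hn ?_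
      show n = s + t - r - 1 + (s' + t' - r' - 1) + 1
      linear_combination -h1

/-- `IsIntertwining.slice` for `a ↦ a ⊗ 𝟏` and `b = 𝟏 ⊗ ω²`: here `b₁ = 1 ⊗ L(0)` acts on the fixed
homogeneous data by their weights. The resulting exponent `y.wt₁ + y.wt₂ - y.wt₃` is `y.index + 1`,
which matches the index in `pairEval`. -/
theorem exists_left_slice (hY₁ : D.IsModule Y₁) (hY₂ : D.IsModule Y₂)
    (hY₃ : D.IsModule Y₃) (hZ₁ : E.IsModule Z₁) (hZ₂ : E.IsModule Z₂) (hZ₃ : E.IsModule Z₃)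
    {𝒳 : M₁ ⊗[ℂ] N₁ →ₗ[ℂ] ℂ → M₂ ⊗[ℂ] N₂ →ₗ[ℂ] M₃ ⊗[ℂ] N₃}
    (h : (D.tensor E).IsIntertwining (tensorAction Y₁ Z₁) (tensorAction Y₂ Z₂)
      (tensorAction Y₃ Z₃) 𝒳) (y : E.HomogeneousMode Z₁ Z₂ Z₃) :
    ∃ 𝒴, D.IsIntertwining Y₁ Y₂ Y₃ 𝒴 ∧
      ∀ x : D.HomogeneousMode Y₁ Y₂ Y₃, x.eval 𝒴 = x.pairEval y 𝒳 := by
  let π : M₃ ⊗[ℂ] N₃ →ₗ[ℂ] M₃ := (TensorProduct.rid ℂ M₃).toLinearMap ∘ₗ y.ψ.lTensor M₃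
  have hπ : ∀ w z, π (w ⊗ₜ z) = y.ψ z • w := fun w z => by simp [π]
  refine ⟨slice ((TensorProduct.mk ℂ M₁ N₁).flip y.u) ((TensorProduct.mk ℂ M₂ N₂).flip y.v) π
    (y.wt₁ + y.wt₂ - y.wt₃) 𝒳, h.slice (fun a => a ⊗ₜ E.vacuum)
    (fun a p u => tensorAction_tmul_vacuum hZ₁.toIsWeakModule a p u y.u)
    (fun a p v => tensorAction_tmul_vacuum hZ₂.toIsWeakModule a p v y.v) (fun a p w => ?_)
    (b := D.vacuum ⊗ₜ E.conformal)
    (fun u => ?_) (fun u => ?_) (fun v => ?_) (fun w => ?_), fun x => ?_⟩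
  · induction w using TensorProduct.induction_on with
    | zero => simp
    | add w w' hw hw' => simp only [map_add, hw, hw']
    | tmul w z =>
      rw [tensorAction_tmul_vacuum hZ₃.toIsWeakModule, hπ, hπ, map_smul]
  · show (D.tensor E).vir (tensorAction Y₁ Z₁) (-1) (u ⊗ₜ y.u) = D.vir Y₁ (-1) u ⊗ₜ y.u +
      ((tensorAction Y₁ Z₁ (D.vacuum ⊗ₜ E.conformal))[[0]]) (u ⊗ₜ y.u)
    rw [vir_tensor_tmul hY₁.toIsWeakModule hZ₁.toIsWeakModule,
      tensorAction_vacuum_tmul hY₁.toIsWeakModule]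
    rfl
  · show ((tensorAction Y₁ Z₁ (D.vacuum ⊗ₜ E.conformal))[[1]]) (u ⊗ₜ y.u) = y.wt₁ • u ⊗ₜ[ℂ] y.u
    rw [tensorAction_vacuum_tmul hY₁.toIsWeakModule, ← TensorProduct.tmul_smul,
      ← Module.End.mem_eigenspace_iff.1 y.u_mem]
    rfl
  · show ((tensorAction Y₂ Z₂ (D.vacuum ⊗ₜ E.conformal))[[1]]) (v ⊗ₜ y.v) = y.wt₂ • v ⊗ₜ[ℂ] y.v
    rw [tensorAction_vacuum_tmul hY₂.toIsWeakModule, ← TensorProduct.tmul_smul,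
      ← Module.End.mem_eigenspace_iff.1 y.v_mem]
    rfl
  · induction w using TensorProduct.induction_on with
    | zero => simp
    | add w w' hw hw' => simp only [map_add, hw, hw', smul_add]
    | tmul w z =>
      rw [tensorAction_vacuum_tmul hY₃.toIsWeakModule, hπ, hπ, smul_smul, ← y.functional]
      rfl
  · have e : x.ψ ∘ₗ π = TensorProduct.dualDistrib ℂ M₃ N₃ (x.ψ ⊗ₜ y.ψ) :=
      TensorProduct.ext' fun w z => by
        rw [LinearMap.comp_apply, hπ, map_smul, TensorProduct.dualDistrib_apply, smul_eq_mul,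
          mul_comm]
    rw [HomogeneousMode.pairEval, ← e,
      show x.index + y.index + 1 = x.index + (y.wt₁ + y.wt₂ - y.wt₃) by
        simp only [HomogeneousMode.index]; ring]
    rfl

theorem exists_right_slice (hY₁ : D.IsModule Y₁) (hY₂ : D.IsModule Y₂)
    (hY₃ : D.IsModule Y₃) (hZ₁ : E.IsModule Z₁) (hZ₂ : E.IsModule Z₂) (hZ₃ : E.IsModule Z₃)
    {𝒳 : M₁ ⊗[ℂ] N₁ →ₗ[ℂ] ℂ → M₂ ⊗[ℂ] N₂ →ₗ[ℂ] M₃ ⊗[ℂ] N₃}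
    (h : (D.tensor E).IsIntertwining (tensorAction Y₁ Z₁) (tensorAction Y₂ Z₂)
      (tensorAction Y₃ Z₃) 𝒳) (x : D.HomogeneousMode Y₁ Y₂ Y₃) :
    ∃ 𝒵, E.IsIntertwining Z₁ Z₂ Z₃ 𝒵 ∧
      ∀ y : E.HomogeneousMode Z₁ Z₂ Z₃, y.eval 𝒵 = x.pairEval y 𝒳 := by
  let π : M₃ ⊗[ℂ] N₃ →ₗ[ℂ] N₃ := (TensorProduct.lid ℂ N₃).toLinearMap ∘ₗ x.ψ.rTensor N₃
  have hπ : ∀ w z, π (w ⊗ₜ z) = x.ψ w • z := fun w z => by simp [π]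
  refine ⟨slice (TensorProduct.mk ℂ M₁ N₁ x.u) (TensorProduct.mk ℂ M₂ N₂ x.v) π
    (x.wt₁ + x.wt₂ - x.wt₃) 𝒳, h.slice (fun b => D.vacuum ⊗ₜ b)
    (fun b p u => tensorAction_vacuum_tmul hY₁.toIsWeakModule b p x.u u)
    (fun b p v => tensorAction_vacuum_tmul hY₂.toIsWeakModule b p x.v v) (fun b p w => ?_)
    (b := D.conformal ⊗ₜ E.vacuum)
    (fun u => ?_) (fun u => ?_) (fun v => ?_) (fun w => ?_), fun y => ?_⟩
  · induction w using TensorProduct.induction_on with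
    | zero => simp
    | add w w' hw hw' => simp only [map_add, hw, hw']
    | tmul w z =>
      rw [tensorAction_vacuum_tmul hY₃.toIsWeakModule, hπ, hπ, map_smul]
  · show (D.tensor E).vir (tensorAction Y₁ Z₁) (-1) (x.u ⊗ₜ u) = x.u ⊗ₜ E.vir Z₁ (-1) u +
      ((tensorAction Y₁ Z₁ (D.conformal ⊗ₜ E.vacuum))[[0]]) (x.u ⊗ₜ u)
    rw [vir_tensor_tmul hY₁.toIsWeakModule hZ₁.toIsWeakModule,
      tensorAction_tmul_vacuum hZ₁.toIsWeakModule, add_comm]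
    rfl
  · show ((tensorAction Y₁ Z₁ (D.conformal ⊗ₜ E.vacuum))[[1]]) (x.u ⊗ₜ u) = x.wt₁ • x.u ⊗ₜ[ℂ] u
    rw [tensorAction_tmul_vacuum hZ₁.toIsWeakModule, TensorProduct.smul_tmul',
      ← Module.End.mem_eigenspace_iff.1 x.u_mem]
    rfl
  · show ((tensorAction Y₂ Z₂ (D.conformal ⊗ₜ E.vacuum))[[1]]) (x.v ⊗ₜ v) = x.wt₂ • x.v ⊗ₜ[ℂ] v
    rw [tensorAction_tmul_vacuum hZ₂.toIsWeakModule, TensorProduct.smul_tmul',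
      ← Module.End.mem_eigenspace_iff.1 x.v_mem]
    rfl
  · induction w using TensorProduct.induction_on with
    | zero => simp
    | add w w' hw hw' => simp only [map_add, hw, hw', smul_add]
    | tmul w z =>
      rw [tensorAction_tmul_vacuum hZ₃.toIsWeakModule, hπ, hπ, smul_smul, ← x.functional]
      rfl
  · have e : y.ψ ∘ₗ π = TensorProduct.dualDistrib ℂ M₃ N₃ (x.ψ ⊗ₜ y.ψ) :=
      TensorProduct.ext' fun w z => by
        rw [LinearMap.comp_apply, hπ, map_smul, TensorProduct.dualDistrib_apply, smul_eq_mul]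
    rw [HomogeneousMode.pairEval, ← e,
      show x.index + y.index + 1 = y.index + (x.wt₁ + x.wt₂ - x.wt₃) by
        simp only [HomogeneousMode.index]; ring]
    rfl

end HomogeneousModes

end VertexData

/-! ### Bilinearity of the product -/

section TensorIntertwiner

variable {M₁ M₂ M₃ N₁ N₂ N₃ : Type*}
  [AddCommGroup M₁] [Module ℂ M₁] [AddCommGroup M₂] [Module ℂ M₂] [AddCommGroup M₃] [Module ℂ M₃]
  [AddCommGroup N₁] [Module ℂ N₁] [AddCommGroup N₂] [Module ℂ N₂] [AddCommGroup N₃] [Module ℂ N₃]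
  {𝒴 𝒴' : M₁ →ₗ[ℂ] ℂ → M₂ →ₗ[ℂ] M₃} {𝒵 𝒵' : N₁ →ₗ[ℂ] ℂ → N₂ →ₗ[ℂ] N₃}

theorem modeMap_ext {𝒳 𝒳' : M₁ ⊗[ℂ] N₁ →ₗ[ℂ] ℂ → M₂ ⊗[ℂ] N₂ →ₗ[ℂ] M₃ ⊗[ℂ] N₃}
    (h : ∀ u₁ v₁ n u₂ v₂, 𝒳 (u₁ ⊗ₜ v₁) n (u₂ ⊗ₜ v₂) = 𝒳' (u₁ ⊗ₜ v₁) n (u₂ ⊗ₜ v₂)) : 𝒳 = 𝒳' :=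
  TensorProduct.ext' fun u₁ v₁ => funext fun n => TensorProduct.ext' fun u₂ v₂ => h u₁ v₁ n u₂ v₂

theorem tensorIntertwiner_add_left (h : HasTensor 𝒴 𝒵) (h' : HasTensor 𝒴' 𝒵)
    (h'' : HasTensor (𝒴 + 𝒴') 𝒵) :
    tensorIntertwiner h'' = tensorIntertwiner h + tensorIntertwiner h' :=
  modeMap_ext fun u₁ v₁ n u₂ v₂ => by
    rw [LinearMap.add_apply, Pi.add_apply, LinearMap.add_apply, tensorIntertwiner_tmul,
      tensorIntertwiner_tmul, tensorIntertwiner_tmul,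
      ← finsum_add_distrib (h u₁ u₂ v₁ v₂ n) (h' u₁ u₂ v₁ v₂ n)]
    exact finsum_congr fun i => TensorProduct.add_tmul _ _ _

theorem tensorIntertwiner_add_right (h : HasTensor 𝒴 𝒵) (h' : HasTensor 𝒴 𝒵')
    (h'' : HasTensor 𝒴 (𝒵 + 𝒵')) :
    tensorIntertwiner h'' = tensorIntertwiner h + tensorIntertwiner h' :=
  modeMap_ext fun u₁ v₁ n u₂ v₂ => by
    rw [LinearMap.add_apply, Pi.add_apply, LinearMap.add_apply, tensorIntertwiner_tmul,
      tensorIntertwiner_tmul, tensorIntertwiner_tmul,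
      ← finsum_add_distrib (h u₁ u₂ v₁ v₂ n) (h' u₁ u₂ v₁ v₂ n)]
    exact finsum_congr fun i => TensorProduct.tmul_add _ _ _

theorem tensorIntertwiner_smul_left (c : ℂ) (h : HasTensor 𝒴 𝒵) (h' : HasTensor (c • 𝒴) 𝒵) :
    tensorIntertwiner h' = c • tensorIntertwiner h :=
  modeMap_ext fun u₁ v₁ n u₂ v₂ => by
    rw [LinearMap.smul_apply, Pi.smul_apply, LinearMap.smul_apply, tensorIntertwiner_tmul,
      tensorIntertwiner_tmul, smul_finsum' c (h u₁ u₂ v₁ v₂ n)]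
    exact finsum_congr fun i => (TensorProduct.smul_tmul' _ _ _).symm

theorem tensorIntertwiner_smul_right (c : ℂ) (h : HasTensor 𝒴 𝒵) (h' : HasTensor 𝒴 (c • 𝒵)) :
    tensorIntertwiner h' = c • tensorIntertwiner h :=
  modeMap_ext fun u₁ v₁ n u₂ v₂ => by
    rw [LinearMap.smul_apply, Pi.smul_apply, LinearMap.smul_apply, tensorIntertwiner_tmul,
      tensorIntertwiner_tmul, smul_finsum' c (h u₁ u₂ v₁ v₂ n)]
    exact finsum_congr fun i => TensorProduct.tmul_smul _ _ _

end TensorIntertwiner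

/-! ### The map `σ` and the fusion rules -/

namespace VertexData

variable {V W M₁ M₂ M₃ N₁ N₂ N₃ : Type*} [AddCommGroup V] [Module ℂ V] [AddCommGroup W] [Module ℂ W]
  [AddCommGroup M₁] [Module ℂ M₁] [AddCommGroup M₂] [Module ℂ M₂] [AddCommGroup M₃] [Module ℂ M₃]
  [AddCommGroup N₁] [Module ℂ N₁] [AddCommGroup N₂] [Module ℂ N₂] [AddCommGroup N₃] [Module ℂ N₃]
  {D : VertexData V} {E : VertexData W}
  {Y₁ : V →ₗ[ℂ] VertexOperator ℂ M₁} {Y₂ : V →ₗ[ℂ] VertexOperator ℂ M₂}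
  {Y₃ : V →ₗ[ℂ] VertexOperator ℂ M₃}
  {Z₁ : W →ₗ[ℂ] VertexOperator ℂ N₁} {Z₂ : W →ₗ[ℂ] VertexOperator ℂ N₂}
  {Z₃ : W →ₗ[ℂ] VertexOperator ℂ N₃}

theorem finite_intCoset_of_finite (hf : Module.Finite ℂ (D.intertwiners Y₁ Y₂ Y₃))
    {𝒴 : M₁ →ₗ[ℂ] ℂ → M₂ →ₗ[ℂ] M₃} (h : D.IsIntertwining Y₁ Y₂ Y₃ 𝒴) (u : M₁) (v : M₂) :
    (intCoset '' {i | 𝒴 u i v ≠ 0}).Finite := by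
  have hf' : Module.Finite ℂ (D.finiteCosetIntertwiners Y₁ Y₂ Y₃) :=
    finite_of_injective (Submodule.inclusion finiteCosetIntertwiners_le)
      (Submodule.inclusion_injective _)
  exact finite_intCoset_of_mem ((finiteCosetIntertwiners_eq hf').ge h) u v

theorem hasTensor_of_finite (hY₁ : D.IsModule Y₁) (hY₂ : D.IsModule Y₂)
    (hZ₁ : E.IsModule Z₁) (hZ₂ : E.IsModule Z₂) {𝒴 : M₁ →ₗ[ℂ] ℂ → M₂ →ₗ[ℂ] M₃}
    {𝒵 : N₁ →ₗ[ℂ] ℂ → N₂ →ₗ[ℂ] N₃}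
    (h : D.IsIntertwining Y₁ Y₂ Y₃ 𝒴) (h' : E.IsIntertwining Z₁ Z₂ Z₃ 𝒵)
    (hfin : D.FinitelyManyCosets Y₃ ∨ E.FinitelyManyCosets Z₃ ∨
      Module.Finite ℂ (D.intertwiners Y₁ Y₂ Y₃) ∨ Module.Finite ℂ (E.intertwiners Z₁ Z₂ Z₃)) :
    HasTensor 𝒴 𝒵 := by
  rcases hfin with hf | hf | hf | hf
  · exact h.hasTensor_of_left h' (hf.finite_intCoset hY₁ hY₂ h)
  · exact h.hasTensor_of_right h' (hf.finite_intCoset hZ₁ hZ₂ h')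
  · exact h.hasTensor_of_left h' (finite_intCoset_of_finite hf h)
  · exact h.hasTensor_of_right h' (finite_intCoset_of_finite hf h')

/-- The linear map `𝒴 ⊗ 𝒵 ↦ 𝒴(·, z) ⊗ 𝒵(·, z)` on spaces of intertwining operators for which the
products are well defined. -/
def tensorMap (hD : D.IsVOA) (hY₁ : D.IsModule Y₁) (hY₂ : D.IsModule Y₂) (hZ₁ : E.IsModule Z₁)
    {P : Submodule ℂ (M₁ →ₗ[ℂ] ℂ → M₂ →ₗ[ℂ] M₃)} {Q : Submodule ℂ (N₁ →ₗ[ℂ] ℂ → N₂ →ₗ[ℂ] N₃)}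
    (hP : P ≤ D.intertwiners Y₁ Y₂ Y₃) (hQ : Q ≤ E.intertwiners Z₁ Z₂ Z₃)
    (ht : ∀ (𝒴 : P) (𝒵 : Q), HasTensor 𝒴.1 𝒵.1) :
    P ⊗[ℂ] Q →ₗ[ℂ] (D.tensor E).intertwiners (tensorAction Y₁ Z₁) (tensorAction Y₂ Z₂)
      (tensorAction Y₃ Z₃) :=
  TensorProduct.lift <| LinearMap.mk₂ ℂ
    (fun 𝒴 𝒵 => ⟨tensorIntertwiner (ht 𝒴 𝒵),
      isIntertwining_tensorIntertwiner hD hY₁ hY₂ hZ₁ (hP 𝒴.2) (hQ 𝒵.2) (ht 𝒴 𝒵)⟩)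
    (fun 𝒴 𝒴' 𝒵 => Subtype.ext (tensorIntertwiner_add_left (ht 𝒴 𝒵) (ht 𝒴' 𝒵) (ht (𝒴 + 𝒴') 𝒵)))
    (fun c 𝒴 𝒵 => Subtype.ext (tensorIntertwiner_smul_left c (ht 𝒴 𝒵) (ht (c • 𝒴) 𝒵)))
    (fun 𝒴 𝒵 𝒵' => Subtype.ext (tensorIntertwiner_add_right (ht 𝒴 𝒵) (ht 𝒴 𝒵') (ht 𝒴 (𝒵 + 𝒵'))))
    (fun c 𝒴 𝒵 => Subtype.ext (tensorIntertwiner_smul_right c (ht 𝒴 𝒵) (ht 𝒴 (c • 𝒵))))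

theorem eq_zero_of_eval_subtype (hY₁ : D.IsModule Y₁) (hY₂ : D.IsModule Y₂) (hY₃ : D.IsModule Y₃)
    {P : Submodule ℂ (M₁ →ₗ[ℂ] ℂ → M₂ →ₗ[ℂ] M₃)} (hP : P ≤ D.intertwiners Y₁ Y₂ Y₃) (𝒴 : P)
    (h : ∀ x : D.HomogeneousMode Y₁ Y₂ Y₃, (x.eval ∘ₗ P.subtype) 𝒴 = 0) : 𝒴 = 0 :=
  Subtype.ext (IsIntertwining.eq_zero_of_eval hY₁ hY₂ hY₃ (hP 𝒴.2) h)

theorem pairEval_tensorMap_tmul (hD : D.IsVOA) (hY₁ : D.IsModule Y₁) (hY₂ : D.IsModule Y₂)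
    (hZ₁ : E.IsModule Z₁)
    {P : Submodule ℂ (M₁ →ₗ[ℂ] ℂ → M₂ →ₗ[ℂ] M₃)} {Q : Submodule ℂ (N₁ →ₗ[ℂ] ℂ → N₂ →ₗ[ℂ] N₃)}
    (hP : P ≤ D.intertwiners Y₁ Y₂ Y₃) (hQ : Q ≤ E.intertwiners Z₁ Z₂ Z₃)
    (ht : ∀ (𝒴 : P) (𝒵 : Q), HasTensor 𝒴.1 𝒵.1)
    (x : D.HomogeneousMode Y₁ Y₂ Y₃) (y : E.HomogeneousMode Z₁ Z₂ Z₃) (𝒴 : P) (𝒵 : Q) :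
    (x.pairEval y ∘ₗ Submodule.subtype _) (tensorMap hD hY₁ hY₂ hZ₁ hP hQ ht (𝒴 ⊗ₜ 𝒵)) =
      (x.eval ∘ₗ P.subtype) 𝒴 * (y.eval ∘ₗ Q.subtype) 𝒵 :=
  x.pairEval_tensorIntertwiner y (hP 𝒴.2) (ht 𝒴 𝒵)

/-- Subspaces `P` and `Q` are allowed for the sake of infinite fusion rules, where `tensorMap` is
used on `finiteCosetIntertwiners`. -/
theorem tensorMap_injective (hD : D.IsVOA) (hY₁ : D.IsModule Y₁) (hY₂ : D.IsModule Y₂)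
    (hY₃ : D.IsModule Y₃) (hZ₁ : E.IsModule Z₁) (hZ₂ : E.IsModule Z₂) (hZ₃ : E.IsModule Z₃)
    {P : Submodule ℂ (M₁ →ₗ[ℂ] ℂ → M₂ →ₗ[ℂ] M₃)} {Q : Submodule ℂ (N₁ →ₗ[ℂ] ℂ → N₂ →ₗ[ℂ] N₃)}
    (hP : P ≤ D.intertwiners Y₁ Y₂ Y₃) (hQ : Q ≤ E.intertwiners Z₁ Z₂ Z₃)
    (ht : ∀ (𝒴 : P) (𝒵 : Q), HasTensor 𝒴.1 𝒵.1) :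
    Function.Injective (tensorMap hD hY₁ hY₂ hZ₁ hP hQ ht) :=
  injective_of_separating (eq_zero_of_eval_subtype hY₁ hY₂ hY₃ hP)
    (eq_zero_of_eval_subtype hZ₁ hZ₂ hZ₃ hQ) (pairEval_tensorMap_tmul hD hY₁ hY₂ hZ₁ hP hQ ht)

theorem tensorMap_bijective (hD : D.IsVOA) (hY₁ : D.IsModule Y₁) (hY₂ : D.IsModule Y₂)
    (hY₃ : D.IsModule Y₃) (hZ₁ : E.IsModule Z₁) (hZ₂ : E.IsModule Z₂) (hZ₃ : E.IsModule Z₃)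
    (ht : ∀ (𝒴 : D.intertwiners Y₁ Y₂ Y₃) (𝒵 : E.intertwiners Z₁ Z₂ Z₃), HasTensor 𝒴.1 𝒵.1)
    (hfin : Module.Finite ℂ (D.intertwiners Y₁ Y₂ Y₃) ∨
      Module.Finite ℂ (E.intertwiners Z₁ Z₂ Z₃)) :
    Function.Bijective (tensorMap hD hY₁ hY₂ hZ₁ le_rfl le_rfl ht) := by
  refine bijective_of_slices (eq_zero_of_eval_subtype hY₁ hY₂ hY₃ le_rfl)
    (eq_zero_of_eval_subtype hZ₁ hZ₂ hZ₃ le_rfl) (fun 𝒳 h => Subtype.ext ?_)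
    (pairEval_tensorMap_tmul hD hY₁ hY₂ hZ₁ le_rfl le_rfl ht) (fun 𝒳 y => ?_) (fun 𝒳 x => ?_) hfin
  · exact IsIntertwining.eq_zero_of_pairEval hY₁ hY₂ hY₃ hZ₁ hZ₂ hZ₃ 𝒳.2 h
  · obtain ⟨𝒴, h𝒴, h⟩ := exists_left_slice hY₁ hY₂ hY₃ hZ₁ hZ₂ hZ₃ 𝒳.2 y
    exact ⟨⟨𝒴, h𝒴⟩, h⟩
  · obtain ⟨𝒵, h𝒵, h⟩ := exists_right_slice hY₁ hY₂ hY₃ hZ₁ hZ₂ hZ₃ 𝒳.2 x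
    exact ⟨⟨𝒵, h𝒵⟩, h⟩

theorem fusionRule_tensor (hD : D.IsVOA) (hY₁ : D.IsModule Y₁) (hY₂ : D.IsModule Y₂)
    (hY₃ : D.IsModule Y₃) (hZ₁ : E.IsModule Z₁) (hZ₂ : E.IsModule Z₂) (hZ₃ : E.IsModule Z₃) :
    (D.tensor E).fusionRule (tensorAction Y₁ Z₁) (tensorAction Y₂ Z₂) (tensorAction Y₃ Z₃) =
      D.fusionRule Y₁ Y₂ Y₃ * E.fusionRule Z₁ Z₂ Z₃ := by
  by_cases hfin : Module.Finite ℂ (D.intertwiners Y₁ Y₂ Y₃) ∨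
      Module.Finite ℂ (E.intertwiners Z₁ Z₂ Z₃)
  · exact toENat_rank_of_bijective (tensorMap_bijective hD hY₁ hY₂ hY₃ hZ₁ hZ₂ hZ₃
      (fun 𝒴 𝒵 => hasTensor_of_finite hY₁ hY₂ hZ₁ hZ₂ 𝒴.2 𝒵.2 (Or.inr (Or.inr hfin))) hfin)
  · rw [not_or] at hfin
    -- With both spaces infinite-dimensional, some products may be undefined. The operators with
    -- exponents in finitely many cosets can be multiplied with all of `I₂`, and they are enough to
    -- make `I₁₂` infinite-dimensional.
    have hP : ¬ Module.Finite ℂ (D.finiteCosetIntertwiners Y₁ Y₂ Y₃) := fun hf =>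
      hfin.1 (finiteCosetIntertwiners_eq hf ▸ hf)
    obtain ⟨𝒵, h𝒵⟩ := exists_ne_zero_of_not_finite hfin.2
    have hinf := not_finite_of_injective (tensorMap_injective hD hY₁ hY₂ hY₃ hZ₁ hZ₂ hZ₃
      finiteCosetIntertwiners_le le_rfl fun 𝒴 𝒵 => IsIntertwining.hasTensor_of_left
        (finiteCosetIntertwiners_le 𝒴.2) 𝒵.2 (finite_intCoset_of_mem 𝒴.2)) hP h𝒵
    rw [fusionRule, fusionRule, fusionRule, toENat_rank_eq_top hinf, toENat_rank_eq_top hfin.1,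
      toENat_rank_eq_top hfin.2, ENat.top_mul ENat.top_ne_zero]

end VertexData

end

theorem theorem2p6
    {V W M₁ M₂ M₃ N₁ N₂ N₃ : Type*} [AddCommGroup V] [Module ℂ V] [AddCommGroup W] [Module ℂ W]
    [AddCommGroup M₁] [Module ℂ M₁] [AddCommGroup M₂] [Module ℂ M₂] [AddCommGroup M₃] [Module ℂ M₃]
    [AddCommGroup N₁] [Module ℂ N₁] [AddCommGroup N₂] [Module ℂ N₂] [AddCommGroup N₃] [Module ℂ N₃]
    (D : VertexData V) (E : VertexData W)
    (Y₁ : V →ₗ[ℂ] VertexOperator ℂ M₁) (Y₂ : V →ₗ[ℂ] VertexOperator ℂ M₂)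
    (Y₃ : V →ₗ[ℂ] VertexOperator ℂ M₃)
    (Z₁ : W →ₗ[ℂ] VertexOperator ℂ N₁) (Z₂ : W →ₗ[ℂ] VertexOperator ℂ N₂)
    (Z₃ : W →ₗ[ℂ] VertexOperator ℂ N₃)
    (hD : D.IsVOA) (hE : E.IsVOA)
    (hY₁ : D.IsModule Y₁) (hY₂ : D.IsModule Y₂) (hY₃ : D.IsModule Y₃)
    (hZ₁ : E.IsModule Z₁) (hZ₂ : E.IsModule Z₂) (hZ₃ : E.IsModule Z₃) :
    -- in these cases all products of intertwining operators are well defined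
    ((D.FinitelyManyCosets Y₃ ∨ E.FinitelyManyCosets Z₃ ∨
        FiniteDimensional ℂ (D.intertwiners Y₁ Y₂ Y₃) ∨
        FiniteDimensional ℂ (E.intertwiners Z₁ Z₂ Z₃)) →
      ∀ (𝒴₁ : D.intertwiners Y₁ Y₂ Y₃) (𝒴₂ : E.intertwiners Z₁ Z₂ Z₃), HasTensor 𝒴₁.1 𝒴₂.1) ∧
    -- whenever they are, the linear map `σ` is defined and injective, and it is bijective if one of
    -- the two spaces is finite-dimensional
    ((∀ (𝒴₁ : D.intertwiners Y₁ Y₂ Y₃) (𝒴₂ : E.intertwiners Z₁ Z₂ Z₃), HasTensor 𝒴₁.1 𝒴₂.1) →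
      ∃ σ : D.intertwiners Y₁ Y₂ Y₃ ⊗[ℂ] E.intertwiners Z₁ Z₂ Z₃ →ₗ[ℂ]
          (D.tensor E).intertwiners (tensorAction Y₁ Z₁) (tensorAction Y₂ Z₂)
            (tensorAction Y₃ Z₃),
        (∀ 𝒴₁ 𝒴₂, IsTensor 𝒴₁.1 𝒴₂.1 (σ (𝒴₁ ⊗ₜ 𝒴₂)).1) ∧
        Function.Injective σ ∧
        (FiniteDimensional ℂ (D.intertwiners Y₁ Y₂ Y₃) ∨
            FiniteDimensional ℂ (E.intertwiners Z₁ Z₂ Z₃) →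
          Function.Bijective σ)) ∧
    -- fusion rules are multiplicative
    (D.tensor E).fusionRule (tensorAction Y₁ Z₁) (tensorAction Y₂ Z₂) (tensorAction Y₃ Z₃) =
      D.fusionRule Y₁ Y₂ Y₃ * E.fusionRule Z₁ Z₂ Z₃ := by
  refine ⟨fun hfin 𝒴₁ 𝒴₂ => ?_, fun ht => ⟨VertexData.tensorMap hD hY₁ hY₂ hZ₁ le_rfl le_rfl ht,
    fun 𝒴₁ 𝒴₂ => isTensor_tensorIntertwiner (ht 𝒴₁ 𝒴₂),
    VertexData.tensorMap_injective hD hY₁ hY₂ hY₃ hZ₁ hZ₂ hZ₃ le_rfl le_rfl ht, fun hfin => ?_⟩,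
    VertexData.fusionRule_tensor hD hY₁ hY₂ hY₃ hZ₁ hZ₂ hZ₃⟩
  · exact VertexData.hasTensor_of_finite hY₁ hY₂ hZ₁ hZ₂ 𝒴₁.2 𝒴₂.2 hfin
  · exact VertexData.tensorMap_bijective hD hY₁ hY₂ hY₃ hZ₁ hZ₂ hZ₃ ht hfin
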